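/- **Structure Theorem for Decomposition Spaces.** *Setting.* Let $F$ be a free group of finite rank $>1$ with boundary $\partial F$ (the boundary at infinity of the Cayley tree of $F$ with respect to a free basis). A *multiword* $M$ in a free group is a finite set of words, considered only up to the set of conjugacy classes of maximal cyclic subgroups that it determines. Its *decomposition space* $\mathcal D_M$ is the quotient of the boundary obtained by identifying $gw^{\infty}$ with $gw^{-\infty}$ for all $w\in M$ and all group elements $g$. Assume that $M$ is a multiword in $F$ with $\mathcal D_M$ connected. Let $\Gamma$ be a finite graph of groups decomposition of $F$ relative to $M$ (each word of $M$ is conjugate into a vertex group) with cyclic edge groups, normalized in the following sense. Its Bass–Serre tree $T=\mathcal D(\Gamma)$ is bipartite with vertices of two types; Type 1 vertices are stabilized by maximal cyclic subgroups of $F$, Type 2 vertices are stabilized by non-cyclic subgroups; distinct Type 1 vertices have distinct stabilizers; and each Type 1 vertex has at least two incident edges. (The decomposition consisting of a single Type 2 vertex is allowed.) Let $\mathrm{Aug}_\Gamma(M)$ be the multiword consisting of $M$ and generators of the edge groups of $\Gamma$. For a Type 2 vertex $v$ with stabilizer $G_v$, let $\mathrm{Ind}_\Gamma^{G_v}(M)$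 be the multiword in $G_v$ consisting of the conjugates of words of $M$ that lie in $G_v$, along with generators of the maximal cyclic subgroups of $G_v$ that contain an incident edge group. Let $\overline T=T\cup\partial T$. *Theorem.* Each $G_v$ is free of finite rank, and $X=\mathcal D_{\mathrm{Aug}_\Gamma(M)}$ is a compactified tree of the decomposition spaces of the vertex groups of $\Gamma$. That is, $X$ is compact Hausdorff, and there is an $F$-equivariant surjective quasi-map $\pi\colon X\to\overline T$, whose values are Type 1 vertices, closed stars of Type 2 vertices and points of $\partial T$ (all of these occur), such that: 1. The preimage of each Type 1 vertex $t$ is a single point, which is a cut point of $X$; it is the image of $g^{\infty}$ for every nontrivial $g$ in the stabilizer of $t$. 2. For each Type 2 vertex $v$, the inclusion $G_v\hookrightarrow F$ induces a topological embedding $\mathcal D_{\mathrm{Ind}_\Gamma^{G_v}(M)}\to X$ whose image $X_v$ is the preimage of the closed star of $v$ (the set of points that $\pi$ sends to the closed star of $v$ or to a Type 1 vertex adjacent to $v$). 3. The preimage of each point $\eta\in\partial T$ is a single point. If it is represented by $\xi\in\partial F$, and $g_m\in F$ are the successive vertices of the geodesic ray from the identity to $\xi$, then $g_m v$ converges to $\eta$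 for every vertex $v$ of $T$, in the sense that for each edge of a ray of $T$ representing $\eta$, the vertices $g_mv$ eventually lie on the side of that edge that contains the tail of the ray. 4. For each Type 1 vertex $t$ and each component $B$ of $\overline T\setminus\{t\}$, the set of points that $\pi$ sends into $B$ (a closed star of a Type 2 vertex $v$ counting as lying in the component that contains $v$) is open in $X$. 5. For each Type 2 vertex $v$, the retraction $X\to X_v$ that collapses, for each Type 1 vertex $t$ adjacent to $v$, everything lying over the component of $\overline T\setminus\{v\}$ containing $t$ to the point $\pi^{-1}(t)$ is continuous. -/

import Mathlib

open Filter Topology MulAction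

/-! ### The boundary of a free group and decomposition spaces -/

/-- The boundary at infinity of the Cayley tree of a free group with a basis indexed by `ι`:
geodesic rays issuing from the identity vertex, that is, infinite reduced words. The letter
`(i, true)` is the `i`-th basis element and `(i, false)` is its inverse. -/
def FreeBoundary (ι : Type*) : Type _ :=
  {ξ : ℕ → ι × Bool // ∀ n, ξ (n + 1) ≠ ((ξ n).1, !(ξ n).2)}

/-- The topology of the boundary: the subspace topology of the product topology on infinite
words, with the discrete topology on letters. -/
instance FreeBoundary.instTopologicalSpace (ι : Type*) : TopologicalSpace (FreeBoundary ι) :=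
  letI : TopologicalSpace (ι × Bool) := ⊥
  inferInstanceAs (TopologicalSpace {ξ : ℕ → ι × Bool // ∀ n, ξ (n + 1) ≠ ((ξ n).1, !(ξ n).2)})

section DecompositionSpace

variable {ι F : Type*} [Group F]

open Classical in
/-- The reduced word of `g` in the basis `b`. -/
noncomputable def basisWord (b : FreeGroupBasis ι F) (g : F) : List (ι × Bool) :=
  (b.repr g).toWord

/-- The `m`-th vertex of the geodesic ray `ξ`: the product of its first `m` letters. -/
noncomputable def rayVertex (b : FreeGroupBasis ι F) (ξ : FreeBoundary ι) (m : ℕ) : F :=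
  b.repr.symm (FreeGroup.mk (List.ofFn fun k : Fin m => ξ.1 k))

/-- The sequence of vertices `u` of the Cayley tree converges to the boundary point `ξ`:
each finite initial segment of `ξ` is eventually an initial segment of the reduced word of
`u m`. -/
def ConvergesToBoundary (b : FreeGroupBasis ι F) (u : ℕ → F) (ξ : FreeBoundary ι) : Prop :=
  ∀ n : ℕ, ∀ᶠ m in atTop, ∀ k < n, (basisWord b (u m))[k]? = some (ξ.1 k)

/-- `ξ = g w^∞` and `η = g w^{-∞}` are the two endpoints of the `w`-line through `g`, for some
word `w` of `W` and some `g`. -/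
def LineEndpoints (b : FreeGroupBasis ι F) (W : Set F) (ξ η : FreeBoundary ι) : Prop :=
  ∃ g : F, ∃ w ∈ W, ConvergesToBoundary b (fun m => g * w ^ m) ξ ∧
    ConvergesToBoundary b (fun m => g * w⁻¹ ^ m) η

/-- The decomposition space of the multiword `W`: the quotient of the boundary obtained by
identifying the two endpoints of each line of the line pattern generated by `W`.
It depends only on the set of conjugacy classes of maximal cyclic subgroups determined by `W`,
so `W` is allowed to be any set of representatives of these, repetitions included. -/
def DecompSpace (b : FreeGroupBasis ι F) (W : Set F) : Type _ := Quot (LineEndpoints b W)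

instance DecompSpace.instTopologicalSpace (b : FreeGroupBasis ι F) (W : Set F) :
    TopologicalSpace (DecompSpace b W) :=
  inferInstanceAs (TopologicalSpace (Quot (LineEndpoints b W)))

/-- The quotient map from the boundary to the decomposition space. -/
def decompMap (b : FreeGroupBasis ι F) (W : Set F) : FreeBoundary ι → DecompSpace b W :=
  Quot.mk _

/-- A maximal cyclic subgroup. -/
def IsMaxCyclic (H : Subgroup F) : Prop := Maximal (fun K : Subgroup F => IsCyclic K) H

end DecompositionSpace

/-- A cut point: a point whose complement is not connected. -/
def IsCutPoint {X : Type*} [TopologicalSpace X] (x : X) : Prop := ¬ IsPreconnected ({x}ᶜ : Set X)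

/-! ### Trees, their ends and compactified trees of spaces -/

section Tree

variable {V : Type*}

/-- Geodesic rays in a tree: infinite edge paths without backtracking. -/
def TreeRay (T : SimpleGraph V) : Type _ :=
  {r : ℕ → V // ∀ n, T.Adj (r n) (r (n + 1)) ∧ r n ≠ r (n + 2)}

/-- Two rays are asymptotic if they share a tail. -/
def TreeRay.Asymptotic {T : SimpleGraph V} (r s : TreeRay T) : Prop :=
  ∃ a b : ℕ, ∀ n, r.1 (n + a) = s.1 (n + b)

/-- The boundary at infinity of a tree: geodesic rays up to being asymptotic. -/
def TreeEnd (T : SimpleGraph V) : Type _ := Quot (TreeRay.Asymptotic (T := T))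

/-- The end of a ray. -/
def TreeRay.toEnd {T : SimpleGraph V} (r : TreeRay T) : TreeEnd T := Quot.mk _ r

/-- The closed star of a vertex (its vertices). -/
def closedStar (T : SimpleGraph V) (v : V) : Set V := insert v (T.neighborSet v)

/-- For adjacent vertices `u`, `v` of a tree: the part of the compactified tree lying in the
component of the complement of `u` that contains `v`. -/
def treeBranch (T : SimpleGraph V) (u v : V) : Set (V ⊕ TreeEnd T) :=
  {p | (∃ z : V, p = Sum.inl z ∧ T.dist u z = T.dist v z + 1) ∨
    ∃ r : TreeRay T, p = Sum.inr r.toEnd ∧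
      ∀ᶠ n in atTop, T.dist u (r.1 n) = T.dist v (r.1 n) + 1}

/-- `X` is a compactified tree of the spaces `Y v`, where `v` ranges over the vertices of the
bipartite tree `T` that are not in `type1` (the Type 2 vertices); the Type 1 vertices carry
one-point spaces. The quasi-map `π` to the compactified tree takes as values
Type 1 vertices, closed stars of Type 2 vertices (recorded by the Type 2 vertex itself) and ends.
The conditions say that `X` is, as a set, the union of the pieces `Y v`, glued at the points
corresponding to Type 1 vertices in the pattern of `T`, together with the ends of `T`, and that
its topology is the (compact Hausdorff) one in which the half-spaces cut off by a Type 1 vertex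
are open and the retractions to the pieces, collapsing everything that hangs off a piece at a
Type 1 vertex to the point of that vertex, are continuous. -/
structure IsCompactifiedTreeOfSpaces (T : SimpleGraph V) (type1 : Set V)
    {X : Type*} [TopologicalSpace X]
    {Y : {v : V // v ∉ type1} → Type*} [∀ v, TopologicalSpace (Y v)]
    (j : ∀ v, Y v → X) (π : X → V ⊕ TreeEnd T) : Prop where
  compact : CompactSpace X
  hausdorff : T2Space X
  surjective : Function.Surjective π
  /-- The preimage of a Type 1 vertex is a point. -/
  type1_fiber : ∀ t ∈ type1, ∃! x, π x = Sum.inl t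
  /-- The preimage of an end is a point. -/
  end_fiber : ∀ e : TreeEnd T, ∃! x, π x = Sum.inr e
  /-- Each piece is embedded. -/
  embedding : ∀ v, IsEmbedding (j v)
  /-- The image of each piece is the preimage of the closed star of the Type 2 vertex. -/
  range_piece : ∀ v, Set.range (j v) = {x | ∃ u ∈ closedStar T v.1, π x = Sum.inl u}
  /-- The half-spaces cut off by a Type 1 vertex are open. -/
  isOpen_branch : ∀ t ∈ type1, ∀ v, T.Adj t v → IsOpen (π ⁻¹' treeBranch T t v)
  /-- The retraction to each piece is continuous. -/
  retraction : ∀ v ∉ type1, ∃ ρ : X → X, Continuous ρ ∧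
    (∀ x, π x = Sum.inl v → ρ x = x) ∧
    ∀ t, T.Adj v t → ∀ x, π x ∈ treeBranch T v t → π (ρ x) = Sum.inl t

end Tree

/-! ### Splittings of a free group relative to a multiword -/

/-- A (normalized, bipartite) graph of groups decomposition `Γ` of `F` relative to the multiword
`M`, with cyclic edge groups, given by the action of `F` on its Bass-Serre tree, with vertex
set `V`. Edge stabilizers are subgroups of stabilizers of Type 1 vertices, hence cyclic. -/
structure RelCyclicSplitting {F : Type*} [Group F] (M : Set F) (V : Type*) [MulAction F V] where
  /-- The Bass-Serre tree. -/
  tree : SimpleGraph V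
  isTree : tree.IsTree
  adj_smul : ∀ (g : F) {u v : V}, tree.Adj u v → tree.Adj (g • u) (g • v)
  /-- The vertices of Type 1; all other vertices are of Type 2. -/
  type1 : Set V
  smul_type1 : ∀ (g : F) {v : V}, v ∈ type1 → g • v ∈ type1
  bipartite : ∀ {u v : V}, tree.Adj u v → (u ∈ type1 ↔ v ∉ type1)
  /-- The quotient graph is finite. -/
  finite_vertices : ∃ s : Set V, s.Finite ∧ ∀ v, ∃ g : F, g • v ∈ s
  finite_edges : ∃ s : Set (V × V), s.Finite ∧
    ∀ u v, tree.Adj u v → ∃ g : F, (g • u, g • v) ∈ s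
  /-- Type 1 vertices are stabilized by maximal cyclic subgroups. -/
  stab_type1 : ∀ t ∈ type1, IsMaxCyclic (stabilizer F t)
  /-- Type 2 vertices are stabilized by non-cyclic subgroups. -/
  stab_type2 : ∀ v ∉ type1, ¬ IsCyclic (stabilizer F v)
  /-- Distinct Type 1 vertices have distinct stabilizers (equivalently, the edge groups incident
  to a non-cyclic vertex group are in distinct conjugacy classes of that group). -/
  stab_injOn : Set.InjOn (fun t : V => stabilizer F t) type1
  /-- A Type 1 vertex has at least two incident edges (the degrees of the edge inclusions
  at the corresponding vertex of the graph of groups add up to at least two). -/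
  nontrivial_type1 : ∀ t ∈ type1, (tree.neighborSet t).Nontrivial
  /-- Each word of `M` is conjugate into a vertex group. -/
  elliptic : ∀ w ∈ M, ∃ v : V, w • v = v

namespace RelCyclicSplitting

variable {F : Type*} [Group F] {M : Set F} {V : Type*} [MulAction F V]

/-- The vertices of Type 2. -/
abbrev Type2 (Γ : RelCyclicSplitting M V) : Type _ := {v : V // v ∉ Γ.type1}

/-- The augmented multiword: the words of `M` together with the generators of the
edge groups. -/
def aug (Γ : RelCyclicSplitting M V) : Set F :=
  M ∪ {h | ∃ u v, Γ.tree.Adj u v ∧ Subgroup.zpowers h = stabilizer F u ⊓ stabilizer F v}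

/-- The induced multiword in the vertex group `G = stabilizer F v`: the conjugates of words
of `M` that lie in `G`, together with the generators of the maximal cyclic subgroups of `G`
that contain an incident edge group. -/
def ind (Γ : RelCyclicSplitting M V) (v : V) : Set (stabilizer F v) :=
  {h | ∃ w ∈ M, IsConj w (h : F)} ∪
    {h | IsMaxCyclic (Subgroup.zpowers h) ∧
      ∃ t, Γ.tree.Adj v t ∧ (stabilizer F t).subgroupOf (stabilizer F v) ≤ Subgroup.zpowers h}

/-- The action of `F` on rays of the tree. -/
def smulRay (Γ : RelCyclicSplitting M V) (g : F) (r : TreeRay Γ.tree) : TreeRay Γ.tree :=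
  ⟨fun n => g • r.1 n, fun n =>
    ⟨Γ.adj_smul g (r.2 n).1, fun h => (r.2 n).2 (MulAction.injective g h)⟩⟩

/-- The action of `F` on ends of the tree. -/
def smulEnd (Γ : RelCyclicSplitting M V) (g : F) : TreeEnd Γ.tree → TreeEnd Γ.tree :=
  Quot.map (Γ.smulRay g) fun r s ⟨a, b, h⟩ => ⟨a, b, fun n => by simp only [smulRay, h n]⟩

/-- The action of `F` on the compactified tree. -/
def smulCompactified (Γ : RelCyclicSplitting M V) (g : F) :
    V ⊕ TreeEnd Γ.tree → V ⊕ TreeEnd Γ.tree :=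
  Sum.map (fun v => g • v) (Γ.smulEnd g)

end RelCyclicSplitting

/-! A boundary point `ξ` is handled through the filter of its cones in the Cayley tree, and the tree
of `Γ` is read off from the orbit maps `g ↦ g • u` along that filter. If `ξ` is not in the limit set
of the stabilizer of a vertex `z`, then near `ξ` the translates of a fixed finite walk miss `z`.
Since cones are connected, all orbits eventually stay in one branch at `z`: `ξ` has a direction
there (`exists_toward`). Following directions, `ξ` lands at a Type 1 vertex, at a Type 2 vertex, or
at an end. A Type 1 vertex takes precedence, because its limit set also lies in those of its
neighbours. The landing point is unique (`Lands.unique`). Lines of the augmented pattern are axes of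
elliptic elements, so both their endpoints land at the same place, and landing descends to the
quasi-map `π`.

Connectedness of the decomposition space of `M` enters once: if an edge group were trivial, the two
sides of that edge would split the space into clopen pieces (`exists_edge_stabilizer_ne_one`). Hence
each edge generator is a nonzero power of a generator of the Type 1 stabilizer, which makes the
fibre over a Type 1 vertex a single point and puts it in every adjacent piece.

Vertex groups are finitely generated (`fg_stabilizer_type2`), so their boundaries embed in the
boundary of `F` with closed image the limit set. The limit set of a Type 2 group is exactly what
lands in its closed star. Matching line patterns makes the induced map of decomposition spaces
injective, hence an embedding of a compact space in a Hausdorff one. The target is Hausdorff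
because, for each `n`, only finitely many lines have endpoints that differ in the first `n` letters.

The remaining metric input is the shadow lemma `exists_finite_shadow`: seen from a base vertex, the
part of the boundary behind `z` is small for all but finitely many `z`. It makes fibres over ends
single points and the retractions continuous. Cut points come from the branches at a Type 1 vertex,
which have open preimages, at least two in number. -/

/-! ### Reduced words, cones and convergence to the boundary -/

section Words

variable {ι F : Type*} [Group F] (b : FreeGroupBasis ι F)

/-- The element spelled by a word. -/
noncomputable def wordElem (L : List (ι × Bool)) : F := b.repr.symm (FreeGroup.mk L)

lemma wordElem_append (L L' : List (ι × Bool)) :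
    wordElem b (L ++ L') = wordElem b L * wordElem b L' := by
  simp [wordElem, ← map_mul]

@[simp] lemma wordElem_nil : wordElem b [] = 1 := by
  simp [wordElem, ← FreeGroup.one_eq_mk]

lemma wordElem_basisWord (g : F) : wordElem b (basisWord b g) = g := by
  classical
  simp [wordElem, basisWord, FreeGroup.mk_toWord]

lemma basisWord_wordElem {L : List (ι × Bool)} (h : FreeGroup.IsReduced L) :
    basisWord b (wordElem b L) = L := by
  classical
  simp only [wordElem, basisWord, MulEquiv.apply_symm_apply, FreeGroup.toWord_mk]
  convert h.reduce_eq

lemma isReduced_basisWord (g : F) : FreeGroup.IsReduced (basisWord b g) := by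
  classical exact FreeGroup.isReduced_toWord

lemma basisWord_injective : Function.Injective (basisWord b) := fun g h e => by
  rw [← wordElem_basisWord b g, e, wordElem_basisWord]

@[simp] lemma basisWord_one : basisWord b 1 = [] := by
  simpa using basisWord_wordElem b (L := []) FreeGroup.IsReduced.nil

lemma wordElem_pair (i : ι) (e : Bool) :
    wordElem b [(i, e)] * wordElem b [(i, !e)] = 1 := by
  rw [← wordElem_append]
  simp only [wordElem, List.cons_append, List.nil_append]
  have : FreeGroup.mk [(i, e), (i, !e)] = 1 := by
    rw [FreeGroup.one_eq_mk]
    exact FreeGroup.Red.exact.2 ⟨[], Relation.ReflTransGen.single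
      (FreeGroup.Red.Step.not (L₁ := []) (L₂ := []) (x := i) (b := e)),
      Relation.ReflTransGen.refl⟩
  rw [this, map_one]

/-- The new letter is either appended or cancels the last letter of the word; these are the two ways
to cross an edge of the Cayley tree. -/
lemma basisWord_mul_letter (g : F) (l : ι × Bool) :
    basisWord b (g * wordElem b [l]) = basisWord b g ++ [l] ∨
      basisWord b g = basisWord b (g * wordElem b [l]) ++ [(l.1, !l.2)] := by
  rcases List.eq_nil_or_concat (basisWord b g) with h | ⟨L, l', h⟩
  · left
    have : g = 1 := by rw [← wordElem_basisWord b g, h, wordElem_nil]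
    rw [h, this, one_mul, basisWord_wordElem b FreeGroup.IsReduced.singleton, List.nil_append]
  · rw [List.concat_eq_append] at h
    have hg : g = wordElem b L * wordElem b [l'] := by
      rw [← wordElem_append, ← h, wordElem_basisWord]
    have hr := isReduced_basisWord b g
    by_cases hl : l' = (l.1, !l.2)
    · right
      have h1 : wordElem b [l'] * wordElem b [l] = 1 := by
        rw [hl]; simpa using wordElem_pair b l.1 (!l.2)
      have hL : FreeGroup.IsReduced L := hr.infix (h ▸ (List.prefix_append L [l']).isInfix)
      rw [hg, mul_assoc, h1, mul_one, basisWord_wordElem b hL, ← hl, ← wordElem_append,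
        basisWord_wordElem b (h ▸ hr)]
    · left
      rw [← wordElem_basisWord b g, ← wordElem_append, wordElem_basisWord, basisWord_wordElem]
      rw [FreeGroup.IsReduced, List.isChain_append]
      refine ⟨hr, List.isChain_singleton _, ?_⟩
      rw [h]
      simp only [List.getLast?_append, List.getLast?_singleton, Option.some_or, Option.mem_def,
        Option.some.injEq, List.head?_cons, forall_eq']
      intro h1
      by_contra h2
      exact hl (Prod.ext h1 (by simpa using Bool.eq_not_of_ne h2))

/-- Word length. -/
noncomputable def wordLen (g : F) : ℕ := (basisWord b g).length

lemma wordLen_inv (g : F) : wordLen b g⁻¹ = wordLen b g := by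
  classical
  simp only [wordLen, basisWord, map_inv]
  convert FreeGroup.norm_inv_eq (x := b.repr g) <;> (unfold FreeGroup.norm; congr!)

lemma finite_wordLen_le [Finite ι] (n : ℕ) : {g : F | wordLen b g ≤ n}.Finite := by
  refine Set.Finite.of_finite_image (f := basisWord b) ?_ (basisWord_injective b).injOn
  refine (List.finite_length_le (ι × Bool) n).subset ?_
  rintro _ ⟨g, hg, rfl⟩
  exact hg

/-- Each letter shortens the reduced word by at most one, so `L` is too short to eat into the first
`n` letters. -/
lemma take_basisWord_mul_wordElem {n : ℕ} (L : List (ι × Bool)) (g : F)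
    (h : n + L.length ≤ wordLen b g) :
    (basisWord b (g * wordElem b L)).take n = (basisWord b g).take n := by
  induction L generalizing g with
  | nil => simp
  | cons l L ih =>
    rw [← List.singleton_append, wordElem_append, ← mul_assoc]
    simp only [List.length_cons] at h
    rcases basisWord_mul_letter b g l with h1 | h1
    · rw [ih _ (by rw [wordLen, h1, List.length_append]; unfold wordLen at h; omega), h1,
        List.take_append_of_le_length (by unfold wordLen at h; omega)]
    · have h2 : wordLen b g = wordLen b (g * wordElem b [l]) + 1 := by
        rw [wordLen, h1, List.length_append]; rfl
      rw [ih _ (by omega), h1, List.take_append_of_le_length (by unfold wordLen at h2 h; omega)]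

/-- Right multiplication by a short element preserves initial segments. -/
lemma take_basisWord_mul {n : ℕ} (g s : F) (h : n + wordLen b s ≤ wordLen b g) :
    (basisWord b (g * s)).take n = (basisWord b g).take n := by
  conv_lhs => rw [← wordElem_basisWord b s]
  exact take_basisWord_mul_wordElem b _ _ h

/-- The elements whose reduced word starts with the first `n` letters of `ξ`. -/
def cone (ξ : FreeBoundary ι) (n : ℕ) : Set F := {g | ∀ k < n, (basisWord b g)[k]? = some (ξ.1 k)}

variable {b}

lemma mem_cone {ξ : FreeBoundary ι} {n : ℕ} {g : F} :
    g ∈ cone b ξ n ↔ ∀ k < n, (basisWord b g)[k]? = some (ξ.1 k) := Iff.rfl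

lemma mem_cone_iff_take {ξ : FreeBoundary ι} {n : ℕ} {g : F} :
    g ∈ cone b ξ n ↔ (basisWord b g).take n = List.ofFn fun k : Fin n => ξ.1 k := by
  rw [mem_cone]
  constructor
  · intro h
    refine List.ext_getElem? fun k => ?_
    by_cases hk : k < n
    · simp [hk, h k hk]
    · simp [hk]
  · intro h k hk
    have := congrArg (fun L => L[k]?) h
    simpa [List.getElem?_take, hk] using this

lemma le_wordLen_of_mem_cone {ξ : FreeBoundary ι} {n : ℕ} {g : F} (h : g ∈ cone b ξ n) :
    n ≤ wordLen b g := by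
  have := congrArg List.length (mem_cone_iff_take.1 h)
  simp only [List.length_take, List.length_ofFn] at this
  unfold wordLen; omega

lemma cone_anti (ξ : FreeBoundary ι) : Antitone (cone b ξ) :=
  fun _ _ h _ hg k hk => hg k (hk.trans_le h)

lemma mul_mem_cone {ξ : FreeBoundary ι} {n : ℕ} {g s : F} (hg : g ∈ cone b ξ n)
    (h : n + wordLen b s ≤ wordLen b g) : g * s ∈ cone b ξ n := by
  rw [mem_cone_iff_take] at hg ⊢
  rw [take_basisWord_mul b g s h, hg]

lemma cone_congr {ξ η : FreeBoundary ι} {n : ℕ} (h : ∀ k < n, ξ.1 k = η.1 k) :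
    cone b ξ n = cone b η n := by
  ext g
  simp only [mem_cone]
  exact forall₂_congr fun k hk => by rw [h k hk]

lemma eq_of_mem_cone {ξ η : FreeBoundary ι} {n : ℕ} {g : F} (h : g ∈ cone b ξ n)
    (h' : g ∈ cone b η n) {k : ℕ} (hk : k < n) : ξ.1 k = η.1 k :=
  Option.some_injective _ ((h k hk).symm.trans (h' k hk))

lemma isReduced_ofFn (ξ : FreeBoundary ι) (n : ℕ) :
    FreeGroup.IsReduced (List.ofFn fun k : Fin n => ξ.1 k) := by
  rw [FreeGroup.IsReduced, List.isChain_ofFn]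
  intro i hi h1
  by_contra h2
  exact ξ.2 i (Prod.ext h1.symm (Bool.eq_not_of_ne (Ne.symm h2)))

variable (b)

lemma basisWord_rayVertex (ξ : FreeBoundary ι) (n : ℕ) :
    basisWord b (rayVertex b ξ n) = List.ofFn fun k : Fin n => ξ.1 k :=
  basisWord_wordElem b (isReduced_ofFn ξ n)

lemma wordLen_rayVertex (ξ : FreeBoundary ι) (n : ℕ) : wordLen b (rayVertex b ξ n) = n := by
  simp [wordLen, basisWord_rayVertex]

lemma rayVertex_mem_cone (ξ : FreeBoundary ι) {n m : ℕ} (h : n ≤ m) :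
    rayVertex b ξ m ∈ cone b ξ n := by
  intro k hk
  rw [basisWord_rayVertex]
  simp [hk.trans_le h]

@[simp] lemma rayVertex_zero (ξ : FreeBoundary ι) : rayVertex b ξ 0 = 1 :=
  basisWord_injective b (by simp [basisWord_rayVertex])

lemma rayVertex_succ (ξ : FreeBoundary ι) (n : ℕ) :
    rayVertex b ξ (n + 1) = rayVertex b ξ n * wordElem b [ξ.1 n] := by
  change wordElem b _ = wordElem b _ * _
  rw [← wordElem_append, List.ofFn_succ_last]
  rfl

variable {b}

/-- Every element of a cone is the apex times the rest of its word. -/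
lemma exists_eq_rayVertex_mul {ξ : FreeBoundary ι} {n : ℕ} {g : F} (h : g ∈ cone b ξ n) :
    ∃ y, g = rayVertex b ξ n * y ∧ wordLen b g = n + wordLen b y := by
  have e : basisWord b g = (List.ofFn fun k : Fin n => ξ.1 k) ++ (basisWord b g).drop n := by
    rw [← mem_cone_iff_take.1 h, List.take_append_drop]
  have hr : FreeGroup.IsReduced ((basisWord b g).drop n) :=
    (isReduced_basisWord b g).infix (List.drop_suffix _ _).isInfix
  refine ⟨wordElem b ((basisWord b g).drop n), ?_, ?_⟩
  · conv_lhs => rw [← wordElem_basisWord b g, e, wordElem_append]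
    rfl
  · rw [wordLen, wordLen, basisWord_wordElem b hr]
    conv_lhs => rw [e]
    simp

/-- Cones are connected in the Cayley tree. -/
lemma cone_induction {ξ : FreeBoundary ι} {n : ℕ} {p : F → Prop} (h0 : p (rayVertex b ξ n))
    (hs : ∀ x l, x ∈ cone b ξ n → x * wordElem b [l] ∈ cone b ξ n → p x →
      p (x * wordElem b [l])) : ∀ x ∈ cone b ξ n, p x := by
  -- The apex word is extended letter by letter at its right end, and every intermediate word keeps
  -- the prefix that defines the cone.
  have key : ∀ R : List (ι × Bool),
      FreeGroup.IsReduced ((List.ofFn fun k : Fin n => ξ.1 k) ++ R) →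
      wordElem b ((List.ofFn fun k : Fin n => ξ.1 k) ++ R) ∈ cone b ξ n ∧
        p (wordElem b ((List.ofFn fun k : Fin n => ξ.1 k) ++ R)) := by
    intro R
    have hmem : ∀ R : List (ι × Bool),
      FreeGroup.IsReduced ((List.ofFn fun k : Fin n => ξ.1 k) ++ R) →
      wordElem b ((List.ofFn fun k : Fin n => ξ.1 k) ++ R) ∈ cone b ξ n := by
      intro R hR
      rw [mem_cone_iff_take, basisWord_wordElem b hR]
      exact List.take_left' (by simp)
    induction R using List.reverseRecOn with
    | nil => exact fun hR => ⟨hmem _ hR, by rw [List.append_nil]; exact h0⟩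
    | append_singleton R l ih =>
      intro hR
      refine ⟨hmem _ hR, ?_⟩
      have h2 := hmem _ hR
      rw [← List.append_assoc] at hR h2 ⊢
      have h1 := ih (hR.infix (List.prefix_append _ _).isInfix)
      rw [wordElem_append] at h2 ⊢
      exact hs _ l h1.1 h2 h1.2
  intro x hx
  have e : (List.ofFn fun k : Fin n => ξ.1 k) ++ (basisWord b x).drop n = basisWord b x := by
    rw [← mem_cone_iff_take.1 hx, List.take_append_drop]
  have := (key ((basisWord b x).drop n) (by rw [e]; exact isReduced_basisWord b x)).2
  rwa [e, wordElem_basisWord] at this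

variable (b)

/-- The trace on the group of the neighbourhood filter of a boundary point. -/
def coneFilter (ξ : FreeBoundary ι) : Filter F := ⨅ n, 𝓟 (cone b ξ n)

lemma coneFilter_hasBasis (ξ : FreeBoundary ι) :
    (coneFilter b ξ).HasBasis (fun _ : ℕ => True) (cone b ξ) :=
  hasBasis_iInf_principal (cone_anti ξ).directed_ge

lemma cone_mem_coneFilter (ξ : FreeBoundary ι) (n : ℕ) : cone b ξ n ∈ coneFilter b ξ :=
  (coneFilter_hasBasis b ξ).mem_of_mem trivial

lemma convergesToBoundary_iff {u : ℕ → F} {ξ : FreeBoundary ι} :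
    ConvergesToBoundary b u ξ ↔ Tendsto u atTop (coneFilter b ξ) := by
  rw [(coneFilter_hasBasis b ξ).tendsto_right_iff]
  simp [ConvergesToBoundary, mem_cone]

lemma tendsto_rayVertex (ξ : FreeBoundary ι) :
    Tendsto (rayVertex b ξ) atTop (coneFilter b ξ) := by
  rw [(coneFilter_hasBasis b ξ).tendsto_right_iff]
  intro n _
  filter_upwards [eventually_ge_atTop n] with m hm using rayVertex_mem_cone b ξ hm

instance coneFilter_neBot (ξ : FreeBoundary ι) : (coneFilter b ξ).NeBot :=
  (tendsto_rayVertex b ξ).neBot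

lemma coneFilter_eq_of_neBot {ξ η : FreeBoundary ι}
    (h : (coneFilter b ξ ⊓ coneFilter b η).NeBot) : ξ = η := by
  refine Subtype.ext (funext fun k => ?_)
  obtain ⟨g, hg⟩ := h.nonempty_of_mem (inter_mem_inf (cone_mem_coneFilter b ξ (k + 1))
    (cone_mem_coneFilter b η (k + 1)))
  exact eq_of_mem_cone hg.1 hg.2 (Nat.lt_succ_self k)

variable {b}

lemma boundary_limit_unique {α : Type*} {l : Filter α} [l.NeBot] {u : α → F}
    {ξ η : FreeBoundary ι} (h : Tendsto u l (coneFilter b ξ)) (h' : Tendsto u l (coneFilter b η)) :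
    ξ = η :=
  coneFilter_eq_of_neBot b ((tendsto_inf.2 ⟨h, h'⟩).neBot)

variable (b)

/-- A right translation moves every vertex of the Cayley tree by the same bounded distance. This
permits a change of base point in an orbit and the passage from `g * w ^ m` to powers of a conjugate
of `w`. -/
lemma tendsto_mul_right (ξ : FreeBoundary ι) (s : F) :
    Tendsto (fun g => g * s) (coneFilter b ξ) (coneFilter b ξ) := by
  refine ((coneFilter_hasBasis b ξ).tendsto_iff (coneFilter_hasBasis b ξ)).2 fun n _ =>
    ⟨n + wordLen b s, trivial, fun g hg => ?_⟩
  exact mul_mem_cone (cone_anti ξ (Nat.le_add_right _ _) hg) (le_wordLen_of_mem_cone hg)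

lemma coneFilter_le_cofinite (ξ : FreeBoundary ι) : coneFilter b ξ ≤ cofinite := by
  intro s hs
  obtain ⟨n, hn⟩ := (Set.Finite.image (wordLen b) (mem_cofinite.1 hs)).bddAbove
  refine mem_of_superset (cone_mem_coneFilter b ξ (n + 1)) fun g hg => ?_
  by_contra h
  have := hn (Set.mem_image_of_mem (wordLen b) h)
  have := le_wordLen_of_mem_cone hg
  omega

/-- A filter along which all initial segments of words stabilize converges to a boundary point. -/
lemma exists_le_coneFilter {l : Filter F} [l.NeBot]
    (h : ∀ n, ∃ w : List (ι × Bool), w.length = n ∧ ∀ᶠ g in l, (basisWord b g).take n = w) :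
    ∃ ξ, l ≤ coneFilter b ξ := by
  choose w hw hl using h
  let a : ℕ → ι × Bool := fun k => (w (k + 1))[k]'(by rw [hw]; omega)
  have ha : ∀ k, ∀ᶠ g in l, (basisWord b g)[k]? = some (a k) := by
    intro k
    filter_upwards [hl (k + 1)] with g hg
    have : ((basisWord b g).take (k + 1))[k]? = (w (k + 1))[k]? := by rw [hg]
    rw [List.getElem?_take_of_lt (Nat.lt_succ_self k)] at this
    rw [this, List.getElem?_eq_getElem]
  have hred : ∀ n, a (n + 1) ≠ ((a n).1, !(a n).2) := by
    intro n hn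
    obtain ⟨g, h1, h2⟩ := ((ha n).and (ha (n + 1))).exists
    have hr := isReduced_basisWord b g
    rw [FreeGroup.IsReduced, List.isChain_iff_getElem] at hr
    obtain ⟨hlt1, h1⟩ := List.getElem?_eq_some_iff.1 h1
    obtain ⟨hlt2, h2⟩ := List.getElem?_eq_some_iff.1 h2
    have := hr n hlt2
    rw [h1, h2, hn] at this
    simpa using this rfl
  refine ⟨⟨a, hred⟩, ?_⟩
  refine le_iInf fun n => le_principal_iff.2 ?_
  have := (eventually_all_finite (Set.finite_lt_nat n)).2 fun k _ => ha k
  filter_upwards [this] with g hg k hk using hg k hk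

end Words

/-! ### Topology of the boundary -/

section BoundaryTopology

variable {ι : Type*}

lemma FreeBoundary.isOpen_letter (k : ℕ) (s : Set (ι × Bool)) :
    IsOpen {ξ : FreeBoundary ι | ξ.1 k ∈ s} := by
  let _ : TopologicalSpace (ι × Bool) := ⊥
  have : DiscreteTopology (ι × Bool) := ⟨rfl⟩
  exact (isOpen_discrete s).preimage ((continuous_apply k).comp continuous_subtype_val)

lemma FreeBoundary.isOpen_cylinder (ξ : FreeBoundary ι) (n : ℕ) :
    IsOpen {η : FreeBoundary ι | ∀ k < n, η.1 k = ξ.1 k} := by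
  have : {η : FreeBoundary ι | ∀ k < n, η.1 k = ξ.1 k} =
      ⋂ k ∈ Set.Iio n, {η : FreeBoundary ι | η.1 k ∈ ({ξ.1 k} : Set _)} := by
    ext η; simp
  rw [this]
  exact (Set.finite_Iio n).isOpen_biInter fun k _ => FreeBoundary.isOpen_letter k _

lemma FreeBoundary.nhds_hasBasis (ξ : FreeBoundary ι) :
    (𝓝 ξ).HasBasis (fun _ : ℕ => True) fun n => {η | ∀ k < n, η.1 k = ξ.1 k} := by
  refine ⟨fun s => ⟨fun hs => ?_, fun ⟨n, _, hn⟩ =>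
    mem_of_superset ((FreeBoundary.isOpen_cylinder ξ n).mem_nhds fun _ _ => rfl) hn⟩⟩
  let _ : TopologicalSpace (ι × Bool) := ⊥
  have : DiscreteTopology (ι × Bool) := ⟨rfl⟩
  have hind : IsInducing fun η : FreeBoundary ι => η.1 := IsInducing.subtypeVal
  rw [hind.nhds_eq_comap, nhds_pi, Filter.mem_comap] at hs
  obtain ⟨t, ht, hts⟩ := hs
  obtain ⟨I, hI, w, hw, hwt⟩ := Filter.mem_pi.1 ht
  obtain ⟨n, hn⟩ := hI.bddAbove
  refine ⟨n + 1, trivial, fun η hη => hts (hwt fun i hi => ?_)⟩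
  change η.1 i ∈ w i
  rw [hη i (Nat.lt_succ_of_le (hn hi))]
  exact mem_of_mem_nhds (hw i)

lemma FreeBoundary.continuous_of_letters {X : Type*} [TopologicalSpace X]
    {f : X → FreeBoundary ι} (h : ∀ x n, ∀ᶠ y in 𝓝 x, ∀ k < n, (f y).1 k = (f x).1 k) :
    Continuous f :=
  continuous_iff_continuousAt.2 fun x =>
    ((FreeBoundary.nhds_hasBasis (f x)).tendsto_right_iff).2 fun n _ => h x n

instance FreeBoundary.compactSpace [Finite ι] : CompactSpace (FreeBoundary ι) := by
  let _ : TopologicalSpace (ι × Bool) := ⊥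
  have : DiscreteTopology (ι × Bool) := ⟨rfl⟩
  suffices h : IsClosed {ξ : ℕ → ι × Bool | ∀ n, ξ (n + 1) ≠ ((ξ n).1, !(ξ n).2)} from
    isCompact_iff_compactSpace.1 h.isCompact
  rw [Set.ofPred_forall]
  refine isClosed_iInter fun n => ?_
  have : Continuous fun ξ : ℕ → ι × Bool => (ξ (n + 1), ξ n) := by fun_prop
  exact (isClosed_discrete {p : (ι × Bool) × (ι × Bool) | p.1 ≠ (p.2.1, !p.2.2)}).preimage this

instance FreeBoundary.t2Space : T2Space (FreeBoundary ι) := by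
  let _ : TopologicalSpace (ι × Bool) := ⊥
  have : DiscreteTopology (ι × Bool) := ⟨rfl⟩
  exact inferInstanceAs (T2Space {ξ : ℕ → ι × Bool // ∀ n, ξ (n + 1) ≠ ((ξ n).1, !(ξ n).2)})

variable {F : Type*} [Group F] (b : FreeGroupBasis ι F)

/-- A single cone witnesses the property, and all boundary points with the same initial segment
share that cone. -/
lemma isOpen_setOf_eventually (p : F → Prop) :
    IsOpen {ξ : FreeBoundary ι | ∀ᶠ g in coneFilter b ξ, p g} := by
  rw [isOpen_iff_mem_nhds]
  intro ξ hξ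
  obtain ⟨n, -, hn⟩ := (coneFilter_hasBasis b ξ).mem_iff.1 hξ
  refine mem_of_superset ((FreeBoundary.nhds_hasBasis ξ).mem_of_mem (i := n) trivial) fun η hη => ?_
  refine mem_of_superset (cone_mem_coneFilter b η n) ?_
  rwa [cone_congr hη]

/-- A cone is contained in the cylinder of any of its deep elements. -/
lemma exists_mem_cone_of_ne_one {g : F} (hg : g ≠ 1) :
    ∃ ξ : FreeBoundary ι, g ∈ cone b ξ (wordLen b g) := by
  have hne : basisWord b g ≠ [] := fun h => hg (basisWord_injective b (by simp [h]))
  have hpos : 0 < (basisWord b g).length := List.length_pos_iff.2 hne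
  -- Past its end the word is continued by repeating its last letter, which never cancels against
  -- itself.
  let a : ℕ → ι × Bool := fun k => (basisWord b g).getD k ((basisWord b g).getLast hne)
  refine ⟨⟨a, fun n h => ?_⟩, fun k hk => ?_⟩
  · have hr := isReduced_basisWord b g
    rw [FreeGroup.IsReduced, List.isChain_iff_getElem] at hr
    by_cases h1 : n + 1 < (basisWord b g).length
    · have := hr n h1
      simp only [a, List.getD_eq_getElem _ _ h1, List.getD_eq_getElem _ _ (Nat.lt_of_succ_lt h1)]
        at h
      rw [h] at this
      simpa using this rfl
    · have h2 : a (n + 1) = a n := by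
        by_cases h3 : n < (basisWord b g).length
        · have h4 : n = (basisWord b g).length - 1 := by omega
          simp only [a, List.getD_eq_default _ _ (not_lt.1 h1), List.getD_eq_getElem _ _ h3,
            List.getLast_eq_getElem]
          exact getElem_congr_idx h4.symm
        · simp only [a, List.getD_eq_default _ _ (not_lt.1 h1),
            List.getD_eq_default _ _ (not_lt.1 h3)]
      rw [h2] at h
      simpa using congrArg Prod.snd h
  · simp only [a]
    rw [List.getElem?_eq_getElem hk, List.getD_eq_getElem _ _ hk]

end BoundaryTopology

/-! ### Paths with bounded jumps -/

section Paths

variable {ι F : Type*} [Group F] (b : FreeGroupBasis ι F)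

lemma finite_letters [Finite ι] : (Set.range fun l : ι × Bool => wordElem b [l]).Finite :=
  Set.finite_range _

/-- Jumps in a finite set preserve initial segments far away from the identity. -/
lemma exists_finite_take_mul_eq [Finite ι] {S : Set F} (hS : S.Finite) (n : ℕ) :
    ∃ B : Set F, B.Finite ∧ ∀ g, g ∉ B → n ≤ wordLen b g ∧ ∀ s ∈ S,
      (basisWord b (g * s)).take n = (basisWord b g).take n := by
  obtain ⟨L, hL⟩ := (hS.image (wordLen b)).bddAbove
  refine ⟨_, finite_wordLen_le b (n + L), fun g hg => ?_⟩
  rw [Set.mem_ofPred, not_le] at hg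
  refine ⟨by omega, fun s hs => take_basisWord_mul b g s ?_⟩
  have := hL (Set.mem_image_of_mem _ hs)
  omega

/-- A proper sequence with bounded jumps converges to a boundary point. -/
lemma exists_tendsto_of_bounded_jumps [Finite ι] {S : Set F} (hS : S.Finite) {u : ℕ → F}
    (hu : Tendsto u atTop cofinite) (hj : ∀ m, (u m)⁻¹ * u (m + 1) ∈ S) :
    ∃ ξ, Tendsto u atTop (coneFilter b ξ) := by
  refine exists_le_coneFilter b (l := map u atTop) fun n => ?_
  obtain ⟨B, hB, h⟩ := exists_finite_take_mul_eq b hS n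
  obtain ⟨m₀, hm₀⟩ := eventually_atTop.1 (hu hB.compl_mem_cofinite)
  have key : ∀ m ≥ m₀, (basisWord b (u m)).take n = (basisWord b (u m₀)).take n := by
    intro m hm
    induction m, hm using Nat.le_induction with
    | base => rfl
    | succ m hm ih =>
      rw [← ih, ← (h (u m) (hm₀ m hm)).2 _ (hj m), mul_inv_cancel_left]
  refine ⟨(basisWord b (u m₀)).take n, ?_, ?_⟩
  · have := (h (u m₀) (hm₀ m₀ le_rfl)).1
    unfold wordLen at this
    simpa using this
  · exact eventually_map.2 (eventually_atTop.2 ⟨m₀, key⟩)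

lemma tendsto_pow_cofinite {x : F} (b : FreeGroupBasis ι F) (hx : x ≠ 1) :
    Tendsto (fun m : ℕ => x ^ m) atTop cofinite := by
  rw [← Nat.cofinite_eq_atTop]
  refine Function.Injective.tendsto_cofinite (fun m n h => ?_)
  have h' : b.repr x ^ m = b.repr x ^ n := by rw [← map_pow, ← map_pow]; exact congrArg _ h
  exact IsMulTorsionFree.pow_right_injective (by simpa using hx) h'

lemma exists_tendsto_pow [Finite ι] {x : F} (hx : x ≠ 1) :
    ∃ ξ, Tendsto (fun m : ℕ => x ^ m) atTop (coneFilter b ξ) :=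
  exists_tendsto_of_bounded_jumps b (Set.finite_singleton x) (tendsto_pow_cofinite b hx)
    fun m => by simp [pow_succ]

/-- A sequence with bounded jumps passes near the vertices of the ray to its limit. -/
lemma exists_near_rayVertex [Finite ι] {S : Set F} (hS : S.Finite) {u : ℕ → F} {ξ : FreeBoundary ι}
    (hj : ∀ m, (u m)⁻¹ * u (m + 1) ∈ S) (hu : Tendsto u atTop (coneFilter b ξ)) :
    ∃ B : Set F, B.Finite ∧ ∀ m₀, ∀ᶠ n in atTop, ∃ m ≥ m₀, ∃ y ∈ B, u m = rayVertex b ξ n * y := by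
  obtain ⟨L, hL⟩ := (hS.image (wordLen b)).bddAbove
  refine ⟨_, finite_wordLen_le b L, fun m₀ => ?_⟩
  filter_upwards [eventually_gt_atTop (wordLen b (u m₀))] with n hn
  have hex : ∃ m, u (m₀ + m) ∈ cone b ξ n := by
    obtain ⟨a, ha⟩ := eventually_atTop.1 (hu (cone_mem_coneFilter b ξ n))
    exact ⟨a, ha _ (by omega)⟩
  classical
  -- At the first entry into the cone the sequence jumps across its apex, the `n`-th vertex of the
  -- ray, so it is then at most one jump length away from it. Since `n` exceeds the length of `u
  -- m₀`, the entry does not occur at time `m₀` itself.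
  obtain ⟨m, hm, hmin⟩ : ∃ m, u (m₀ + m) ∈ cone b ξ n ∧ ∀ k < m, u (m₀ + k) ∉ cone b ξ n :=
    ⟨Nat.find hex, Nat.find_spec hex, fun k hk => Nat.find_min hex hk⟩
  cases m with
  | zero => exact absurd (le_wordLen_of_mem_cone hm) (by simpa using hn)
  | succ m =>
    have h1 := hmin m (Nat.lt_succ_self m)
    obtain ⟨y, hy, hlen⟩ := exists_eq_rayVertex_mul hm
    refine ⟨m₀ + (m + 1), by omega, y, ?_, hy⟩
    have hs := hL (Set.mem_image_of_mem (wordLen b) (hj (m₀ + m)))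
    by_contra hcon
    have hcon := not_le.1 hcon
    refine h1 ?_
    have := mul_mem_cone (s := ((u (m₀ + m))⁻¹ * u (m₀ + m + 1))⁻¹) hm
      (by rw [wordLen_inv]; omega)
    simpa [← add_assoc] using this

/-- Two sequences with bounded jumps and the same limit fellow-travel. -/
lemma exists_mul_eq_of_tendsto [Finite ι] {S : Set F} (hS : S.Finite) {u u' : ℕ → F}
    {ξ : FreeBoundary ι} (hj : ∀ m, (u m)⁻¹ * u (m + 1) ∈ S)
    (hu : Tendsto u atTop (coneFilter b ξ)) (hj' : ∀ m, (u' m)⁻¹ * u' (m + 1) ∈ S)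
    (hu' : Tendsto u' atTop (coneFilter b ξ)) :
    ∃ y, ∀ m₀, ∃ m ≥ m₀, ∃ m' ≥ m₀, u m * y = u' m' := by
  obtain ⟨B, hB, h⟩ := exists_near_rayVertex b hS hj hu
  obtain ⟨B', hB', h'⟩ := exists_near_rayVertex b hS hj' hu'
  have hfin : (Set.image2 (fun y y' => y⁻¹ * y') B B').Finite := hB.image2 _ hB'
  -- Both sequences pass near the same ray vertices, so only finitely many offsets occur between
  -- them. If each offset stopped occurring after some time, the maximum of these times would give a
  -- contradiction.
  by_contra! hcon
  choose m₀ hm₀ using hcon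
  obtain ⟨M, hM⟩ := (hfin.image m₀).bddAbove
  obtain ⟨n, ⟨m, hm, y, hy, e⟩, m', hm', y', hy', e'⟩ := ((h M).and (h' M)).exists
  have hmem := Set.mem_image2_of_mem (f := fun y y' : F => y⁻¹ * y') hy hy'
  have hle := hM (Set.mem_image_of_mem m₀ hmem)
  exact hm₀ _ m (le_trans hle hm) m' (le_trans hle hm') (by rw [e, e']; group)

/-- Elements with the same attracting point are commensurable. -/
lemma exists_pow_eq_pow [Finite ι] {x y : F} {ξ : FreeBoundary ι}
    (hx : Tendsto (fun m : ℕ => x ^ m) atTop (coneFilter b ξ))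
    (hy : Tendsto (fun m : ℕ => y ^ m) atTop (coneFilter b ξ)) :
    ∃ p q : ℕ, 0 < p ∧ 0 < q ∧ x ^ p = y ^ q := by
  -- The powers of `x` and of `y` meet repeatedly with one offset `z`; dividing two such
  -- coincidences eliminates `z`. The threshold `m₁ + n₁ + 1` makes both exponent differences
  -- positive.
  obtain ⟨z, hz⟩ := exists_mul_eq_of_tendsto b (S := {x, y}) (by simp)
    (fun m => by simp [pow_succ]) hx (fun m => by simp [pow_succ]) hy
  obtain ⟨m₁, -, n₁, -, e₁⟩ := hz 0
  obtain ⟨m₂, h₂, n₂, h₂', e₂⟩ := hz (m₁ + n₁ + 1)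
  refine ⟨m₂ - m₁, n₂ - n₁, by omega, by omega, ?_⟩
  have e : x ^ m₂ * (x ^ m₁)⁻¹ = y ^ n₂ * (y ^ n₁)⁻¹ := by rw [← e₁, ← e₂]; group
  rwa [← pow_sub x (by omega), ← pow_sub y (by omega)] at e

/-! ### Boundary maps -/

section BoundaryMap

variable {κ G : Type*} [Group G] (c : FreeGroupBasis κ G)

/-- Uniform convergence at infinity of finite-to-one maps with bounded jumps. -/
lemma exists_depth [Finite ι] {f : G → F} (hf : Tendsto f cofinite cofinite) {S : Set F}
    (hS : S.Finite) (hj : ∀ x l, (f x)⁻¹ * f (x * wordElem c [l]) ∈ S) (n : ℕ) :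
    ∃ m, ∀ ξ : FreeBoundary κ, ∀ x ∈ cone c ξ m, n ≤ wordLen b (f x) ∧
      (basisWord b (f x)).take n = (basisWord b (f (rayVertex c ξ m))).take n := by
  obtain ⟨B, hB, h⟩ := exists_finite_take_mul_eq b hS n
  -- Outside `B` a jump does not change the first `n` letters. As `f` is finite-to-one, deep cones
  -- of `G` avoid the preimage of `B`, and connectedness of cones makes the prefix constant on them.
  have hfin : (f ⁻¹' B).Finite := by
    have := hf hB.compl_mem_cofinite
    simpa [Filter.mem_map, mem_cofinite] using this
  obtain ⟨m, hm⟩ := (hfin.image (wordLen c)).bddAbove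
  have hout : ∀ (ξ : FreeBoundary κ), ∀ x ∈ cone c ξ (m + 1), f x ∉ B := by
    intro ξ x hx hxB
    have h1 := hm (Set.mem_image_of_mem (wordLen c) (show x ∈ f ⁻¹' B from hxB))
    have h2 := le_wordLen_of_mem_cone hx
    omega
  refine ⟨m + 1, fun ξ x hx => ⟨(h _ (hout ξ x hx)).1, ?_⟩⟩
  revert x
  refine cone_induction rfl fun x l hx _ ih => ?_
  rw [← ih, ← (h _ (hout ξ x hx)).2 _ (hj x l), mul_inv_cancel_left]

/-- Finite-to-one maps with bounded jumps extend continuously to the boundary. -/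
lemma exists_boundaryMap [Finite ι] {f : G → F} (hf : Tendsto f cofinite cofinite) {S : Set F}
    (hS : S.Finite) (hj : ∀ x l, (f x)⁻¹ * f (x * wordElem c [l]) ∈ S) :
    ∃ φ : FreeBoundary κ → FreeBoundary ι, Continuous φ ∧
      (∀ ξ, Tendsto f (coneFilter c ξ) (coneFilter b (φ ξ))) ∧
      ∀ n, ∃ m, ∀ ξ, ∀ x ∈ cone c ξ m, f x ∈ cone b (φ ξ) n := by
  choose m hm using exists_depth b c hf hS hj
  have hφ : ∀ ξ : FreeBoundary κ, ∃ η, Tendsto f (coneFilter c ξ) (coneFilter b η) := by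
    intro ξ
    refine exists_le_coneFilter b fun n => ⟨_, ?_, eventually_map.2
      (mem_of_superset (cone_mem_coneFilter c ξ (m n)) fun x hx => (hm n ξ x hx).2)⟩
    have := (hm n ξ _ (rayVertex_mem_cone c ξ le_rfl)).1
    unfold wordLen at this
    simpa using this
  choose φ hφ using hφ
  have hdepth : ∀ n, ∀ ξ, ∀ x ∈ cone c ξ (m n), f x ∈ cone b (φ ξ) n := by
    intro n ξ x hx
    obtain ⟨y, hy, hy'⟩ := (((hφ ξ).eventually (cone_mem_coneFilter b (φ ξ) n)).and
      (cone_mem_coneFilter c ξ (m n))).exists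
    rw [mem_cone_iff_take, (hm n ξ x hx).2, ← (hm n ξ y hy').2]
    exact mem_cone_iff_take.1 hy
  refine ⟨φ, FreeBoundary.continuous_of_letters fun ξ n => ?_, hφ, fun n => ⟨m n, hdepth n⟩⟩
  filter_upwards [(FreeBoundary.nhds_hasBasis ξ).mem_of_mem (i := m n) trivial] with η hη k hk
  have h1 := hdepth n ξ _ (rayVertex_mem_cone c ξ le_rfl)
  have h2 := hdepth n η (rayVertex c ξ (m n)) (by
    rw [cone_congr hη]; exact rayVertex_mem_cone c ξ le_rfl)
  exact eq_of_mem_cone h2 h1 hk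

/-- Left multiplication carries edges of the Cayley tree to edges with the same letter, so it
extends to the boundary. This is the action of `F` on the boundary, expressed through limits. -/
lemma exists_tendsto_mul_left [Finite ι] (g : F) (ξ : FreeBoundary ι) :
    ∃ ξ', Tendsto (fun x => g * x) (coneFilter b ξ) (coneFilter b ξ') := by
  obtain ⟨φ, -, h, -⟩ := exists_boundaryMap b b (f := fun x => g * x)
    (mul_right_injective g).tendsto_cofinite (finite_letters b) (fun x l => ⟨l, by group⟩)
  exact ⟨φ ξ, h ξ⟩

end BoundaryMap

end Paths

/-! ### Limit sets of subgroups -/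

section LimitSet

variable {ι F : Type*} [Group F] (b : FreeGroupBasis ι F)

/-- The limit set of a subgroup. -/
def limitSet (H : Subgroup F) : Set (FreeBoundary ι) := {ξ | ∃ᶠ g in coneFilter b ξ, g ∈ H}

variable {b}

lemma mem_limitSet_of_tendsto {H : Subgroup F} {u : ℕ → F} {ξ : FreeBoundary ι}
    (hu : Tendsto u atTop (coneFilter b ξ)) (h : ∃ᶠ m in atTop, u m ∈ H) : ξ ∈ limitSet b H :=
  hu.frequently h

lemma mem_limitSet_of_pow {H : Subgroup F} {x : F} {ξ : FreeBoundary ι}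
    (hu : Tendsto (fun m : ℕ => x ^ m) atTop (coneFilter b ξ)) {p : ℕ} (hp : 0 < p)
    (h : x ^ p ∈ H) : ξ ∈ limitSet b H := by
  refine mem_limitSet_of_tendsto hu (frequently_atTop.2 fun a => ⟨p * a, ?_, ?_⟩)
  · exact Nat.le_mul_of_pos_left a hp
  · rw [pow_mul]; exact H.pow_mem h a

/-- The cone filter ignores finite sets, so a tail of `u` already meets all cones at `ξ`, while
tails of `u` lie in the cones at `η`. -/
lemma eq_of_frequently_mem_range {u : ℕ → F} {ξ η : FreeBoundary ι}
    (hu : Tendsto u atTop (coneFilter b η)) (h : ∃ᶠ g in coneFilter b ξ, g ∈ Set.range u) :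
    ξ = η := by
  refine coneFilter_eq_of_neBot b ?_
  rw [((coneFilter_hasBasis b ξ).inf (coneFilter_hasBasis b η)).neBot_iff]
  rintro ⟨n, m⟩ -
  obtain ⟨a, ha⟩ := eventually_atTop.1 (hu (cone_mem_coneFilter b η m))
  have hfin : (u '' Set.Iio a).Finite := (Set.finite_Iio a).image u
  have hev := coneFilter_le_cofinite b ξ hfin.compl_mem_cofinite
  obtain ⟨g, ⟨⟨k, rfl⟩, hg⟩, hg'⟩ := ((h.and_eventually hev).and_eventually
    (cone_mem_coneFilter b ξ n)).exists
  refine ⟨u k, hg', ha k ?_⟩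
  by_contra hk
  exact hg (Set.mem_image_of_mem u (not_le.1 hk))

/-- The limit set of a cyclic group consists of the endpoints of its axis. -/
lemma tendsto_pow_of_mem_limitSet_zpowers [Finite ι] {h : F} {ξ : FreeBoundary ι}
    (hξ : ξ ∈ limitSet b (Subgroup.zpowers h)) :
    Tendsto (fun m : ℕ => h ^ m) atTop (coneFilter b ξ) ∨
      Tendsto (fun m : ℕ => h⁻¹ ^ m) atTop (coneFilter b ξ) := by
  have hne : h ≠ 1 := by
    rintro rfl
    have := coneFilter_le_cofinite b ξ (Set.finite_singleton (1 : F)).compl_mem_cofinite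
    obtain ⟨g, hg, hg'⟩ := (Filter.Frequently.and_eventually hξ this).exists
    simp at hg hg'
    exact hg' hg
  obtain ⟨η, hη⟩ := exists_tendsto_pow b hne
  obtain ⟨η', hη'⟩ := exists_tendsto_pow b (inv_ne_one.2 hne)
  have : ∃ᶠ g in coneFilter b ξ, g ∈ Set.range (fun m : ℕ => h ^ m) ∨
      g ∈ Set.range (fun m : ℕ => h⁻¹ ^ m) := by
    refine Filter.Frequently.mono hξ ?_
    rintro _ ⟨k, rfl⟩
    rcases Int.eq_nat_or_neg k with ⟨m, rfl | rfl⟩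
    · exact Or.inl ⟨m, by simp⟩
    · exact Or.inr ⟨m, by simp⟩
  rcases frequently_or_distrib.1 this with h1 | h1
  · left; rwa [eq_of_frequently_mem_range hη h1]
  · right; rwa [eq_of_frequently_mem_range hη' h1]

/-- The boundary map of a subgroup with a finite basis: a continuous injection onto the
limit set. -/
lemma exists_subgroup_boundaryMap [Finite ι] (b : FreeGroupBasis ι F) {κ : Type*} [Finite κ]
    {H : Subgroup F} (c : FreeGroupBasis κ H) :
    ∃ φ : FreeBoundary κ → FreeBoundary ι, Continuous φ ∧ Function.Injective φ ∧
      (∀ ξ, Tendsto (fun h : H => (h : F)) (coneFilter c ξ) (coneFilter b (φ ξ))) ∧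
      Set.range φ = limitSet b H := by
  have hS := (finite_letters c).image (fun h : H => (h : F))
  obtain ⟨φ, hc, ht, hd⟩ := exists_boundaryMap b c (f := fun h : H => (h : F))
    Subtype.val_injective.tendsto_cofinite hS (fun x l => ⟨_, ⟨l, rfl⟩, by simp⟩)
  refine ⟨φ, hc, fun ξ η e => ?_, ht, Set.Subset.antisymm ?_ ?_⟩
  -- Injectivity: rays of `H` whose images have the same limit fellow-travel in `F` with a constant
  -- offset `y`. This `y` lies in `H`, so the rays differ by a right translation inside `H` and have
  -- the same limit there.
  · have hray : ∀ ξ : FreeBoundary κ, ∀ m, ((rayVertex c ξ m : H) : F)⁻¹ *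
        (rayVertex c ξ (m + 1) : H) ∈ (fun h : H => (h : F)) ''
          (Set.range fun l : κ × Bool => wordElem c [l]) :=
      fun ξ m => ⟨_, ⟨ξ.1 m, rfl⟩, by rw [rayVertex_succ]; simp⟩
    obtain ⟨y, hy⟩ := exists_mul_eq_of_tendsto b hS (hray ξ) ((ht ξ).comp (tendsto_rayVertex c ξ))
      (hray η) (by rw [e]; exact (ht η).comp (tendsto_rayVertex c η))
    have hyH : y ∈ H := by
      obtain ⟨m, -, m', -, e⟩ := hy 0
      rw [← eq_inv_mul_iff_mul_eq] at e
      rw [e]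
      exact H.mul_mem (H.inv_mem (rayVertex c ξ m).2) (rayVertex c η m').2
    refine coneFilter_eq_of_neBot c ?_
    rw [((coneFilter_hasBasis c ξ).inf (coneFilter_hasBasis c η)).neBot_iff]
    rintro ⟨n, n'⟩ -
    obtain ⟨a, ha⟩ := eventually_atTop.1 ((tendsto_mul_right c ξ ⟨y, hyH⟩).comp
      (tendsto_rayVertex c ξ) (cone_mem_coneFilter c ξ n))
    obtain ⟨a', ha'⟩ := eventually_atTop.1
      (tendsto_rayVertex c η (cone_mem_coneFilter c η n'))
    obtain ⟨m, hm, m', hm', e⟩ := hy (a + a')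
    refine ⟨rayVertex c η m', ?_, ha' m' (by omega)⟩
    have : rayVertex c ξ m * ⟨y, hyH⟩ = rayVertex c η m' := Subtype.ext e
    rw [← this]
    exact ha m (by omega)
  · rintro _ ⟨ξ, rfl⟩
    exact (ht ξ).frequently (Frequently.of_forall fun h => h.2)
  · intro ξ hξ
    -- If the compact range missed `ξ`, it would miss a cylinder around `ξ`. But elements of `H`
    -- near `ξ` have long words in `c`; a boundary point of `H` continuing such a word is sent into
    -- that cylinder.
    have hcl : IsClosed (Set.range φ) := (isCompact_range hc).isClosed
    by_contra hcon
    obtain ⟨n, -, hn⟩ := (FreeBoundary.nhds_hasBasis ξ).mem_iff.1 (hcl.isOpen_compl.mem_nhds hcon)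
    obtain ⟨m, hm⟩ := hd n
    have hev := coneFilter_le_cofinite b ξ
      (((finite_wordLen_le c m).image (fun h : H => (h : F))).compl_mem_cofinite)
    obtain ⟨g, ⟨hg, hg'⟩, hg''⟩ := ((Filter.Frequently.and_eventually hξ hev).and_eventually
      (cone_mem_coneFilter b ξ n)).exists
    have hlen : m < wordLen c (⟨g, hg⟩ : H) := by
      by_contra hlt
      exact hg' ⟨⟨g, hg⟩, not_lt.1 hlt, rfl⟩
    have hne : (⟨g, hg⟩ : H) ≠ 1 := by
      intro h1
      rw [h1] at hlen
      simp [wordLen] at hlen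
    obtain ⟨η, hη⟩ := exists_mem_cone_of_ne_one c hne
    have := hm η _ (cone_anti η hlen.le hη)
    exact hn (show φ η ∈ {η | ∀ k < n, η.1 k = ξ.1 k} from
      fun k hk => eq_of_mem_cone this hg'' hk) ⟨η, rfl⟩

end LimitSet

/-! ### Cyclic subgroups of free groups -/

section FreeGroupAlgebra

variable {ι F : Type*} [Group F] (b : FreeGroupBasis ι F)

lemma wordElem_singleton (i : ι) (e : Bool) :
    wordElem b [(i, e)] = if e then b i else (b i)⁻¹ := by
  have h : wordElem b [(i, true)] = b i := by
    apply b.repr.injective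
    simp [wordElem, FreeGroup.of]
  cases e with
  | true => simpa using h
  | false =>
    simp only [Bool.false_eq_true, if_false]
    rw [eq_inv_iff_mul_eq_one, ← h]
    simpa using wordElem_pair b i false

lemma isCyclic_of_subsingleton_basis (b : FreeGroupBasis ι F) [Subsingleton ι] : IsCyclic F := by
  rcases isEmpty_or_nonempty ι with h | ⟨⟨i⟩⟩
  · refine ⟨1, fun g => ?_⟩
    have : basisWord b g = [] := List.eq_nil_iff_forall_not_mem.2 fun l => h.elim l.1
    rw [← wordElem_basisWord b g, this, wordElem_nil]
    exact Subgroup.one_mem (Subgroup.zpowers (1 : F))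
  · refine ⟨b i, fun g => ?_⟩
    change g ∈ Subgroup.zpowers (b i)
    rw [← wordElem_basisWord b g]
    induction basisWord b g with
    | nil => rw [wordElem_nil]; exact Subgroup.one_mem _
    | cons l L ih =>
      rw [← List.singleton_append, wordElem_append]
      refine Subgroup.mul_mem _ ?_ ih
      obtain ⟨j, e⟩ := l
      rw [Subsingleton.elim j i, wordElem_singleton]
      split_ifs
      · exact Subgroup.mem_zpowers _
      · exact Subgroup.inv_mem _ (Subgroup.mem_zpowers _)

lemma nontrivial_basis_of_not_isCyclic (b : FreeGroupBasis ι F) (h : ¬ IsCyclic F) : Nontrivial ι := by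
  by_contra hn
  rw [not_nontrivial_iff_subsingleton] at hn
  exact h (isCyclic_of_subsingleton_basis b)

/-- If `z` starts with a letter of index `i` and `j ≠ i`, then the word of `b j * z` is longer than
that of `z` and starts with `j`. The word of `z * b j` either starts with `i` or is shorter than
that of `z`. -/
lemma basis_subsingleton_of_central (b : FreeGroupBasis ι F) {z : F} (hz : z ≠ 1)
    (hc : ∀ g, g * z = z * g) :
    Subsingleton ι := by
  have hne : basisWord b z ≠ [] := fun h => hz (basisWord_injective b (by simp [h]))
  obtain ⟨⟨i, e⟩, L, hL⟩ := List.exists_cons_of_ne_nil hne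
  suffices h : ∀ j, j = i from ⟨fun j k => (h j).trans (h k).symm⟩
  intro j
  by_contra hj
  have hr : FreeGroup.IsReduced ((j, true) :: basisWord b z) := by
    rw [hL, FreeGroup.isReduced_cons_cons, ← hL]
    exact ⟨fun h => absurd h hj, isReduced_basisWord b z⟩
  have h1 : basisWord b (z * wordElem b [(j, true)]) = (j, true) :: basisWord b z := by
    rw [← hc, ← basisWord_wordElem b hr]
    conv_rhs => rw [← List.singleton_append, wordElem_append, wordElem_basisWord]
  rcases basisWord_mul_letter b z (j, true) with h2 | h2
  · rw [h1, hL] at h2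
    simp only [List.cons_append, List.cons.injEq, Prod.mk.injEq] at h2
    exact hj h2.1.1
  · rw [h1] at h2
    have := congrArg List.length h2
    simp only [List.length_append, List.length_cons] at this
    omega

/-- The subgroup generated by `x` and a generator of `H` is free and has the nontrivial central
element `x ^ p`, so it is cyclic; maximality of `H` absorbs it. Closure under roots is what turns
commensurability into membership throughout. -/
lemma IsMaxCyclic.mem_of_pow_mem {H : Subgroup F} (hH : IsMaxCyclic H) {x : F} {p : ℕ}
    (hp : x ^ p ∈ H) (h1 : x ^ p ≠ 1) (b : FreeGroupBasis ι F) : x ∈ H := by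
  have : IsFreeGroup F := b.isFreeGroup
  obtain ⟨h, rfl⟩ := (Subgroup.isCyclic_iff_exists_zpowers_eq_top H).1 hH.prop
  set K := Subgroup.closure {x, h} with hK
  have hxK : x ∈ K := Subgroup.subset_closure (by simp)
  have hhK : h ∈ K := Subgroup.subset_closure (by simp)
  have hcomm : ∀ g ∈ K, g * x ^ p = x ^ p * g := by
    intro g hg
    have hle : K ≤ Subgroup.centralizer {x ^ p} := by
      rw [hK, Subgroup.closure_le]
      rintro y (rfl | rfl)
      · exact Subgroup.mem_centralizer_singleton_iff.2 (Commute.self_pow y p).eq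
      · obtain ⟨k, hk⟩ := hp
        refine Subgroup.mem_centralizer_singleton_iff.2 ?_
        rw [← hk]
        exact (Commute.self_zpow y k).eq
    exact Subgroup.mem_centralizer_singleton_iff.1 (hle hg)
  have hsub : Subsingleton (IsFreeGroup.Generators K) :=
    basis_subsingleton_of_central (IsFreeGroup.basis K) (z := ⟨x ^ p, K.pow_mem hxK p⟩)
      (fun h => h1 (congrArg Subtype.val h)) fun g => Subtype.ext (hcomm g.1 g.2)
  have hcyc : IsCyclic K := isCyclic_of_subsingleton_basis (IsFreeGroup.basis K)
  exact hH.le_of_ge hcyc (Subgroup.zpowers_le.2 hhK) hxK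

lemma IsMaxCyclic.eq_of_mem (b : FreeGroupBasis ι F) {H H' : Subgroup F} (hH : IsMaxCyclic H)
    (hH' : IsMaxCyclic H') {x : F} (hx : x ≠ 1) (h : x ∈ H) (h' : x ∈ H') : H = H' := by
  obtain ⟨y, rfl⟩ := (Subgroup.isCyclic_iff_exists_zpowers_eq_top H').1 hH'.prop
  obtain ⟨k, rfl⟩ := h'
  have hy : y ∈ H := by
    rcases Int.eq_nat_or_neg k with ⟨m, rfl | rfl⟩
    · exact hH.mem_of_pow_mem (by simpa using h) (by simpa using hx) b
    · exact hH.mem_of_pow_mem (by simpa using H.inv_mem h) (by simpa using hx) b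
  exact le_antisymm (hH'.le_of_ge hH.prop (Subgroup.zpowers_le.2 hy)) (Subgroup.zpowers_le.2 hy)

lemma IsMaxCyclic.exists_zpowers_eq [Nontrivial F] {H : Subgroup F} (hH : IsMaxCyclic H) :
    ∃ h, h ≠ 1 ∧ Subgroup.zpowers h = H := by
  obtain ⟨h, rfl⟩ := (Subgroup.isCyclic_iff_exists_zpowers_eq_top H).1 hH.prop
  refine ⟨h, ?_, rfl⟩
  rintro rfl
  obtain ⟨y, hy⟩ := exists_ne (1 : F)
  have h1 : IsCyclic (Subgroup.zpowers y) := inferInstance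
  have := hH.le_of_ge h1 (by simp) (Subgroup.mem_zpowers y)
  simp at this
  exact hy this

/-- Every basis of a finitely generated free group is finite. -/
lemma finite_basis_of_fg (b : FreeGroupBasis ι F) [Group.FG F] : Finite ι := by
  classical
  obtain ⟨S, hS⟩ := Group.FG.out (G := F)
  let T : Set ι := ⋃ g ∈ S, {i | ∃ e, (i, e) ∈ basisWord b g}
  have hT : T.Finite := by
    refine S.finite_toSet.biUnion fun g _ => ?_
    refine ((basisWord b g).finite_toSet.image Prod.fst).subset ?_
    rintro i ⟨e, he⟩
    exact ⟨(i, e), he, rfl⟩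
  -- This homomorphism kills the basis elements that occur in the generators `S` and sends all the
  -- others to a generator of `ℤ`. It kills `S`, so it is trivial and no other basis elements exist.
  let f : F →* Multiplicative ℤ := b.lift fun i => if i ∈ T then 1 else Multiplicative.ofAdd 1
  have hfb : ∀ i, f (b i) = if i ∈ T then 1 else Multiplicative.ofAdd 1 := fun i => by
    simp [f]
  have hfw : ∀ L : List (ι × Bool), (∀ l ∈ L, l.1 ∈ T) → f (wordElem b L) = 1 := by
    intro L
    induction L with
    | nil => simp
    | cons l L ih =>
      intro h
      rw [← List.singleton_append, wordElem_append, map_mul,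
        ih fun l hl => h l (List.mem_cons_of_mem _ hl), mul_one]
      obtain ⟨i, e⟩ := l
      have hi : i ∈ T := h _ List.mem_cons_self
      rw [wordElem_singleton]
      split_ifs <;> simp [hfb, hi]
  have hker : (⊤ : Subgroup F) ≤ f.ker := by
    rw [← hS, Subgroup.closure_le]
    intro g hg
    rw [SetLike.mem_coe, MonoidHom.mem_ker, ← wordElem_basisWord b g]
    exact hfw _ fun l hl => Set.mem_biUnion hg ⟨l.2, hl⟩
  have hall : ∀ i, i ∈ T := by
    intro i
    by_contra hi
    have h1 : f (b i) = 1 := hker (Subgroup.mem_top _)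
    rw [hfb, if_neg hi] at h1
    exact absurd h1 (by decide)
  exact Set.finite_univ_iff.1 (hT.subset fun i _ => hall i)

end FreeGroupAlgebra

/-! ### Decomposition spaces -/

section DecompTopology

/-- Saturations of closed sets are projections of compact sets, so the quotient map is closed with
compact fibres, hence proper. The diagonal of `Y` is then the image of the closed kernel under a
closed map. -/
lemma t2Space_of_isClosed_ker {X Y : Type*} [TopologicalSpace X] [TopologicalSpace Y]
    [CompactSpace X] [T2Space X] {f : X → Y} (hf : IsQuotientMap f)
    (h : IsClosed {p : X × X | f p.1 = f p.2}) : T2Space Y := by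
  have hcl : IsClosedMap f := by
    intro C hC
    rw [← hf.isClosed_preimage]
    have : f ⁻¹' (f '' C) = Prod.snd '' ({p : X × X | f p.1 = f p.2} ∩ Prod.fst ⁻¹' C) := by
      ext y
      constructor
      · rintro ⟨x, hx, e⟩
        exact ⟨(x, y), ⟨e, hx⟩, rfl⟩
      · rintro ⟨⟨x, y'⟩, ⟨e, hx⟩, rfl⟩
        exact ⟨x, hx, e⟩
    rw [this]
    exact ((h.inter (hC.preimage continuous_fst)).isCompact.image continuous_snd).isClosed
  have hprop : IsProperMap f := by
    refine isProperMap_iff_isClosedMap_and_compact_fibers.2 ⟨hf.continuous, hcl, fun y => ?_⟩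
    obtain ⟨x, rfl⟩ := hf.surjective y
    have : f ⁻¹' {f x} = (fun z => (x, z)) ⁻¹' {p : X × X | f p.1 = f p.2} := by
      ext z; simp [eq_comm]
    rw [this]
    exact (h.preimage (by fun_prop)).isCompact
  rw [t2_iff_isClosed_diagonal]
  have : Set.diagonal Y = Prod.map f f '' {p : X × X | f p.1 = f p.2} := by
    ext ⟨y, y'⟩
    constructor
    · intro h
      obtain rfl : y = y' := h
      obtain ⟨x, rfl⟩ := hf.surjective y
      exact ⟨(x, x), rfl, rfl⟩
    · rintro ⟨⟨x, x'⟩, e, h⟩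
      simp only [Prod.map_apply, Prod.mk.injEq] at h
      rw [Set.mem_diagonal_iff, ← h.1, ← h.2]
      exact e
  rw [this]
  exact (hprop.prodMap hprop).isClosedMap _ h

variable {ι F : Type*} [Group F] (b : FreeGroupBasis ι F)

/-- `ξ` and `η` are the attracting and the repelling point of `x`. -/
def IsAxis (x : F) (ξ η : FreeBoundary ι) : Prop :=
  Tendsto (fun m : ℕ => x ^ m) atTop (coneFilter b ξ) ∧
    Tendsto (fun m : ℕ => x⁻¹ ^ m) atTop (coneFilter b η)

/-- The elements whose axes are lines of the line pattern of `W`. -/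
def linePattern (W : Set F) : Set F := {x | ∃ w ∈ W, IsConj w x ∨ IsConj w x⁻¹}

variable {b}

lemma IsAxis.symm {x : F} {ξ η : FreeBoundary ι} (h : IsAxis b x ξ η) : IsAxis b x⁻¹ η ξ :=
  ⟨h.2, by simpa using h.1⟩

lemma IsAxis.pow {x : F} {ξ η : FreeBoundary ι} (h : IsAxis b x ξ η) {p : ℕ} (hp : 0 < p) :
    IsAxis b (x ^ p) ξ η := by
  have hm : Tendsto (fun m : ℕ => p * m) atTop atTop :=
    tendsto_id.const_mul_atTop' hp
  refine ⟨(h.1.comp hm).congr fun m => ?_, (h.2.comp hm).congr fun m => ?_⟩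
  · simp [pow_mul]
  · simp [pow_mul, inv_pow]

/-- Elements with a common attracting point have a common positive power, which determines the
repelling point. Consequently the identifications do not chain: classes have at most two points. -/
lemma IsAxis.eq_right [Finite ι] {x y : F} {ξ η η' : FreeBoundary ι} (h : IsAxis b x ξ η)
    (h' : IsAxis b y ξ η') : η = η' := by
  obtain ⟨p, q, hp, hq, e⟩ := exists_pow_eq_pow b h.1 h'.1
  exact boundary_limit_unique (h.pow hp).2 (e ▸ (h'.pow hq).2)

lemma IsAxis.unique {x : F} {ξ η ξ' η' : FreeBoundary ι} (h : IsAxis b x ξ η)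
    (h' : IsAxis b x ξ' η') : ξ = ξ' ∧ η = η' :=
  ⟨boundary_limit_unique h.1 h'.1, boundary_limit_unique h.2 h'.2⟩

lemma IsAxis.ne_one {x : F} {ξ η : FreeBoundary ι} (h : IsAxis b x ξ η) : x ≠ 1 := by
  rintro rfl
  have := h.1.eventually
    (coneFilter_le_cofinite b ξ (Set.finite_singleton (1 : F)).compl_mem_cofinite)
  simpa using this.exists

lemma exists_isAxis [Finite ι] (b : FreeGroupBasis ι F) {x : F} (hx : x ≠ 1) :
    ∃ ξ η, IsAxis b x ξ η := by
  obtain ⟨ξ, hξ⟩ := exists_tendsto_pow b hx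
  obtain ⟨η, hη⟩ := exists_tendsto_pow b (inv_ne_one.2 hx)
  exact ⟨ξ, η, hξ, hη⟩

lemma inv_mem_linePattern {W : Set F} {x : F} (h : x ∈ linePattern W) : x⁻¹ ∈ linePattern W := by
  obtain ⟨w, hw, h⟩ := h
  exact ⟨w, hw, by simpa using h.symm⟩

lemma subset_linePattern (W : Set F) : W ⊆ linePattern W :=
  fun w hw => ⟨w, hw, Or.inl (IsConj.refl w)⟩

lemma tendsto_mul_right_iff {α : Type*} {l : Filter α} {u : α → F} {ξ : FreeBoundary ι} (s : F) :
    Tendsto (fun a => u a * s) l (coneFilter b ξ) ↔ Tendsto u l (coneFilter b ξ) :=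
  ⟨fun h => ((tendsto_mul_right b ξ s⁻¹).comp h).congr fun a => by simp,
    fun h => (tendsto_mul_right b ξ s).comp h⟩

/-- Right translation by `g⁻¹` does not affect limits, so the `w`-line through `g` has the endpoints
of the axis of `g * w * g⁻¹`. -/
lemma lineEndpoints_iff {W : Set F} {ξ η : FreeBoundary ι} :
    LineEndpoints b W ξ η ↔ ∃ w ∈ W, ∃ x, IsConj w x ∧ IsAxis b x ξ η := by
  simp only [LineEndpoints, convergesToBoundary_iff, IsAxis]
  constructor
  · rintro ⟨g, w, hw, h1, h2⟩
    refine ⟨w, hw, g * w * g⁻¹, isConj_iff.2 ⟨g, rfl⟩, ?_, ?_⟩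
    · simpa only [conj_pow, tendsto_mul_right_iff] using h1
    · have : (g * w * g⁻¹)⁻¹ = g * w⁻¹ * g⁻¹ := by group
      simpa only [this, conj_pow, tendsto_mul_right_iff] using h2
  · rintro ⟨w, hw, x, hx, h1, h2⟩
    obtain ⟨g, rfl⟩ := isConj_iff.1 hx
    refine ⟨g, w, hw, ?_, ?_⟩
    · simpa only [conj_pow, tendsto_mul_right_iff] using h1
    · have : (g * w * g⁻¹)⁻¹ = g * w⁻¹ * g⁻¹ := by group
      simpa only [this, conj_pow, tendsto_mul_right_iff] using h2

lemma decompMap_eq_of_isAxis {W : Set F} {x : F} {ξ η : FreeBoundary ι} (hx : x ∈ linePattern W)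
    (h : IsAxis b x ξ η) : decompMap b W ξ = decompMap b W η := by
  obtain ⟨w, hw, hx | hx⟩ := hx
  · exact Quot.sound (lineEndpoints_iff.2 ⟨w, hw, x, hx, h⟩)
  · exact (Quot.sound (lineEndpoints_iff.2 ⟨w, hw, _, hx, h.symm⟩)).symm

/-- Points of the boundary are identified only if they are equal or endpoints of a line. -/
lemma decompMap_eq_iff [Finite ι] {W : Set F} {ξ η : FreeBoundary ι} :
    decompMap b W ξ = decompMap b W η ↔ ξ = η ∨ ∃ x ∈ linePattern W, IsAxis b x ξ η := by
  constructor
  · intro h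
    have h' := Quot.eqvGen_exact h
    clear h
    induction h' with
    | rel ξ η h =>
      obtain ⟨w, hw, x, hx, h⟩ := lineEndpoints_iff.1 h
      exact Or.inr ⟨x, ⟨w, hw, Or.inl hx⟩, h⟩
    | refl ξ => exact Or.inl rfl
    | symm ξ η h ih =>
      rcases ih with rfl | ⟨x, hx, h⟩
      · exact Or.inl rfl
      · exact Or.inr ⟨x⁻¹, inv_mem_linePattern hx, h.symm⟩
    | trans ξ η ζ h h' ih ih' =>
      rcases ih with rfl | ⟨x, hx, hxa⟩
      · exact ih'
      · rcases ih' with rfl | ⟨y, -, hya⟩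
        · exact Or.inr ⟨x, hx, hxa⟩
        · exact Or.inl (hxa.symm.eq_right hya)
  · rintro (rfl | ⟨x, hx, h⟩)
    · rfl
    · exact decompMap_eq_of_isAxis hx h

variable (b)

lemma isQuotientMap_decompMap (W : Set F) : IsQuotientMap (decompMap b W) :=
  isQuotientMap_quot_mk

lemma surjective_decompMap (W : Set F) : Function.Surjective (decompMap b W) :=
  (isQuotientMap_decompMap b W).surjective

instance compactSpace_decompSpace [Finite ι] (W : Set F) : CompactSpace (DecompSpace b W) :=
  inferInstanceAs (CompactSpace (Quot (LineEndpoints b W)))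

/-- Only finitely many translates of an axis separate points near the identity. -/
lemma finite_translates_axis [Finite ι] (w : F) (n : ℕ) :
    {p : FreeBoundary ι × FreeBoundary ι | (∃ x, IsConj w x ∧ IsAxis b x p.1 p.2) ∧
      ¬ ∀ k < n, p.1.1 k = p.2.1 k}.Finite := by
  obtain ⟨B, hB, h⟩ := exists_finite_take_mul_eq b (S := {w, w⁻¹}) (by simp) n
  refine (hB.biUnion (t := fun z => {p : FreeBoundary ι × FreeBoundary ι |
    IsAxis b (z * w * z⁻¹) p.1 p.2}) fun z _ => Set.Subsingleton.finite ?_).subset ?_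
  · rintro ⟨ξ, η⟩ h ⟨ξ', η'⟩ h'
    obtain ⟨rfl, rfl⟩ := h.unique h'
    rfl
  · rintro ⟨ξ, η⟩ ⟨⟨x, hx, hax⟩, hne⟩
    obtain ⟨g, rfl⟩ := isConj_iff.1 hx
    -- A line that avoids `B` has a constant prefix of length `n`, so its endpoints agree that far.
    -- Otherwise the line passes through some `z` in the finite set `B` and is the axis of `z * w *
    -- z⁻¹`.
    have hex : ∃ k : ℤ, g * w ^ k ∈ B := by
      by_contra! hcon
      have hconst : ∀ k : ℤ, (basisWord b (g * w ^ k)).take n = (basisWord b g).take n := by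
        intro k
        induction k using Int.induction_on with
        | zero => simp
        | succ k ih =>
          rw [← ih, ← (h _ (hcon k)).2 w (by simp), mul_assoc, zpow_add_one]
        | pred k ih =>
          rw [← ih, ← (h _ (hcon (-k))).2 w⁻¹ (by simp), mul_assoc, zpow_sub_one]
      obtain ⟨h1, h2⟩ := hax
      have e : (g * w * g⁻¹)⁻¹ = g * w⁻¹ * g⁻¹ := by group
      simp only [e, conj_pow, tendsto_mul_right_iff] at h1 h2
      obtain ⟨m, hm, hm'⟩ := ((h1.eventually (cone_mem_coneFilter b ξ n)).and
        (h2.eventually (cone_mem_coneFilter b η n))).exists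
      have e1 := hconst m
      have e2 := hconst (-m)
      rw [zpow_natCast, mem_cone_iff_take.1 hm] at e1
      rw [zpow_neg, zpow_natCast, ← inv_pow, mem_cone_iff_take.1 hm', ← e1] at e2
      refine hne fun k hk => ?_
      have := congrArg (fun L => L[k]?) e2
      simpa [hk] using this.symm
    obtain ⟨k, hk⟩ := hex
    refine Set.mem_biUnion hk ?_
    have : g * w ^ k * w * (g * w ^ k)⁻¹ = g * w * g⁻¹ := by
      have := (Commute.self_zpow w k).eq
      calc g * w ^ k * w * (g * w ^ k)⁻¹ = g * (w ^ k * w) * (w ^ k)⁻¹ * g⁻¹ := by group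
        _ = g * w * g⁻¹ := by rw [← this]; group
    rw [Set.mem_ofPred, this]
    exact hax

/-- The decomposition space of finitely many conjugacy classes is Hausdorff. -/
lemma t2Space_decompSpace [Finite ι] {W W₀ : Set F} (hW₀ : W₀.Finite)
    (h : ∀ w ∈ W, ∃ w₀ ∈ W₀, IsConj w₀ w) : T2Space (DecompSpace b W) := by
  refine t2Space_of_isClosed_ker (isQuotientMap_decompMap b W) ?_
  let A : ℕ → Set (FreeBoundary ι × FreeBoundary ι) := fun n =>
    {p | (∃ x ∈ linePattern W, IsAxis b x p.1 p.2) ∧ ¬ ∀ k < n, p.1.1 k = p.2.1 k}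
  have hA : ∀ n, (A n).Finite := by
    intro n
    refine ((hW₀.union hW₀.inv).biUnion fun w _ => finite_translates_axis b w n).subset ?_
    rintro p ⟨⟨x, ⟨w, hw, hx⟩, hax⟩, hne⟩
    obtain ⟨w₀, hw₀, hc⟩ := h w hw
    rcases hx with hx | hx
    · exact Set.mem_biUnion (Or.inl hw₀) ⟨⟨x, hc.trans hx, hax⟩, hne⟩
    · refine Set.mem_biUnion (x := w₀⁻¹) (Or.inr (by simpa using hw₀)) ⟨⟨x, ?_, hax⟩, hne⟩
      obtain ⟨g, hg⟩ := isConj_iff.1 (hc.trans hx)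
      exact isConj_iff.2 ⟨g, by rw [← inv_inv x, ← hg]; group⟩
  have hclosed : ∀ k, IsClosed {p : FreeBoundary ι × FreeBoundary ι | p.1.1 k = p.2.1 k} := by
    intro k
    rw [← isOpen_compl_iff]
    have : {p : FreeBoundary ι × FreeBoundary ι | p.1.1 k = p.2.1 k}ᶜ =
        ⋃ a, (Prod.fst ⁻¹' {ξ | ξ.1 k ∈ ({a} : Set _)}) ∩
          (Prod.snd ⁻¹' {ξ | ξ.1 k ∈ ({a}ᶜ : Set _)}) := by
      ext p
      simp [eq_comm]
    rw [this]
    exact isOpen_iUnion fun a => ((FreeBoundary.isOpen_letter k _).preimage continuous_fst).inter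
      ((FreeBoundary.isOpen_letter k _).preimage continuous_snd)
  -- Two points are identified exactly when, for every `n`, they agree in `n` letters or form one of
  -- the finitely many pairs in `A n`; each of these conditions is closed.
  have : {p : FreeBoundary ι × FreeBoundary ι | decompMap b W p.1 = decompMap b W p.2} =
      ⋂ n, ((⋂ k ∈ Set.Iio n, {p | p.1.1 k = p.2.1 k}) ∪ A n) := by
    ext ⟨ξ, η⟩
    simp only [Set.mem_ofPred, decompMap_eq_iff, Set.mem_iInter, Set.mem_union, Set.mem_Iio]
    constructor
    · rintro (rfl | hx) n
      · exact Or.inl fun _ _ => rfl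
      · by_cases hn : ∀ k < n, ξ.1 k = η.1 k
        · exact Or.inl hn
        · exact Or.inr ⟨hx, hn⟩
    · intro hn
      by_cases e : ξ = η
      · exact Or.inl e
      · obtain ⟨k, hk⟩ : ∃ k, ξ.1 k ≠ η.1 k := by
          by_contra! hcon
          exact e (Subtype.ext (funext hcon))
        rcases hn (k + 1) with h1 | h1
        · exact absurd (h1 k (Nat.lt_succ_self k)) hk
        · exact Or.inr h1.1
  rw [this]
  exact isClosed_iInter fun n =>
    (isClosed_biInter fun k _ => hclosed k).union (hA n).isClosed

end DecompTopology

/-! ### Branches, rays and ends of trees -/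

section Branches

variable {V : Type*} {T : SimpleGraph V}

/-- The vertices separated from `u` by its neighbour `v`, including `v`. -/
def branch (T : SimpleGraph V) (u v : V) : Set V := {z | T.dist u z = T.dist v z + 1}

lemma not_mem_branch_self (u v : V) : u ∉ branch T u v := by
  simp [branch]

lemma mem_branch_of_adj {u v : V} (h : T.Adj u v) : v ∈ branch T u v := by
  simp [branch, SimpleGraph.dist_eq_one_iff_adj.2 h]

/-- Distances to the two ends of an edge of a tree differ by exactly one, so the two branches of an
edge partition the vertices. -/
lemma not_mem_branch_iff (hT : T.IsTree) {u v z : V} (h : T.Adj u v) :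
    z ∉ branch T u v ↔ z ∈ branch T v u := by
  have := hT.dist_eq_dist_add_one_of_adj z h
  simp only [branch, Set.mem_ofPred, SimpleGraph.dist_comm (v := z)] at this ⊢
  omega

lemma exists_mem_branch (hT : T.IsTree) {u z : V} (h : z ≠ u) :
    ∃ v, T.Adj u v ∧ z ∈ branch T u v := by
  obtain ⟨p, hp⟩ := hT.connected.exists_walk_length_eq_dist u z
  cases p with
  | nil => exact absurd rfl h
  | cons hadj q =>
    rename_i v
    refine ⟨v, hadj, ?_⟩
    have h1 := SimpleGraph.dist_le q
    have h2 := hT.dist_eq_dist_add_one_of_adj z hadj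
    simp only [SimpleGraph.Walk.length_cons] at hp
    simp only [branch, Set.mem_ofPred, SimpleGraph.dist_comm (v := z)] at h2 ⊢
    rw [SimpleGraph.dist_comm] at hp h1
    omega

lemma branch_unique (hT : T.IsTree) {u v w z : V} (hv : T.Adj u v) (hw : T.Adj u w)
    (h : z ∈ branch T u v) (h' : z ∈ branch T u w) : v = w := by
  obtain ⟨p, hp⟩ := hT.connected.exists_walk_length_eq_dist v z
  obtain ⟨q, hq⟩ := hT.connected.exists_walk_length_eq_dist w z
  have hp' : (SimpleGraph.Walk.cons hv p).IsPath :=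
    SimpleGraph.Walk.isPath_of_length_eq_dist _
      (by rw [SimpleGraph.Walk.length_cons, hp]; exact h.symm)
  have hq' : (SimpleGraph.Walk.cons hw q).IsPath :=
    SimpleGraph.Walk.isPath_of_length_eq_dist _
      (by rw [SimpleGraph.Walk.length_cons, hq]; exact h'.symm)
  have := (hT.isAcyclic.subsingleton_path u z).elim ⟨_, hp'⟩ ⟨_, hq'⟩
  have := congrArg (fun p : T.Path u z => p.1.snd) this
  simpa using this

/-- The edge from `u` to `v` is the only one between its two sides. If `z ≠ v`, then `z` and `z'`
lie in the same branch at `v`, which for `z'` is the branch towards `u`, a contradiction. -/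
lemma eq_of_adj_of_mem_branch (hT : T.IsTree) {u v z z' : V} (huv : T.Adj u v) (h : T.Adj z z')
    (hz : z ∈ branch T u v) (hz' : z' ∉ branch T u v) : z = v ∧ z' = u := by
  rw [not_mem_branch_iff hT huv] at hz'
  have h1 := hT.dist_eq_dist_add_one_of_adj u h
  have h2 := hT.dist_eq_dist_add_one_of_adj v h
  have hv : z = v := by
    by_contra hne
    obtain ⟨w, hw, hzw⟩ := exists_mem_branch hT hne
    have h3 := hT.dist_eq_dist_add_one_of_adj w h
    have hz'w : z' ∈ branch T v w := by
      have := hT.dist_eq_dist_add_one_of_adj z' hw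
      simp only [branch, Set.mem_ofPred, SimpleGraph.dist_comm (v := z')] at *
      rw [SimpleGraph.dist_comm (u := z') (v := w)] at *
      omega
    have := branch_unique hT huv.symm hw hz' hz'w
    subst this
    exact (not_mem_branch_iff hT hw).2 hz hzw
  refine ⟨hv, ?_⟩
  subst hv
  simp only [branch, Set.mem_ofPred, SimpleGraph.dist_self] at *
  have h0 : T.dist u z' = 0 := by omega
  exact ((hT.connected.dist_eq_zero_iff).1 h0).symm

/-- A walk that avoids an edge stays in the branch at that edge. -/
lemma mem_branch_of_walk (hT : T.IsTree) {u v z z' : V} (huv : T.Adj u v) (p : T.Walk z z')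
    (h : u ∈ p.support → v ∉ p.support) (hz : z ∈ branch T u v) : z' ∈ branch T u v := by
  induction p with
  | nil => exact hz
  | cons hadj p ih =>
    rename_i a c d
    simp only [SimpleGraph.Walk.support_cons, List.mem_cons, not_or] at h
    refine ih (fun hu => (h (Or.inr hu)).2) ?_
    by_contra hc
    obtain ⟨rfl, rfl⟩ := eq_of_adj_of_mem_branch hT huv hadj hz hc
    exact (h (Or.inr p.start_mem_support)).1 rfl

lemma branch_subset (hT : T.IsTree) {u v w : V} (huv : T.Adj u v) (hvw : T.Adj v w) (h : w ≠ u) :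
    branch T v w ⊆ branch T u v := by
  intro z hz
  by_contra hc
  exact h (branch_unique hT hvw huv.symm hz ((not_mem_branch_iff hT huv).1 hc))

lemma TreeRay.branch_anti (hT : T.IsTree) (r : TreeRay T) {k l : ℕ} (h : k ≤ l) :
    branch T (r.1 l) (r.1 (l + 1)) ⊆ branch T (r.1 k) (r.1 (k + 1)) := by
  induction l, h using Nat.le_induction with
  | base => exact subset_rfl
  | succ l _ ih =>
    exact (branch_subset hT (r.2 l).1 (r.2 (l + 1)).1 (r.2 l).2.symm).trans ih

lemma TreeRay.mem_branch (hT : T.IsTree) (r : TreeRay T) {k n : ℕ} (h : k < n) :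
    r.1 n ∈ branch T (r.1 k) (r.1 (k + 1)) := by
  obtain ⟨m, rfl⟩ := Nat.exists_eq_succ_of_ne_zero (Nat.ne_zero_of_lt h)
  exact r.branch_anti hT (Nat.le_of_lt_succ h) (mem_branch_of_adj (r.2 m).1)

lemma TreeRay.mem_branch_back (hT : T.IsTree) (r : TreeRay T) {k n : ℕ} (h : k ≤ n) :
    r.1 k ∈ branch T (r.1 (n + 1)) (r.1 n) :=
  (not_mem_branch_iff hT (r.2 n).1).1 fun h' => not_mem_branch_self _ _ (r.branch_anti hT h h')

lemma TreeRay.injective (hT : T.IsTree) (r : TreeRay T) : Function.Injective r.1 := by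
  intro k n h
  rcases lt_trichotomy k n with h' | h' | h'
  · exact absurd (h ▸ r.mem_branch hT h') (not_mem_branch_self _ _)
  · exact h'
  · exact absurd (h ▸ r.mem_branch hT h') (not_mem_branch_self _ _)

/-- Otherwise each step along the ray would bring it one closer to `z`, indefinitely. -/
lemma TreeRay.exists_not_mem_branch (r : TreeRay T) (z : V) :
    ∃ k, z ∉ branch T (r.1 k) (r.1 (k + 1)) := by
  by_contra! h
  have : ∀ k, T.dist (r.1 0) z = T.dist (r.1 k) z + k := by
    intro k
    induction k with
    | zero => simp
    | succ k ih =>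
      have := h k
      simp only [branch, Set.mem_ofPred] at this
      omega
  have := this (T.dist (r.1 0) z + 1)
  omega

lemma TreeRay.asymptotic_equivalence : Equivalence (TreeRay.Asymptotic (T := T)) where
  refl r := ⟨0, 0, fun _ => rfl⟩
  symm := fun ⟨a, b, h⟩ => ⟨b, a, fun n => (h n).symm⟩
  trans := by
    rintro r s q ⟨a, b, h⟩ ⟨c, d, h'⟩
    refine ⟨a + c, d + b, fun n => ?_⟩
    have h1 := h (n + c)
    have h2 := h' (n + b)
    rw [show n + (a + c) = n + c + a by omega, h1, show n + c + b = n + b + c by omega, h2]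
    exact congrArg q.1 (by omega)

lemma TreeRay.toEnd_eq_iff {r s : TreeRay T} : r.toEnd = s.toEnd ↔ r.Asymptotic s := by
  constructor
  · intro h
    exact (TreeRay.asymptotic_equivalence.eqvGen_iff).1 (Quot.eqvGen_exact h)
  · exact fun h => Quot.sound h

lemma TreeEnd.exists_ray (e : TreeEnd T) : ∃ r : TreeRay T, e = r.toEnd := by
  obtain ⟨r, hr⟩ := Quot.exists_rep e
  exact ⟨r, hr.symm⟩

lemma TreeRay.Asymptotic.eventually {r s : TreeRay T} (h : r.Asymptotic s) {p : V → Prop}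
    (hr : ∀ᶠ n in atTop, p (r.1 n)) : ∀ᶠ n in atTop, p (s.1 n) := by
  obtain ⟨a, b, h⟩ := h
  obtain ⟨N, hN⟩ := eventually_atTop.1 hr
  refine eventually_atTop.2 ⟨N + b, fun n hn => ?_⟩
  have := h (n - b)
  rw [Nat.sub_add_cancel (by omega)] at this
  rw [← this]
  exact hN _ (by omega)

@[simp] lemma inl_mem_treeBranch {u v z : V} :
    (Sum.inl z : V ⊕ TreeEnd T) ∈ treeBranch T u v ↔ z ∈ branch T u v := by
  simp [treeBranch, branch]

@[simp] lemma toEnd_mem_treeBranch {u v : V} {r : TreeRay T} :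
    (Sum.inr r.toEnd : V ⊕ TreeEnd T) ∈ treeBranch T u v ↔
      ∀ᶠ n in atTop, r.1 n ∈ branch T u v := by
  simp only [treeBranch, branch, Set.mem_ofPred, reduceCtorEq, false_and, exists_false, false_or,
    Sum.inr.injEq]
  constructor
  · rintro ⟨s, hs, h⟩
    exact (TreeRay.toEnd_eq_iff.1 hs.symm).eventually (p := fun z => T.dist u z = T.dist v z + 1) h
  · exact fun h => ⟨r, rfl, h⟩

lemma treeBranch_unique (hT : T.IsTree) {u v w : V} {p : V ⊕ TreeEnd T} (hv : T.Adj u v)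
    (hw : T.Adj u w) (h : p ∈ treeBranch T u v) (h' : p ∈ treeBranch T u w) : v = w := by
  rcases p with z | e
  · exact branch_unique hT hv hw (inl_mem_treeBranch.1 h) (inl_mem_treeBranch.1 h')
  · obtain ⟨r, rfl⟩ := e.exists_ray
    obtain ⟨n, h1, h2⟩ := ((toEnd_mem_treeBranch.1 h).and (toEnd_mem_treeBranch.1 h')).exists
    exact branch_unique hT hv hw h1 h2

lemma treeBranch_disjoint (hT : T.IsTree) {u v : V} {p : V ⊕ TreeEnd T} (hv : T.Adj u v)
    (h : p ∈ treeBranch T u v) (h' : p ∈ treeBranch T v u) : False := by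
  rcases p with z | e
  · exact (not_mem_branch_iff hT hv.symm).2 (inl_mem_treeBranch.1 h) (inl_mem_treeBranch.1 h')
  · obtain ⟨r, rfl⟩ := e.exists_ray
    obtain ⟨n, h1, h2⟩ := ((toEnd_mem_treeBranch.1 h).and (toEnd_mem_treeBranch.1 h')).exists
    exact (not_mem_branch_iff hT hv.symm).2 h1 h2

lemma inl_not_mem_treeBranch_self (u v : V) :
    (Sum.inl u : V ⊕ TreeEnd T) ∉ treeBranch T u v :=
  fun h => not_mem_branch_self u v (inl_mem_treeBranch.1 h)

lemma exists_mem_treeBranch (hT : T.IsTree) {u : V} {p : V ⊕ TreeEnd T} (h : p ≠ Sum.inl u) :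
    ∃ v, T.Adj u v ∧ p ∈ treeBranch T u v := by
  rcases p with z | e
  · obtain ⟨v, hv, hz⟩ := exists_mem_branch hT (u := u) (z := z) (fun e => h (by rw [e]))
    exact ⟨v, hv, inl_mem_treeBranch.2 hz⟩
  · obtain ⟨r, rfl⟩ := e.exists_ray
    obtain ⟨N, hN⟩ : ∃ N, ∀ n ≥ N, r.1 n ≠ u := by
      by_cases hu : ∃ k, r.1 k = u
      · obtain ⟨k, rfl⟩ := hu
        exact ⟨k + 1, fun n hn e => by have := r.injective hT e; omega⟩
      · exact ⟨0, fun n _ e => hu ⟨n, e⟩⟩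
    obtain ⟨v, hv, hz⟩ := exists_mem_branch hT (hN N le_rfl)
    refine ⟨v, hv, toEnd_mem_treeBranch.2 (eventually_atTop.2 ⟨N, fun n hn => ?_⟩)⟩
    induction n, hn using Nat.le_induction with
    | base => exact hz
    | succ n hn ih =>
      by_contra hc
      exact hN (n + 1) (by omega) (eq_of_adj_of_mem_branch hT hv (r.2 n).1 ih hc).2

variable {F : Type*} [Group F] [MulAction F V]

lemma dist_smul_smul (hT : T.Connected)
    (hadj : ∀ (g : F) {u v : V}, T.Adj u v → T.Adj (g • u) (g • v))
    (g : F) (u v : V) : T.dist (g • u) (g • v) = T.dist u v := by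
  have key : ∀ (g : F) (u v : V), T.dist (g • u) (g • v) ≤ T.dist u v := by
    intro g u v
    obtain ⟨p, hp⟩ := hT.exists_walk_length_eq_dist u v
    let φ : T →g T := ⟨fun z => g • z, fun h => hadj g h⟩
    have := SimpleGraph.dist_le (p.map φ)
    rwa [SimpleGraph.Walk.length_map, hp] at this
  refine le_antisymm (key g u v) ?_
  simpa using key g⁻¹ (g • u) (g • v)

lemma smul_mem_branch_iff (hT : T.Connected)
    (hadj : ∀ (g : F) {u v : V}, T.Adj u v → T.Adj (g • u) (g • v)) (g : F) {u v z : V} :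
    g • z ∈ branch T (g • u) (g • v) ↔ z ∈ branch T u v := by
  simp only [branch, Set.mem_ofPred, dist_smul_smul hT hadj]

/-- An automorphism that fixes two vertices fixes the first edge of the path between them. -/
lemma smul_eq_of_fixed (hT : T.IsTree)
    (hadj : ∀ (g : F) {u v : V}, T.Adj u v → T.Adj (g • u) (g • v)) {g : F} {u v z : V}
    (huv : T.Adj u v) (hz : z ∈ branch T u v) (hu : g • u = u) (hgz : g • z = z) : g • v = v := by
  have h1 := hadj g huv
  rw [hu] at h1
  refine branch_unique hT h1 huv ?_ hz
  have := (smul_mem_branch_iff hT.connected hadj g).2 hz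
  rwa [hu, hgz] at this

end Branches

/-! ### Directions of boundary points in the Bass-Serre tree -/

namespace RelCyclicSplitting

section Directions

variable {F V : Type*} [Group F] [MulAction F V] {M : Set F} (Γ : RelCyclicSplitting M V)

/-- The action of an element as a graph homomorphism. -/
def smulHom (g : F) : Γ.tree →g Γ.tree := ⟨fun z => g • z, fun h => Γ.adj_smul g h⟩

lemma smul_mem_branch_iff (g : F) {u v z : V} :
    g • z ∈ branch Γ.tree (g • u) (g • v) ↔ z ∈ branch Γ.tree u v :=
  _root_.smul_mem_branch_iff Γ.isTree.connected Γ.adj_smul g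

/-- A walk changes branches at `z` only by passing through `z`. This converts "translates of a
finite set miss `z`" into "the orbit stays in its branch". -/
lemma smul_mem_branch_of_walk {z w u u' : V} (hzw : Γ.tree.Adj z w) (p : Γ.tree.Walk u u') {g : F}
    (h : ∀ x ∈ p.support, g • x ≠ z) (hu : g • u ∈ branch Γ.tree z w) :
    g • u' ∈ branch Γ.tree z w := by
  refine mem_branch_of_walk Γ.isTree hzw (p.map (Γ.smulHom g)) (fun hz => ?_) hu
  have hz' : z ∈ p.support.map (Γ.smulHom g) := by rwa [← SimpleGraph.Walk.support_map]
  obtain ⟨x, hx, e⟩ := List.mem_map.1 hz'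
  exact absurd e (h x hx)

variable {ι : Type*}

/-- A finite connected set supporting walks from a vertex to its translates by the letters. -/
lemma exists_jump_support [Finite ι] (b : FreeGroupBasis ι F) (u : V) :
    ∃ P : Set V, P.Finite ∧ u ∈ P ∧
      (∀ l : ι × Bool, ∃ p : Γ.tree.Walk u (wordElem b [l] • u), ∀ x ∈ p.support, x ∈ P) ∧
      ∀ y ∈ P, ∃ p : Γ.tree.Walk u y, ∀ x ∈ p.support, x ∈ P := by
  classical
  let p : ∀ l : ι × Bool, Γ.tree.Walk u (wordElem b [l] • u) :=
    fun l => (Γ.isTree.connected u (wordElem b [l] • u)).some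
  refine ⟨insert u (⋃ l, {x | x ∈ (p l).support}), ?_, Set.mem_insert _ _, fun l => ⟨p l, ?_⟩, ?_⟩
  · exact (Set.finite_iUnion fun l => List.finite_toSet _).insert u
  · exact fun x hx => Set.mem_insert_of_mem _ (Set.mem_iUnion_of_mem l hx)
  · rintro y (rfl | hy)
    · exact ⟨.nil, fun x hx => by simp at hx; exact Or.inl hx⟩
    · obtain ⟨l, hl⟩ := Set.mem_iUnion.1 hy
      exact ⟨(p l).takeUntil y hl, fun x hx => Set.mem_insert_of_mem _
        (Set.mem_iUnion_of_mem l ((p l).support_takeUntil_subset_support hl hx))⟩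

variable (b : FreeGroupBasis ι F)

/-- The orbits converge, towards `ξ`, into the branch at `z` that contains `w`. -/
def Toward (ξ : FreeBoundary ι) (z w : V) : Prop :=
  ∀ u : V, ∀ᶠ g in coneFilter b ξ, g • u ∈ branch Γ.tree z w

variable {b} {Γ}

/-- The elements that carry `p` to `z` form a right coset of the stabilizer of `z`, and right
translation does not change limits. -/
lemma mem_limitSet_of_frequently_smul_eq {ξ : FreeBoundary ι} {p z : V}
    (h : ∃ᶠ g in coneFilter b ξ, g • p = z) : ξ ∈ limitSet b (stabilizer F z) := by
  obtain ⟨k, hk⟩ := h.exists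
  refine (tendsto_mul_right b ξ k⁻¹).frequently (h.mono fun g hg => ?_)
  rw [mem_stabilizer_iff, mul_smul, inv_smul_eq_iff.2 hk.symm, hg]

lemma eventually_smul_ne {ξ : FreeBoundary ι} {z : V} (h : ξ ∉ limitSet b (stabilizer F z))
    {P : Set V} (hP : P.Finite) : ∀ᶠ g in coneFilter b ξ, ∀ p ∈ P, g • p ≠ z :=
  (eventually_all_finite hP).2 fun _ _ => not_frequently.1 fun hf =>
    h (mem_limitSet_of_frequently_smul_eq hf)

lemma Toward.mem_branch {ξ : FreeBoundary ι} {z w y : V} (h : Γ.Toward b ξ z w)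
    (hy : ξ ∈ limitSet b (stabilizer F y)) : y ∈ branch Γ.tree z w := by
  obtain ⟨g, hg, hg'⟩ := (Filter.Frequently.and_eventually hy (h y)).exists
  rwa [mem_stabilizer_iff.1 hg] at hg'

lemma Toward.not_mem_limitSet {ξ : FreeBoundary ι} {z w : V} (h : Γ.Toward b ξ z w) :
    ξ ∉ limitSet b (stabilizer F z) :=
  fun hz => not_mem_branch_self _ _ (h.mem_branch hz)

lemma Toward.unique {ξ : FreeBoundary ι} {z w w' : V} (h : Γ.Toward b ξ z w)
    (h' : Γ.Toward b ξ z w') (hw : Γ.tree.Adj z w) (hw' : Γ.tree.Adj z w') : w = w' := by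
  obtain ⟨g, h1, h2⟩ := ((h z).and (h' z)).exists
  exact branch_unique Γ.isTree hw hw' h1 h2

lemma Toward.not_symm {ξ : FreeBoundary ι} {z w : V} (h : Γ.Toward b ξ z w)
    (hw : Γ.tree.Adj z w) : ¬ Γ.Toward b ξ w z := by
  intro h'
  obtain ⟨g, h1, h2⟩ := ((h z).and (h' z)).exists
  exact (not_mem_branch_iff Γ.isTree hw.symm).2 h1 h2

lemma Toward.back {ξ : FreeBoundary ι} {u v w : V} (h : Γ.Toward b ξ v w) (huv : Γ.tree.Adj u v)
    (hvw : Γ.tree.Adj v w) (hne : w ≠ u) : Γ.Toward b ξ u v :=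
  fun y => (h y).mono fun _ hg => branch_subset Γ.isTree huv hvw hne hg

lemma toward_of_eventually {ξ : FreeBoundary ι} {z w u : V} (hw : Γ.tree.Adj z w)
    (hξ : ξ ∉ limitSet b (stabilizer F z))
    (h : ∀ᶠ g in coneFilter b ξ, g • u ∈ branch Γ.tree z w) : Γ.Toward b ξ z w := by
  intro u'
  obtain ⟨p⟩ := Γ.isTree.connected u u'
  filter_upwards [h, eventually_smul_ne hξ (List.finite_toSet p.support)] with g hg hp
  exact Γ.smul_mem_branch_of_walk hw p hp hg

/-- A boundary point outside of the limit set of a vertex group has a direction at that vertex. -/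
lemma exists_toward [Finite ι] {ξ : FreeBoundary ι} {z : V}
    (hξ : ξ ∉ limitSet b (stabilizer F z)) : ∃ w, Γ.tree.Adj z w ∧ Γ.Toward b ξ z w := by
  obtain ⟨P, hP, hzP, hwalk, -⟩ := Γ.exists_jump_support b z
  -- In this cone no translate of `P` contains `z`. Multiplying by a letter moves the orbit point
  -- along a walk inside a translate of `P`, so the branch is constant on the cone.
  obtain ⟨n, -, hn⟩ := (coneFilter_hasBasis b ξ).mem_iff.1 (eventually_smul_ne hξ hP)
  have h0 : rayVertex b ξ n • z ≠ z := hn (rayVertex_mem_cone b ξ le_rfl) z hzP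
  obtain ⟨w, hw, hzw⟩ := exists_mem_branch Γ.isTree h0
  refine ⟨w, hw, toward_of_eventually (u := z) hw hξ
    (mem_of_superset (cone_mem_coneFilter b ξ n) ?_)⟩
  refine cone_induction hzw fun x l hx _ ih => ?_
  obtain ⟨p, hp⟩ := hwalk l
  change (x * wordElem b [l]) • z ∈ branch Γ.tree z w
  rw [mul_smul]
  exact Γ.smul_mem_branch_of_walk hw p (fun y hy => hn hx y (hp y hy)) ih

/-- Off the limit set the direction is decided by the orbit of `z` alone, which is an open
condition. -/
lemma isOpen_toward [Finite ι] {z w : V} (hw : Γ.tree.Adj z w)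
    (hcl : IsClosed (limitSet b (stabilizer F z))) : IsOpen {ξ | Γ.Toward b ξ z w} := by
  have : {ξ | Γ.Toward b ξ z w} = {ξ | ∀ᶠ g in coneFilter b ξ, g • z ∈ branch Γ.tree z w} ∩
      (limitSet b (stabilizer F z))ᶜ := by
    ext ξ
    exact ⟨fun h => ⟨h z, h.not_mem_limitSet⟩, fun h => toward_of_eventually hw h.2 h.1⟩
  rw [this]
  exact (isOpen_setOf_eventually b _).inter hcl.isOpen_compl

/-! ### Landing points in the compactified tree -/

variable (Γ) (b)

/-- The ray `r` of the tree is the limit of the orbits towards `ξ`. -/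
def LandsRay (ξ : FreeBoundary ι) (r : TreeRay Γ.tree) : Prop :=
  ∀ k, Γ.Toward b ξ (r.1 k) (r.1 (k + 1))

/-- The value at `ξ` of the quasi-map to the compactified tree. -/
def Lands (ξ : FreeBoundary ι) : V ⊕ TreeEnd Γ.tree → Prop
  | Sum.inl z => ξ ∈ limitSet b (stabilizer F z) ∧
      (z ∉ Γ.type1 → ∀ t ∈ Γ.type1, ξ ∉ limitSet b (stabilizer F t))
  | Sum.inr e => ∃ r, e = r.toEnd ∧ Γ.LandsRay b ξ r

variable {Γ} {b}

lemma LandsRay.eq_of_start_eq {ξ : FreeBoundary ι} {r s : TreeRay Γ.tree}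
    (hr : Γ.LandsRay b ξ r) (hs : Γ.LandsRay b ξ s) (h : r.1 0 = s.1 0) : r = s := by
  refine Subtype.ext (funext fun n => ?_)
  induction n with
  | zero => exact h
  | succ n ih =>
    have h1 := hr n
    have h2 := (r.2 n).1
    rw [ih] at h1 h2
    exact h1.unique (hs n) h2 (s.2 n).1

lemma LandsRay.of_asymptotic {ξ : FreeBoundary ι} {r s : TreeRay Γ.tree}
    (hr : Γ.LandsRay b ξ r) (h : r.Asymptotic s) : Γ.LandsRay b ξ s := by
  obtain ⟨a, c, h⟩ := h
  have key : ∀ n, Γ.Toward b ξ (s.1 (n + c)) (s.1 (n + c + 1)) := by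
    intro n
    have h1 := h n
    have h2 := h (n + 1)
    rw [show n + 1 + a = n + a + 1 by omega, show n + 1 + c = n + c + 1 by omega] at h2
    rw [← h1, ← h2]
    exact hr (n + a)
  exact fun k u => (key k u).mono fun g hg => s.branch_anti Γ.isTree (Nat.le_add_right k c) hg

lemma LandsRay.exists_start_eq {ξ : FreeBoundary ι} {r : TreeRay Γ.tree}
    (hr : Γ.LandsRay b ξ r) (z : V) :
    ∃ s : TreeRay Γ.tree, s.1 0 = z ∧ r.Asymptotic s ∧ Γ.LandsRay b ξ s := by
  suffices h : ∀ {x z : V}, Γ.tree.Walk z x → x = r.1 0 → ∃ s : TreeRay Γ.tree, s.1 0 = z ∧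
      r.Asymptotic s by
    obtain ⟨p⟩ := Γ.isTree.connected z (r.1 0)
    obtain ⟨s, h0, hs⟩ := h p rfl
    exact ⟨s, h0, hs, hr.of_asymptotic hs⟩
  intro x z p hx
  induction p with
  | nil => exact ⟨r, hx.symm, TreeRay.asymptotic_equivalence.refl r⟩
  | cons hadj p ih =>
    rename_i u v w
    obtain ⟨s, h0, hs⟩ := ih hx
    -- Moving the start to a neighbour either deletes the first vertex of the ray or prepends a new
    -- one.
    by_cases h1 : s.1 1 = u
    · refine ⟨⟨fun n => s.1 (n + 1), fun n => s.2 (n + 1)⟩, h1,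
        TreeRay.asymptotic_equivalence.trans hs ⟨1, 0, fun n => rfl⟩⟩
    · refine ⟨⟨fun n => Nat.casesOn n u s.1, ?_⟩, rfl,
        TreeRay.asymptotic_equivalence.trans hs ⟨0, 1, fun n => rfl⟩⟩
      rintro (_ | n)
      · exact ⟨by rw [← h0] at hadj; exact hadj, fun e => h1 e.symm⟩
      · exact s.2 n

lemma LandsRay.asymptotic {ξ : FreeBoundary ι} {r s : TreeRay Γ.tree}
    (hr : Γ.LandsRay b ξ r) (hs : Γ.LandsRay b ξ s) : r.Asymptotic s := by
  obtain ⟨s', h0, h1, h2⟩ := hr.exists_start_eq (s.1 0)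
  rwa [← h2.eq_of_start_eq hs h0]

lemma Lands.landsRay {ξ : FreeBoundary ι} {r : TreeRay Γ.tree}
    (h : Γ.Lands b ξ (Sum.inr r.toEnd)) : Γ.LandsRay b ξ r := by
  obtain ⟨s, e, hs⟩ := h
  exact hs.of_asymptotic (TreeRay.toEnd_eq_iff.1 e.symm)

/-- The landing point lies in the direction of the boundary point. -/
lemma Lands.mem_treeBranch {ξ : FreeBoundary ι} {p : V ⊕ TreeEnd Γ.tree} (h : Γ.Lands b ξ p)
    {z w : V} (hw : Γ.tree.Adj z w) (hzw : Γ.Toward b ξ z w) : p ∈ treeBranch Γ.tree z w := by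
  rcases p with y | e
  · exact inl_mem_treeBranch.2 (hzw.mem_branch h.1)
  · obtain ⟨r, rfl, hr⟩ := h
    obtain ⟨s, rfl, hrs, hs⟩ := hr.exists_start_eq z
    rw [TreeRay.toEnd_eq_iff.2 hrs, toEnd_mem_treeBranch]
    rw [hzw.unique (hs 0) hw (s.2 0).1]
    filter_upwards [eventually_gt_atTop 0] with n hn using s.mem_branch Γ.isTree hn

/-- Every boundary point has a landing point. -/
lemma exists_lands [Finite ι] (ξ : FreeBoundary ι) : ∃ p, Γ.Lands b ξ p := by
  by_cases h1 : ∃ t ∈ Γ.type1, ξ ∈ limitSet b (stabilizer F t)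
  · obtain ⟨t, ht, hξ⟩ := h1
    exact ⟨Sum.inl t, hξ, fun h => absurd ht h⟩
  by_cases h2 : ∃ v : V, ξ ∈ limitSet b (stabilizer F v)
  · obtain ⟨v, hv⟩ := h2
    exact ⟨Sum.inl v, hv, fun _ t ht ht' => h1 ⟨t, ht, ht'⟩⟩
  push Not at h2
  -- With a direction at every vertex, iteration from any start gives a ray. It does not backtrack,
  -- since the directions at two adjacent vertices cannot point at each other.
  choose nxt hadj hnxt using fun z : V => exists_toward (Γ := Γ) (h2 z)
  obtain ⟨z⟩ := Γ.isTree.connected.nonempty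
  let r : TreeRay Γ.tree := ⟨fun n => nxt^[n] z, fun n => by
    simp only [Function.iterate_succ_apply']
    refine ⟨hadj _, fun e => ?_⟩
    refine (hnxt (nxt^[n] z)).not_symm (hadj _) ?_
    have := hnxt (nxt (nxt^[n] z))
    rwa [← e] at this⟩
  refine ⟨Sum.inr r.toEnd, r, rfl, fun k => ?_⟩
  change Γ.Toward b ξ (nxt^[k] z) (nxt^[k + 1] z)
  rw [Function.iterate_succ_apply']
  exact hnxt _

/-- The limit set of a cyclic group consists of the endpoints of its axis, so `x` is commensurable
with a generator of `H` or its inverse; `H` is closed under roots. -/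
lemma mem_of_tendsto_pow_of_isMaxCyclic [Finite ι] {H : Subgroup F} (hH : IsMaxCyclic H) {x : F}
    {ξ : FreeBoundary ι} (hx : Tendsto (fun m : ℕ => x ^ m) atTop (coneFilter b ξ))
    (hξ : ξ ∈ limitSet b H) : x ∈ H := by
  obtain ⟨h, rfl⟩ := (Subgroup.isCyclic_iff_exists_zpowers_eq_top H).1 hH.prop
  have hx1 : x ≠ 1 := by
    rintro rfl
    have := hx.eventually
      (coneFilter_le_cofinite b ξ (Set.finite_singleton (1 : F)).compl_mem_cofinite)
    simpa using this.exists
  have hpow : ∀ p : ℕ, 0 < p → x ^ p ≠ 1 := by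
    intro p hp h1
    have h2 : b.repr x ^ p = 1 ^ p := by rw [← map_pow, h1, map_one, one_pow]
    have h3 := IsMulTorsionFree.pow_left_injective hp.ne' h2
    exact hx1 (by simpa using h3)
  rcases tendsto_pow_of_mem_limitSet_zpowers hξ with h1 | h1
  · obtain ⟨p, q, hp, -, e⟩ := exists_pow_eq_pow b hx h1
    exact hH.mem_of_pow_mem (e ▸ Subgroup.pow_mem _ (Subgroup.mem_zpowers h) q) (hpow p hp) b
  · obtain ⟨p, q, hp, -, e⟩ := exists_pow_eq_pow b hx h1
    exact hH.mem_of_pow_mem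
      (e ▸ Subgroup.pow_mem _ (Subgroup.inv_mem _ (Subgroup.mem_zpowers h)) q) (hpow p hp) b

lemma type1_eq_of_mem (b : FreeGroupBasis ι F) {s t : V} (hs : s ∈ Γ.type1) (ht : t ∈ Γ.type1)
    {x : F} (hx : x ≠ 1) (h : x • s = s) (h' : x • t = t) : s = t :=
  Γ.stab_injOn hs ht ((Γ.stab_type1 s hs).eq_of_mem b (Γ.stab_type1 t ht) hx h h')

lemma exists_isAxis_of_mem_limitSet [Nontrivial F] [Finite ι] {H : Subgroup F}
    (hH : IsMaxCyclic H) {ξ : FreeBoundary ι} (hξ : ξ ∈ limitSet b H) :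
    ∃ h η, Subgroup.zpowers h = H ∧ IsAxis b h ξ η := by
  obtain ⟨h, hne, rfl⟩ := hH.exists_zpowers_eq
  rcases tendsto_pow_of_mem_limitSet_zpowers hξ with h1 | h1
  · obtain ⟨η, hη⟩ := exists_tendsto_pow b (inv_ne_one.2 hne)
    exact ⟨h, η, rfl, h1, hη⟩
  · obtain ⟨η, hη⟩ := exists_tendsto_pow b hne
    exact ⟨h⁻¹, η, Subgroup.zpowers_inv, h1, by simpa using hη⟩

lemma type1_eq_of_mem_limitSet [Nontrivial F] [Finite ι] {s t : V} (hs : s ∈ Γ.type1)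
    (ht : t ∈ Γ.type1) {ξ : FreeBoundary ι} (h : ξ ∈ limitSet b (stabilizer F s))
    (h' : ξ ∈ limitSet b (stabilizer F t)) : s = t := by
  obtain ⟨x, η, hx, hax⟩ := exists_isAxis_of_mem_limitSet (Γ.stab_type1 s hs) h
  have hxs : x ∈ stabilizer F s := hx ▸ Subgroup.mem_zpowers x
  exact type1_eq_of_mem b hs ht hax.ne_one hxs
    (mem_of_tendsto_pow_of_isMaxCyclic (Γ.stab_type1 t ht) hax.1 h')

lemma type1_of_adj {v t : V} (hv : v ∉ Γ.type1) (h : Γ.tree.Adj v t) : t ∈ Γ.type1 := by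
  by_contra ht
  exact hv ((Γ.bipartite h).2 ht)

lemma not_type1_of_adj {v t : V} (hv : v ∈ Γ.type1) (h : Γ.tree.Adj v t) : t ∉ Γ.type1 :=
  (Γ.bipartite h).1 hv

/-- The landing point is unique. -/
lemma Lands.unique [Nontrivial F] [Finite ι] {ξ : FreeBoundary ι} {p q : V ⊕ TreeEnd Γ.tree}
    (hp : Γ.Lands b ξ p) (hq : Γ.Lands b ξ q) : p = q := by
  have mixed : ∀ (z : V) (r : TreeRay Γ.tree), ξ ∈ limitSet b (stabilizer F z) →
      ¬ Γ.LandsRay b ξ r := by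
    intro z r hz hr
    obtain ⟨k, hk⟩ := r.exists_not_mem_branch z
    exact hk ((hr k).mem_branch hz)
  rcases p with y | e <;> rcases q with z | e'
  · congr 1
    by_cases hy : y ∈ Γ.type1 <;> by_cases hz : z ∈ Γ.type1
    · exact type1_eq_of_mem_limitSet hy hz hp.1 hq.1
    · exact absurd hp.1 (hq.2 hz y hy)
    · exact absurd hq.1 (hp.2 hy z hz)
    -- The neighbour `t` of `y` towards `z` is of Type 1, so `ξ` has a direction at `t`. That
    -- direction would have to contain both `y` and `z`, which `t` separates.
    · by_contra hne
      obtain ⟨t, ht, hzt⟩ := exists_mem_branch Γ.isTree (Ne.symm hne)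
      obtain ⟨w, hw, htw⟩ := exists_toward (Γ := Γ) (hp.2 hy t (type1_of_adj hy ht))
      have := branch_unique Γ.isTree hw ht.symm (htw.mem_branch hp.1) (mem_branch_of_adj ht.symm)
      subst this
      exact (not_mem_branch_iff Γ.isTree ht).2 (htw.mem_branch hq.1) hzt
  · obtain ⟨r, -, hr⟩ := hq
    exact absurd hr (mixed y r hp.1)
  · obtain ⟨r, -, hr⟩ := hp
    exact absurd hr (mixed z r hq.1)
  · obtain ⟨r, rfl, hr⟩ := hp
    obtain ⟨s, rfl, hs⟩ := hq
    rw [TreeRay.toEnd_eq_iff.2 (hr.asymptotic hs)]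

lemma Lands.toward_of_type1 [Nontrivial F] [Finite ι] {ξ : FreeBoundary ι}
    {p : V ⊕ TreeEnd Γ.tree} (h : Γ.Lands b ξ p) {t w : V} (ht : t ∈ Γ.type1)
    (hw : Γ.tree.Adj t w) (hp : p ∈ treeBranch Γ.tree t w) : Γ.Toward b ξ t w := by
  have hξ : ξ ∉ limitSet b (stabilizer F t) := by
    intro hξ
    have : Γ.Lands b ξ (Sum.inl t) := ⟨hξ, fun h => absurd ht h⟩
    rw [h.unique this] at hp
    exact inl_not_mem_treeBranch_self t w hp
  obtain ⟨w', hw', htw'⟩ := exists_toward (Γ := Γ) hξ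
  rwa [treeBranch_unique Γ.isTree hw hw' hp (h.mem_treeBranch hw' htw')]

/-! ### Equivariance -/

lemma limitSet_smul {ξ ξ' : FreeBoundary ι} {g : F}
    (h : Tendsto (fun x => g * x) (coneFilter b ξ) (coneFilter b ξ')) {z : V}
    (hz : ξ ∈ limitSet b (stabilizer F z)) : ξ' ∈ limitSet b (stabilizer F (g • z)) := by
  refine mem_limitSet_of_frequently_smul_eq (p := z) (h.frequently ?_)
  exact Filter.Frequently.mono hz fun x hx => by rw [mul_smul, mem_stabilizer_iff.1 hx]

lemma tendsto_inv_mul [Finite ι] {ξ ξ' : FreeBoundary ι} {g : F}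
    (h : Tendsto (fun x => g * x) (coneFilter b ξ) (coneFilter b ξ')) :
    Tendsto (fun x => g⁻¹ * x) (coneFilter b ξ') (coneFilter b ξ) := by
  obtain ⟨ξ'', h'⟩ := exists_tendsto_mul_left b g⁻¹ ξ'
  have : Tendsto id (coneFilter b ξ) (coneFilter b ξ'') :=
    (h'.comp h).congr fun x => by simp
  rwa [boundary_limit_unique tendsto_id this]

lemma Toward.smul [Finite ι] {ξ ξ' : FreeBoundary ι} {g : F}
    (h : Tendsto (fun x => g * x) (coneFilter b ξ) (coneFilter b ξ')) {z w : V}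
    (hzw : Γ.Toward b ξ z w) : Γ.Toward b ξ' (g • z) (g • w) := by
  intro u
  filter_upwards [(tendsto_inv_mul h).eventually (hzw u)] with y hy
  rw [← Γ.smul_mem_branch_iff g, ← mul_smul, mul_inv_cancel_left] at hy
  exact hy

lemma Lands.smul [Finite ι] {ξ ξ' : FreeBoundary ι} {g : F}
    (h : Tendsto (fun x => g * x) (coneFilter b ξ) (coneFilter b ξ')) {p : V ⊕ TreeEnd Γ.tree}
    (hp : Γ.Lands b ξ p) : Γ.Lands b ξ' (Γ.smulCompactified g p) := by
  rcases p with z | e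
  · refine ⟨limitSet_smul h hp.1, fun hz t ht ht' => ?_⟩
    refine hp.2 (fun hz' => hz (Γ.smul_type1 g hz')) (g⁻¹ • t) (Γ.smul_type1 g⁻¹ ht) ?_
    exact limitSet_smul (tendsto_inv_mul h) ht'
  · obtain ⟨r, rfl, hr⟩ := hp
    exact ⟨Γ.smulRay g r, rfl, fun k => (hr k).smul h⟩

end Directions

end RelCyclicSplitting

namespace RelCyclicSplitting

/-! ### Nontriviality of edge groups and finite generation of vertex groups -/

section VertexGroups

variable {F V ι : Type*} [Group F] [MulAction F V] {M : Set F} {Γ : RelCyclicSplitting M V}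
  [Finite ι] {b : FreeGroupBasis ι F}

lemma exists_stabilizer_ne_one {v : V} (hv : v ∉ Γ.type1) : ∃ h : F, h • v = v ∧ h ≠ 1 := by
  by_contra! hcon
  have : Subsingleton (stabilizer F v) :=
    ⟨fun g h => Subtype.ext ((hcon g g.2).trans (hcon h h.2).symm)⟩
  exact Γ.stab_type2 v hv isCyclic_of_subsingleton

/-- If the decomposition space is connected then edge groups are nontrivial. -/
lemma exists_edge_stabilizer_ne_one [Nontrivial F] (hconn : ConnectedSpace (DecompSpace b M))
    {t v : V} (ht : t ∈ Γ.type1) (htv : Γ.tree.Adj t v) :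
    ∃ h : F, h ≠ 1 ∧ h • t = t ∧ h • v = v := by
  -- If the edge group is trivial, only finitely many elements carry a pair from a given finite set
  -- onto the edge. So near every boundary point the translated walks do not cross the edge, and
  -- each boundary point selects one of its sides.
  by_contra! hcon
  have hfin : ∀ P : Set V, P.Finite → ∀ ξ : FreeBoundary ι, ∀ᶠ g in coneFilter b ξ,
      ∀ p ∈ P, ∀ q ∈ P, g • p = t → g • q ≠ v := by
    intro P hP ξ
    have : {g : F | ¬ ∀ p ∈ P, ∀ q ∈ P, g • p = t → g • q ≠ v}.Finite := by
      refine (hP.biUnion (t := fun p => ⋃ q ∈ P, {g : F | g • p = t ∧ g • q = v}) fun p _ =>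
        hP.biUnion fun q _ => Set.Subsingleton.finite ?_).subset ?_
      · rintro g ⟨hg, hg'⟩ h ⟨hh, hh'⟩
        by_contra hne
        refine hcon (g * h⁻¹) (fun e => hne (mul_inv_eq_one.1 e)) ?_ ?_
        · rw [← hh, mul_smul, inv_smul_smul, hg, hh]
        · rw [← hh', mul_smul, inv_smul_smul, hg', hh']
      · intro g hg
        simp only [Set.mem_ofPred, not_forall, not_not] at hg
        obtain ⟨p, hp, q, hq, h1, h2⟩ := hg
        exact Set.mem_biUnion hp (Set.mem_biUnion hq ⟨h1, h2⟩)
    filter_upwards [coneFilter_le_cofinite b ξ this.compl_mem_cofinite] with g hg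
    simpa using hg
  have hmove : ∀ {a c u u' : V}, Γ.tree.Adj a c → (∀ {g : F} {p q : V}, g • p = a ∧ g • q = c →
      (g • p = t ∧ g • q = v) ∨ (g • p = v ∧ g • q = t)) → ∀ (p : Γ.tree.Walk u u') {g : F},
      (∀ x ∈ p.support, ∀ y ∈ p.support, g • x = t → g • y ≠ v) →
      g • u ∈ branch Γ.tree a c → g • u' ∈ branch Γ.tree a c := by
    intro a c u u' hac hor p g hp hu
    refine mem_branch_of_walk Γ.isTree hac (p.map (Γ.smulHom g)) (fun ha hc => ?_) hu
    have ha' : a ∈ p.support.map (Γ.smulHom g) := by rwa [← SimpleGraph.Walk.support_map]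
    have hc' : c ∈ p.support.map (Γ.smulHom g) := by rwa [← SimpleGraph.Walk.support_map]
    obtain ⟨x, hx, ex⟩ := List.mem_map.1 ha'
    obtain ⟨y, hy, ey⟩ := List.mem_map.1 hc'
    rcases hor (p := x) (q := y) ⟨ex, ey⟩ with h | h
    · exact hp x hx y hy h.1 h.2
    · exact hp y hy x hx h.2 h.1
  have hor1 : ∀ {g : F} {p q : V}, g • p = t ∧ g • q = v →
      (g • p = t ∧ g • q = v) ∨ (g • p = v ∧ g • q = t) := fun h => Or.inl h
  have hor2 : ∀ {g : F} {p q : V}, g • p = v ∧ g • q = t →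
      (g • p = t ∧ g • q = v) ∨ (g • p = v ∧ g • q = t) := fun h => Or.inr h
  have hindep : ∀ {ξ : FreeBoundary ι} {a c : V}, (a = t ∧ c = v) ∨ (a = v ∧ c = t) →
      ∀ u u', (∀ᶠ g in coneFilter b ξ, g • u ∈ branch Γ.tree a c) →
        ∀ᶠ g in coneFilter b ξ, g • u' ∈ branch Γ.tree a c := by
    intro ξ a c hac u u' h
    obtain ⟨p⟩ := Γ.isTree.connected u u'
    filter_upwards [h, hfin _ (List.finite_toSet p.support) ξ] with g hg hp
    rcases hac with ⟨rfl, rfl⟩ | ⟨rfl, rfl⟩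
    · exact hmove htv hor1 p hp hg
    · exact hmove htv.symm hor2 p hp hg
  have hdich : ∀ ξ : FreeBoundary ι, (∀ᶠ g in coneFilter b ξ, g • v ∈ branch Γ.tree t v) ∨
      ∀ᶠ g in coneFilter b ξ, g • v ∈ branch Γ.tree v t := by
    intro ξ
    obtain ⟨P, hP, -, hwalk, -⟩ := Γ.exists_jump_support b v
    obtain ⟨n, -, hn⟩ := (coneFilter_hasBasis b ξ).mem_iff.1 (hfin P hP ξ)
    by_cases h0 : rayVertex b ξ n • v ∈ branch Γ.tree t v
    · refine Or.inl (mem_of_superset (cone_mem_coneFilter b ξ n) ?_)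
      refine cone_induction h0 fun x l hx _ ih => ?_
      obtain ⟨p, hp⟩ := hwalk l
      change (x * wordElem b [l]) • v ∈ branch Γ.tree t v
      rw [mul_smul]
      exact hmove htv hor1 p (fun y hy z hz => hn hx y (hp y hy) z (hp z hz)) ih
    · refine Or.inr (mem_of_superset (cone_mem_coneFilter b ξ n) ?_)
      refine cone_induction ((not_mem_branch_iff Γ.isTree htv).1 h0) fun x l hx _ ih => ?_
      obtain ⟨p, hp⟩ := hwalk l
      change (x * wordElem b [l]) • v ∈ branch Γ.tree v t
      rw [mul_smul]
      exact hmove htv.symm hor2 p (fun y hy z hz => hn hx y (hp y hy) z (hp z hz)) ih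
  have hexcl : ∀ ξ : FreeBoundary ι, (∀ᶠ g in coneFilter b ξ, g • v ∈ branch Γ.tree t v) →
      ¬ ∀ᶠ g in coneFilter b ξ, g • v ∈ branch Γ.tree v t := by
    intro ξ h h'
    obtain ⟨g, h1, h2⟩ := (h.and h').exists
    exact (not_mem_branch_iff Γ.isTree htv.symm).2 h1 h2
  -- Powers of an elliptic element fix `u`, so its limit point is on the side of `u`. Applied to `x`
  -- and `x⁻¹` with `x` conjugate into `M`, this shows that identified points select the same side.
  have hfix : ∀ {x : F} {ξ : FreeBoundary ι} {u : V}, x • u = u →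
      Tendsto (fun m : ℕ => x ^ m) atTop (coneFilter b ξ) →
      ((∀ᶠ g in coneFilter b ξ, g • v ∈ branch Γ.tree t v) ↔ u ∈ branch Γ.tree t v) := by
    intro x ξ u hu hx
    have hpow : ∀ m : ℕ, x ^ m • u = u := fun m =>
      (Subgroup.pow_mem (stabilizer F u) (mem_stabilizer_iff.2 hu) m)
    constructor
    · intro h
      obtain ⟨m, hm⟩ := (hx.eventually (hindep (Or.inl ⟨rfl, rfl⟩) v u h)).exists
      rwa [hpow] at hm
    · intro h
      refine (hdich ξ).resolve_right fun h' => ?_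
      obtain ⟨m, hm⟩ := (hx.eventually (hindep (Or.inr ⟨rfl, rfl⟩) v u h')).exists
      rw [hpow] at hm
      exact (not_mem_branch_iff Γ.isTree htv.symm).2 h hm
  let S : FreeBoundary ι → Prop := fun ξ => ∀ᶠ g in coneFilter b ξ, g • v ∈ branch Γ.tree t v
  have hS : ∀ ξ η, LineEndpoints b M ξ η → S ξ = S η := by
    intro ξ η h
    obtain ⟨w, hw, x, hx, hax⟩ := lineEndpoints_iff.1 h
    obtain ⟨u, hu⟩ := Γ.elliptic w hw
    obtain ⟨g, rfl⟩ := isConj_iff.1 hx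
    have hgu : (g * w * g⁻¹) • g • u = g • u := by simp [mul_smul, hu]
    exact propext ((hfix hgu hax.1).trans (hfix (inv_smul_eq_iff.2 hgu.symm) hax.2).symm)
  let A : Set (DecompSpace b M) := {x | Quot.lift S hS x}
  have hA : IsClopen A := by
    constructor
    · rw [← isOpen_compl_iff, ← (isQuotientMap_decompMap b M).isOpen_preimage]
      have : decompMap b M ⁻¹' Aᶜ = {ξ | ∀ᶠ g in coneFilter b ξ, g • v ∈ branch Γ.tree v t} := by
        ext ξ
        exact ⟨fun h => (hdich ξ).resolve_left h, fun h h' => hexcl ξ h' h⟩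
      rw [this]
      exact isOpen_setOf_eventually b _
    · rw [← (isQuotientMap_decompMap b M).isOpen_preimage]
      exact isOpen_setOf_eventually b _
  -- Both sides occur: limits of nontrivial elements fixing `v` and `t` lie on the respective sides.
  obtain ⟨h₁, hv₁, hne₁⟩ := exists_stabilizer_ne_one (not_type1_of_adj ht htv)
  obtain ⟨h₂, hne₂, hh₂⟩ := (Γ.stab_type1 t ht).exists_zpowers_eq
  have ht₂ : h₂ • t = t := mem_stabilizer_iff.1 (hh₂ ▸ Subgroup.mem_zpowers h₂)
  obtain ⟨ξ₁, hξ₁⟩ := exists_tendsto_pow b hne₁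
  obtain ⟨ξ₂, hξ₂⟩ := exists_tendsto_pow b hne₂
  have hS₁ : decompMap b M ξ₁ ∈ A := (hfix hv₁ hξ₁).2 (mem_branch_of_adj htv)
  have hS₂ : decompMap b M ξ₂ ∉ A := fun h => not_mem_branch_self _ _ ((hfix ht₂ hξ₂).1 h)
  rcases isClopen_iff.1 hA with h | h
  · rw [h] at hS₁; exact hS₁
  · rw [h] at hS₂; exact hS₂ trivial

/-- The branch at `z` containing `w` can be left towards `z` only through `w`. -/
lemma exists_mem_support_smul_eq {z w u u' : V} (hzw : Γ.tree.Adj z w) (p : Γ.tree.Walk u u')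
    {g : F} (hu : g • u ∈ branch Γ.tree z w) (hu' : g • u' = z) : ∃ x ∈ p.support, g • x = w := by
  by_contra! hcon
  refine not_mem_branch_self (T := Γ.tree) z w ?_
  rw [← hu'] at hu ⊢
  subst hu'
  refine mem_branch_of_walk Γ.isTree hzw (p.map (Γ.smulHom g)) (fun _ hw => ?_) hu
  have hw' : w ∈ p.support.map (Γ.smulHom g) := by rwa [← SimpleGraph.Walk.support_map]
  obtain ⟨x, hx, e⟩ := List.mem_map.1 hw'
  exact hcon x hx e

/-- Vertex groups are finitely generated. -/
lemma fg_stabilizer_type2 (b : FreeGroupBasis ι F) {v : V} (hv : v ∉ Γ.type1) :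
    (stabilizer F v).FG := by
  classical
  obtain ⟨P, hP, hvP, hwalk, hconnP⟩ := Γ.exists_jump_support b v
  -- `k p` carries `p` to `v` whenever possible. The value `1` at `v` matters: it makes the final
  -- projection of `g` to the vertex group equal to `g`. Elsewhere `1` is a dummy value.
  let k : V → F := fun p => if p = v then 1 else if h : ∃ g : F, g • p = v then h.choose else 1
  have hkv : k v = 1 := by simp [k]
  have hk : ∀ {g : F} {p : V}, g • p = v → k p • p = v := by
    intro g p h
    by_cases hp : p = v
    · simp [k, hp]
    · have hex : ∃ g : F, g • p = v := ⟨g, h⟩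
      simp only [k, if_neg hp, dif_pos hex]
      exact hex.choose_spec
  -- `γ q q'` is a chosen element of the vertex group carrying `q'` to `q`, if there is one.
  let γ : V → V → F := fun q q' =>
    if h : ∃ g : F, g • q' = q ∧ g • v = v then h.choose else 1
  have hγ : ∀ {g : F} {q q' : V}, g • q' = q → g • v = v → γ q q' • q' = q ∧ γ q q' • v = v := by
    intro g q q' h h'
    have hex : ∃ g : F, g • q' = q ∧ g • v = v := ⟨g, h, h'⟩
    simp only [γ, dif_pos hex]
    exact hex.choose_spec
  have he : ∀ q : V, ∃ e : F, q ∈ Γ.type1 → Subgroup.zpowers e = stabilizer F v ⊓ stabilizer F q := by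
    intro q
    by_cases hq : q ∈ Γ.type1
    · have h1 : IsCyclic (stabilizer F q) := (Γ.stab_type1 q hq).prop
      have h2 : IsCyclic (stabilizer F v ⊓ stabilizer F q : Subgroup F) :=
        Subgroup.isCyclic_of_le inf_le_right
      obtain ⟨e, he⟩ := (Subgroup.isCyclic_iff_exists_zpowers_eq_top _).1 h2
      exact ⟨e, fun _ => he⟩
    · exact ⟨1, fun h => absurd h hq⟩
  choose e he using he
  let Q : Set V := Set.image2 (fun p q => k p • q) P P
  let A : Set F := (⋃ l : ι × Bool, Set.image2 (fun p p' => k p * wordElem b [l] * (k p')⁻¹) P P) ∪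
    (Set.image2 γ Q Q ∪ e '' Q)
  have hQ : Q.Finite := hP.image2 _ hP
  have hA : A.Finite := (Set.finite_iUnion fun l => hP.image2 _ hP).union
    ((hQ.image2 _ hQ).union (hQ.image e))
  let H : Subgroup F := Subgroup.closure (A ∩ stabilizer F v)
  have hH : ∀ {x : F}, x ∈ A → x • v = v → x ∈ H :=
    fun h h' => Subgroup.subset_closure ⟨h, h'⟩
  -- The path spelled by a word is projected to the vertex group. While the translate of `P` meets
  -- `v`, the projection `x * (k p)⁻¹` stays in `H`. During an excursion away from `v`, the
  -- invariant is that the neighbour `t` of `v` behind which the orbit lies is an `H`-translate of a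
  -- point of the finite set `Q`.
  have hmain : ∀ L : List (ι × Bool),
      (∀ p ∈ P, wordElem b L • p = v → wordElem b L * (k p)⁻¹ ∈ H) ∧
      ∀ t, Γ.tree.Adj v t → wordElem b L • v ∈ branch Γ.tree v t →
        (∀ p ∈ P, wordElem b L • p ≠ v) → ∃ y ∈ H, ∃ q ∈ Q, y • q = t := by
    intro L
    induction L using List.reverseRecOn with
    | nil =>
      rw [wordElem_nil]
      refine ⟨fun p _ hp => ?_, fun t _ _ h => absurd (one_smul F v) (h v hvP)⟩
      rw [one_smul] at hp
      rw [hp, hkv]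
      simp [H.one_mem]
    | append_singleton L l ih =>
      rw [wordElem_append]
      set x := wordElem b L with hx
      set s := wordElem b [l] with hs
      obtain ⟨W, hW⟩ : ∃ p : Γ.tree.Walk v (s • v), ∀ x ∈ p.support, x ∈ P := hwalk l
      obtain ⟨ih1, ih2⟩ := ih
      by_cases hnear : ∃ p ∈ P, x • p = v
      · obtain ⟨p, hp, hxp⟩ := hnear
        have hy := ih1 p hp hxp
        have hyv : (x * (k p)⁻¹) • v = v := by
          rw [mul_smul, inv_smul_eq_iff.2 (hk hxp).symm, hxp]
        constructor
        · intro p' hp' hxp'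
          have hy'v : (x * s * (k p')⁻¹) • v = v := by
            rw [mul_smul, inv_smul_eq_iff.2 (hk hxp').symm, hxp']
          have e1 : x * s * (k p')⁻¹ = x * (k p)⁻¹ * (k p * s * (k p')⁻¹) := by group
          rw [e1]
          refine H.mul_mem hy (hH (Or.inl (Set.mem_iUnion_of_mem l ⟨p, hp, p', hp', rfl⟩)) ?_)
          rw [e1, mul_smul _ _ v] at hy'v
          rw [smul_eq_iff_eq_inv_smul] at hy'v
          rw [hy'v]
          exact inv_smul_eq_iff.2 hyv.symm
        · intro t hvt hxs _
          obtain ⟨R, hR⟩ := hconnP p hp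
          rw [mul_smul] at hxs
          obtain ⟨z, hz, hxz⟩ := exists_mem_support_smul_eq hvt (W.reverse.append R) hxs hxp
          have hzP : z ∈ P := by
            rw [SimpleGraph.Walk.mem_support_append_iff] at hz
            rcases hz with hz | hz
            · exact hW z (by simpa using hz)
            · exact hR z hz
          refine ⟨_, hy, k p • z, ⟨p, hp, z, hzP, rfl⟩, ?_⟩
          rw [mul_smul, inv_smul_smul, hxz]
      · push Not at hnear
        have hxv : x • v ≠ v := hnear v hvP
        obtain ⟨t, hvt, hxt⟩ := exists_mem_branch Γ.isTree hxv
        obtain ⟨y, hy, q, hq, hyq⟩ := ih2 t hvt hxt hnear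
        have hyv : y • v = v := by
          have : H ≤ stabilizer F v := (Subgroup.closure_le _).2 Set.inter_subset_right
          exact this hy
        have hxst : (x * s) • v ∈ branch Γ.tree v t := by
          rw [mul_smul]
          exact Γ.smul_mem_branch_of_walk hvt W (fun z hz => hnear z (hW z hz)) hxt
        constructor
        · intro p' hp' hxp'
          obtain ⟨R, hR⟩ := hconnP p' hp'
          obtain ⟨z, hz, hxz⟩ := exists_mem_support_smul_eq hvt R hxst hxp'
          set y' := x * s * (k p')⁻¹ with hy'
          have hy'v : y' • v = v := by
            rw [hy', mul_smul, inv_smul_eq_iff.2 (hk hxp').symm, hxp']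
          set q' := k p' • z with hq'
          have hq'Q : q' ∈ Q := ⟨p', hp', z, hR z hz, rfl⟩
          have hy'q' : y' • q' = t := by
            rw [hy', hq', mul_smul, inv_smul_smul, hxz]
          have hq't : q' ∈ Γ.type1 := by
            rw [← inv_smul_eq_iff.2 hy'q'.symm]
            exact Γ.smul_type1 _ (type1_of_adj hv hvt)
          have h1 : (y⁻¹ * y') • q' = q := by
            rw [mul_smul, hy'q', ← hyq, inv_smul_smul]
          have h2 : (y⁻¹ * y') • v = v := by
            rw [mul_smul, hy'v]; exact inv_smul_eq_iff.2 hyv.symm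
          obtain ⟨h3, h4⟩ := hγ h1 h2
          have hγH : γ q q' ∈ H := hH (Or.inr (Or.inl ⟨q, hq, q', hq'Q, rfl⟩)) h4
          have heH : e q' ∈ H := by
            refine hH (Or.inr (Or.inr ⟨q', hq'Q, rfl⟩)) ?_
            have : e q' ∈ stabilizer F v ⊓ stabilizer F q' :=
              he q' hq't ▸ Subgroup.mem_zpowers _
            exact this.1
          -- The elements `y` and `y'` at the two ends of an excursion behind `t` differ by `γ q q'`
          -- up to the stabilizer of the edge from `v` to `q'`, which is generated by `e q'`.
          have h5 : (γ q q')⁻¹ * (y⁻¹ * y') ∈ stabilizer F v ⊓ stabilizer F q' := by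
            refine ⟨?_, ?_⟩
            · change (_ * _) • v = v
              rw [mul_smul, h2]; exact inv_smul_eq_iff.2 h4.symm
            · change (_ * _) • q' = q'
              rw [mul_smul, h1]; exact inv_smul_eq_iff.2 h3.symm
          rw [← he q' hq't] at h5
          have h6 := (Subgroup.zpowers_le.2 heH) h5
          have e1 : y' = y * (γ q q' * ((γ q q')⁻¹ * (y⁻¹ * y'))) := by group
          rw [e1]
          exact H.mul_mem hy (H.mul_mem hγH h6)
        · intro t' hvt' hxst' _
          rw [branch_unique Γ.isTree hvt' hvt hxst' hxst]
          exact ⟨y, hy, q, hq, hyq⟩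
  have hHeq : H = stabilizer F v := by
    refine le_antisymm ((Subgroup.closure_le _).2 Set.inter_subset_right) fun g hg => ?_
    have := (hmain (basisWord b g)).1 v hvP
    rw [wordElem_basisWord, hkv] at this
    simpa using this hg
  rw [← hHeq]
  exact (Subgroup.fg_iff _).2 ⟨_, rfl, hA.subset Set.inter_subset_left⟩

lemma fg_stabilizer (Γ : RelCyclicSplitting M V) (b : FreeGroupBasis ι F) (z : V) : (stabilizer F z).FG := by
  by_cases hz : z ∈ Γ.type1
  · obtain ⟨h, hh⟩ := (Subgroup.isCyclic_iff_exists_zpowers_eq_top _).1 (Γ.stab_type1 z hz).prop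
    exact (Subgroup.fg_iff _).2 ⟨{h}, by rw [← Subgroup.zpowers_eq_closure, hh],
      Set.finite_singleton h⟩
  · exact fg_stabilizer_type2 b hz

end VertexGroups

end RelCyclicSplitting

/-! ### Limit sets of finitely generated subgroups and commensurability -/

lemma isClosed_limitSet {F ι : Type*} [Group F] [Finite ι] (b : FreeGroupBasis ι F)
    {H : Subgroup F} (hH : H.FG) : IsClosed (limitSet b H) := by
  have : IsFreeGroup F := b.isFreeGroup
  have : Group.FG H := (Group.fg_iff_subgroup_fg H).2 hH
  have : Finite (IsFreeGroup.Generators H) := finite_basis_of_fg (IsFreeGroup.basis H)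
  obtain ⟨φ, hφ, -, -, hr⟩ := exists_subgroup_boundaryMap b (IsFreeGroup.basis H)
  rw [← hr]
  exact (isCompact_range hφ).isClosed

section Commensurability

variable {ι F : Type*} [Group F] {b : FreeGroupBasis ι F}

lemma not_isOfFinOrder_of_ne_one (b : FreeGroupBasis ι F) {x : F} (hx : x ≠ 1) :
    ¬ IsOfFinOrder x := fun h =>
  hx (by simpa using (isOfFinOrder_iff_eq_one _).1 (b.repr.toMonoidHom.isOfFinOrder h))

lemma decompMap_eq_of_zpow_mem {W : Set F} {x : F} {ξ η : FreeBoundary ι} (h : IsAxis b x ξ η)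
    {k : ℤ} (hk : k ≠ 0) (hx : x ^ k ∈ linePattern W) : decompMap b W ξ = decompMap b W η := by
  rcases Int.eq_nat_or_neg k with ⟨m, rfl | rfl⟩
  · exact decompMap_eq_of_isAxis (by simpa using hx) (h.pow (p := m) (by omega))
  · exact decompMap_eq_of_isAxis (by simpa using inv_mem_linePattern hx)
      (h.pow (p := m) (by omega))

variable [Finite ι]

/-- A ray of `H` converging to `ξ` fellow-travels the powers of `x` with a constant offset; dividing
two coincidences cancels the offset. -/
lemma exists_pow_mem_of_mem_limitSet {H : Subgroup F} (hH : H.FG) {x : F}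
    {ξ : FreeBoundary ι} (hx : Tendsto (fun m : ℕ => x ^ m) atTop (coneFilter b ξ))
    (hξ : ξ ∈ limitSet b H) : ∃ p : ℕ, 0 < p ∧ x ^ p ∈ H := by
  have : IsFreeGroup F := b.isFreeGroup
  have : Group.FG H := (Group.fg_iff_subgroup_fg H).2 hH
  have : Finite (IsFreeGroup.Generators H) := finite_basis_of_fg (IsFreeGroup.basis H)
  set c := IsFreeGroup.basis H
  obtain ⟨φ, -, -, ht, hr⟩ := exists_subgroup_boundaryMap b c
  rw [← hr] at hξ
  obtain ⟨ζ, rfl⟩ := hξ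
  have hS := (finite_letters c).image (fun h : H => (h : F))
  obtain ⟨y, hy⟩ := exists_mul_eq_of_tendsto b (hS.insert x)
    (u := fun m => ((rayVertex c ζ m : H) : F)) (u' := fun m => x ^ m)
    (fun m => Or.inr ⟨_, ⟨ζ.1 m, rfl⟩, by rw [rayVertex_succ]; simp⟩)
    ((ht ζ).comp (tendsto_rayVertex c ζ)) (fun m => Or.inl (by simp [pow_succ])) hx
  obtain ⟨m₁, -, n₁, -, e₁⟩ := hy 0
  obtain ⟨m₂, -, n₂, hn, e₂⟩ := hy (n₁ + 1)
  refine ⟨n₂ - n₁, by omega, ?_⟩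
  rw [pow_sub x (by omega), ← e₁, ← e₂, mul_inv_rev, mul_assoc, mul_inv_cancel_left]
  exact H.mul_mem (rayVertex c ζ m₂).2 (H.inv_mem (rayVertex c ζ m₁).2)

lemma IsAxis.of_pow {x : F} {ξ η : FreeBoundary ι} {p : ℕ} (hp : 0 < p)
    (h : IsAxis b (x ^ p) ξ η) : IsAxis b x ξ η := by
  obtain ⟨ξ', η', h'⟩ := exists_isAxis b (x := x) (fun e => h.ne_one (by rw [e, one_pow]))
  obtain ⟨rfl, rfl⟩ := h.unique (h'.pow hp)
  exact h'

end Commensurability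

/-- Positive words in two letters already form an uncountable family. This will produce points in
the limit set of a Type 2 group that are not endpoints of any axis. -/
lemma FreeBoundary.uncountable {κ : Type*} [Nontrivial κ] : Uncountable (FreeBoundary κ) := by
  obtain ⟨i, j, hij⟩ := exists_pair_ne κ
  classical
  rw [← not_countable_iff]
  intro hc
  let f : (ℕ → Bool) → FreeBoundary κ :=
    fun a => ⟨fun k => (if a k then i else j, true), fun n h => by simpa using congrArg Prod.snd h⟩
  have hf : Function.Injective f := by
    intro a a' h
    funext k
    have : (if a k then i else j) = if a' k then i else j :=
      congrArg Prod.fst (congrFun (congrArg Subtype.val h) k)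
    cases h1 : a k <;> cases h2 : a' k <;> simp_all
  have hc' : Countable (ℕ → Bool) := hf.countable
  obtain ⟨s, hs⟩ := exists_surjective_nat (ℕ → Bool)
  obtain ⟨n, hn⟩ := hs fun k => !(s k k)
  have := congrFun hn n
  simp at this

namespace RelCyclicSplitting

/-! ### The shadow lemma and the ends of the tree -/

section Shadows

variable {F V ι : Type*} [Group F] [MulAction F V] {M : Set F} (Γ : RelCyclicSplitting M V)
  [Finite ι] (b : FreeGroupBasis ι F)

/-- Away from finitely many vertices `z`, the elements that carry some vertex of a given finite
set to `z` have a long initial segment in common. -/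
lemma exists_finite_take_eq (Γ : RelCyclicSplitting M V) {P : Set V} (hP : P.Finite) (n : ℕ) :
    ∃ E : Set V, E.Finite ∧ ∀ z ∉ E, ∀ x y : F, x⁻¹ • z ∈ P → y⁻¹ • z ∈ P →
      (basisWord b x).take n = (basisWord b y).take n := by
  classical
  have hgen : ∀ p : V, ∃ S : Set F, S.Finite ∧ Subgroup.closure S = stabilizer F p := by
    intro p
    obtain ⟨S, h1, h2⟩ := (Subgroup.fg_iff _).1 (Γ.fg_stabilizer b p)
    exact ⟨S, h2, h1⟩
  choose S hS hSc using hgen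
  let k : V → V → F := fun p q => if h : ∃ g : F, g • q = p then h.choose else 1
  have hk : ∀ {g : F} {p q : V}, g • q = p → k p q • q = p := by
    intro g p q h
    have hex : ∃ g : F, g • q = p := ⟨g, h⟩
    simp only [k, dif_pos hex]
    exact hex.choose_spec
  -- Any two elements carrying points of `P` to `z` are linked by right multiplications by
  -- stabilizer generators and one transporter `k p q`. All elements of the chain carry a point of
  -- `P` to `z`, so for `z` outside the translates of `P` by `B` they avoid `B` and share their
  -- prefix.
  obtain ⟨B, hB, hstep⟩ := exists_finite_take_mul_eq b
    ((hP.biUnion fun p _ => hS p).union (hP.image2 k hP)) n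
  refine ⟨Set.image2 (fun g p => g • p) B P, hB.image2 _ hP, fun z hz x y hx hy => ?_⟩
  have hout : ∀ {g : F} {p : V}, p ∈ P → g • p = z → g ∉ B :=
    fun hp e hg => hz ⟨_, hg, _, hp, e⟩
  set p := x⁻¹ • z with hp
  set q := y⁻¹ • z with hq
  have hxp : x • p = z := by rw [hp, smul_inv_smul]
  have hyq : y • q = z := by rw [hq, smul_inv_smul]
  have hstab : ∀ h ∈ Subgroup.closure (S p), h • p = p ∧ ∀ g : F, g • p = z →
      (basisWord b (g * h)).take n = (basisWord b g).take n := by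
    intro h hh
    induction hh using Subgroup.closure_induction with
    | mem s hs =>
      have : s ∈ stabilizer F p := hSc p ▸ Subgroup.subset_closure hs
      exact ⟨this, fun g hg => (hstep g (hout hx hg)).2 s (Or.inl (Set.mem_biUnion hx hs))⟩
    | one => exact ⟨one_smul _ _, fun g _ => by rw [mul_one]⟩
    | mul h h' _ _ ih ih' =>
      refine ⟨by rw [mul_smul, ih'.1, ih.1], fun g hg => ?_⟩
      rw [← mul_assoc, ih'.2 (g * h) (by rw [mul_smul, ih.1, hg]), ih.2 g hg]
    | inv h _ ih =>
      have hinv : h⁻¹ • p = p := inv_smul_eq_iff.2 ih.1.symm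
      refine ⟨hinv, fun g hg => ?_⟩
      have := ih.2 (g * h⁻¹) (by rw [mul_smul, hinv, hg])
      rw [inv_mul_cancel_right] at this
      exact this.symm
  have hδ : (x⁻¹ * y) • q = p := by rw [mul_smul, hyq]
  have hmem : x⁻¹ * y * (k p q)⁻¹ ∈ stabilizer F p := by
    change (_ * _) • p = p
    rw [mul_smul, inv_smul_eq_iff.2 (hk hδ).symm, hδ]
  obtain ⟨h1, h2⟩ := hstab _ (by rwa [hSc])
  have h3 := (hstep (x * (x⁻¹ * y * (k p q)⁻¹)) (hout hx (by rw [mul_smul, h1, hxp]))).2 (k p q)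
    (Or.inr ⟨p, hx, q, hy, rfl⟩)
  rw [h2 x hxp] at h3
  rw [← h3]
  congr 2
  group

/-- The part of the boundary behind a vertex is small, away from finitely many vertices. -/
lemma exists_finite_shadow (u : V) (n : ℕ) :
    ∃ E : Set V, E.Finite ∧ ∀ z ∉ E, ∀ w, Γ.tree.Adj z w → u ∈ branch Γ.tree z w →
      ∀ ξ η : FreeBoundary ι, ¬ Γ.Toward b ξ z w → ¬ Γ.Toward b η z w →
        ∀ k < n, ξ.1 k = η.1 k := by
  obtain ⟨P, hP, -, hwalk, -⟩ := Γ.exists_jump_support b u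
  obtain ⟨s, hs, hrep⟩ := Γ.finite_vertices
  obtain ⟨E, hE, hEtake⟩ := Γ.exists_finite_take_eq b (hP.union hs) n
  refine ⟨E ∪ Set.image2 (fun g p => g • p) {g : F | wordLen b g ≤ n} P,
    hE.union ((finite_wordLen_le b n).image2 _ hP), fun z hz w hw hu => ?_⟩
  -- Each point behind `z` is close to an element carrying a point of a finite set to `z`. For
  -- points of the limit set it comes from the stabilizer and an orbit representative. Otherwise the
  -- ray to `ξ` must carry the orbit of `u` across `z`; removing the translates of `P` by short
  -- elements forces this to happen at depth at least `n`.
  have key : ∀ ξ : FreeBoundary ι, ¬ Γ.Toward b ξ z w →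
      ∃ x : F, x⁻¹ • z ∈ P ∪ s ∧ x ∈ cone b ξ n := by
    intro ξ hξ
    by_cases hΛ : ξ ∈ limitSet b (stabilizer F z)
    · obtain ⟨a, ha⟩ := hrep z
      have hev := (tendsto_mul_right b ξ a⁻¹).eventually (cone_mem_coneFilter b ξ n)
      obtain ⟨h, hh, hcone⟩ := (Filter.Frequently.and_eventually hΛ hev).exists
      refine ⟨h * a⁻¹, Or.inr ?_, hcone⟩
      rw [mul_inv_rev, inv_inv, mul_smul, inv_smul_eq_iff.2 (mem_stabilizer_iff.1 hh).symm]
      exact ha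
    · obtain ⟨w', hw', hzw'⟩ := exists_toward (Γ := Γ) hΛ
      have hne : w' ≠ w := by rintro rfl; exact hξ hzw'
      obtain ⟨m, hm, hm'⟩ : ∃ m, rayVertex b ξ m • u ∈ branch Γ.tree z w ∧
          rayVertex b ξ (m + 1) • u ∉ branch Γ.tree z w := by
        by_contra! hcon
        have hall : ∀ m, rayVertex b ξ m • u ∈ branch Γ.tree z w := by
          intro m
          induction m with
          | zero => simpa using hu
          | succ m ih => exact hcon m ih
        obtain ⟨m, hm⟩ := ((tendsto_rayVertex b ξ).eventually (hzw' u)).exists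
        exact hne (branch_unique Γ.isTree hw' hw hm (hall m))
      rw [rayVertex_succ, mul_smul] at hm'
      obtain ⟨p, hp⟩ := hwalk (ξ.1 m)
      obtain ⟨y, hy, hyz⟩ : ∃ y ∈ p.support, rayVertex b ξ m • y = z := by
        by_contra! hcon
        exact hm' (Γ.smul_mem_branch_of_walk hw p hcon hm)
      have hyP := hp y hy
      refine ⟨rayVertex b ξ m, Or.inl ?_, rayVertex_mem_cone b ξ ?_⟩
      · rwa [← hyz, inv_smul_smul]
      · by_contra hlt
        exact hz (Or.inr ⟨rayVertex b ξ m,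
          (wordLen_rayVertex b ξ m).le.trans (not_le.1 hlt).le, y, hyP, hyz⟩)
  intro ξ η hξ hη k hk
  obtain ⟨x, hx, hxc⟩ := key ξ hξ
  obtain ⟨y, hy, hyc⟩ := key η hη
  have h1 := hEtake z (fun h => hz (Or.inl h)) x y hx hy
  rw [mem_cone_iff_take.1 hxc, mem_cone_iff_take.1 hyc] at h1
  have := congrArg (fun L => L[k]?) h1
  simpa [hk] using this

variable {Γ} {b}

/-- Different boundary points do not land at the same end. -/
lemma LandsRay.boundary_unique {ξ η : FreeBoundary ι} {r : TreeRay Γ.tree}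
    (h : Γ.LandsRay b ξ r) (h' : Γ.LandsRay b η r) : ξ = η := by
  refine Subtype.ext (funext fun m => ?_)
  obtain ⟨E, hE, hsh⟩ := Γ.exists_finite_shadow b (r.1 0) (m + 1)
  obtain ⟨k, hk⟩ : ∃ k, r.1 (k + 1) ∉ E := by
    by_contra! hcon
    have hinj : Function.Injective fun k => r.1 (k + 1) :=
      fun i j e => Nat.succ_injective (r.injective Γ.isTree e)
    exact Set.infinite_univ (hE.preimage hinj.injOn |>.subset fun k _ => hcon k)
  exact hsh _ hk (r.1 k) (r.2 k).1.symm (r.mem_branch_back Γ.isTree (Nat.zero_le k)) ξ η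
    ((h k).not_symm (r.2 k).1) ((h' k).not_symm (r.2 k).1) m (Nat.lt_succ_self m)

lemma exists_smul_eq_ne_one [Nontrivial F] (Γ : RelCyclicSplitting M V) (z : V) :
    ∃ h : F, h • z = z ∧ h ≠ 1 := by
  by_cases hz : z ∈ Γ.type1
  · obtain ⟨h, hne, hh⟩ := (Γ.stab_type1 z hz).exists_zpowers_eq
    exact ⟨h, mem_stabilizer_iff.1 (hh ▸ Subgroup.mem_zpowers h), hne⟩
  · exact exists_stabilizer_ne_one hz

/-- Every end is the landing point of a boundary point. -/
lemma exists_landsRay [Nontrivial F] (b : FreeGroupBasis ι F) (r : TreeRay Γ.tree) :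
    ∃ ξ, Γ.LandsRay b ξ r := by
  -- The sets of boundary points not directed backwards along `r` are closed, nested and nonempty,
  -- so compactness gives a common point.
  let D : ℕ → Set (FreeBoundary ι) := fun k => {ξ | ¬ Γ.Toward b ξ (r.1 (k + 1)) (r.1 k)}
  have hD : ∀ k, IsClosed (D k) := fun k =>
    (isOpen_toward (r.2 k).1.symm (isClosed_limitSet b (Γ.fg_stabilizer b _))).isClosed_compl
  have hne : ∀ k, (D k).Nonempty := by
    intro k
    obtain ⟨h, hz, hh⟩ := Γ.exists_smul_eq_ne_one (r.1 (k + 1))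
    obtain ⟨ξ, hξ⟩ := exists_tendsto_pow b hh
    exact ⟨ξ, fun ht => ht.not_mem_limitSet
      (mem_limitSet_of_pow hξ Nat.one_pos (by simpa using hz))⟩
  have hanti : ∀ k, D (k + 1) ⊆ D k :=
    fun k ξ hξ ht => hξ (ht.back (r.2 (k + 1)).1.symm (r.2 k).1.symm (r.2 k).2)
  obtain ⟨ξ, hξ⟩ := IsCompact.nonempty_iInter_of_sequence_nonempty_isCompact_isClosed D hanti hne
    (hD 0).isCompact hD
  rw [Set.mem_iInter] at hξ
  refine ⟨ξ, fun k => ?_⟩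
  have hgood : ∀ j, ξ ∉ limitSet b (stabilizer F (r.1 (j + 1))) →
      Γ.Toward b ξ (r.1 (j + 1)) (r.1 (j + 2)) := by
    intro j hj
    obtain ⟨w, hw, hjw⟩ := exists_toward (Γ := Γ) hj
    by_cases h1 : w = r.1 (j + 2)
    · exact h1 ▸ hjw
    · exact absurd (hjw.back (r.2 (j + 1)).1.symm hw h1) (hξ (j + 1))
  have htype : ∀ j, ∃ i, (i = j ∨ i = j + 1) ∧ r.1 (i + 1) ∈ Γ.type1 := by
    intro j
    by_cases h : r.1 (j + 1) ∈ Γ.type1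
    · exact ⟨j, Or.inl rfl, h⟩
    · exact ⟨j + 1, Or.inr rfl, type1_of_adj h (r.2 (j + 1)).1⟩
  -- The common point could still lie in limit sets along the ray, but for at most one Type 1
  -- vertex. The windows starting at `k` and `k + 2` supply two distinct Type 1 vertices, so at one
  -- of them there is a direction, necessarily forward.
  obtain ⟨i, hi, hit⟩ := htype k
  obtain ⟨i', hi', hit'⟩ := htype (k + 2)
  obtain ⟨j, hkj, hj⟩ : ∃ j, k ≤ j ∧ ξ ∉ limitSet b (stabilizer F (r.1 (j + 1))) := by
    by_cases h1 : ξ ∈ limitSet b (stabilizer F (r.1 (i + 1)))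
    · refine ⟨i', by omega, fun h2 => ?_⟩
      have := r.injective Γ.isTree (type1_eq_of_mem_limitSet hit hit' h1 h2)
      omega
    · exact ⟨i, by omega, h1⟩
  exact fun u => (hgood j hj u).mono fun g hg =>
    r.branch_anti Γ.isTree (by omega : k ≤ j + 1) hg

end Shadows

/-! ### Limit sets of Type 2 groups and closed stars -/

section Pieces

variable {F V ι : Type*} [Group F] [MulAction F V] {M : Set F} {Γ : RelCyclicSplitting M V}
  {b : FreeGroupBasis ι F}

/-- A Type 1 vertex fixed by a nontrivial element of a Type 2 vertex group is adjacent to the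
Type 2 vertex. -/
lemma adj_of_fixed (b : FreeGroupBasis ι F) {v t : V} (hv : v ∉ Γ.type1) (ht : t ∈ Γ.type1)
    {x : F} (hx : x ≠ 1) (hxv : x • v = v) (hxt : x • t = t) : Γ.tree.Adj v t := by
  -- The neighbour `s` of `v` towards `t` is also fixed by `x`; distinct Type 1 stabilizers meet
  -- trivially, so `s = t`.
  obtain ⟨s, hs, hts⟩ := exists_mem_branch Γ.isTree (u := v) (z := t) (by rintro rfl; exact hv ht)
  have hxs := smul_eq_of_fixed Γ.isTree Γ.adj_smul hs hts hxv hxt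
  rwa [← type1_eq_of_mem b (type1_of_adj hv hs) ht hx hxs hxt]

variable [Finite ι]

lemma adj_of_mem_limitSet [Nontrivial F] {v t : V} (hv : v ∉ Γ.type1) (ht : t ∈ Γ.type1)
    {ξ : FreeBoundary ι} (h : ξ ∈ limitSet b (stabilizer F v))
    (h' : ξ ∈ limitSet b (stabilizer F t)) : Γ.tree.Adj v t := by
  obtain ⟨x, η, hx, hax⟩ := exists_isAxis_of_mem_limitSet (Γ.stab_type1 t ht) h'
  obtain ⟨p, hp, hpv⟩ := exists_pow_mem_of_mem_limitSet (Γ.fg_stabilizer b v) hax.1 h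
  refine adj_of_fixed b hv ht (hax.pow hp).ne_one hpv ?_
  exact Subgroup.pow_mem (stabilizer F t) (hx ▸ Subgroup.mem_zpowers x) p

/-- The boundary points over the closed star of a Type 2 vertex form the limit set of its
stabilizer. -/
lemma Lands.mem_limitSet_iff [Nontrivial F] (hconn : ConnectedSpace (DecompSpace b M)) {v : V}
    (hv : v ∉ Γ.type1) {ξ : FreeBoundary ι} {p : V ⊕ TreeEnd Γ.tree} (h : Γ.Lands b ξ p) :
    ξ ∈ limitSet b (stabilizer F v) ↔ ∃ u ∈ closedStar Γ.tree v, p = Sum.inl u := by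
  constructor
  · intro hξ
    by_cases h1 : ∃ t ∈ Γ.type1, ξ ∈ limitSet b (stabilizer F t)
    · obtain ⟨t, ht, hξt⟩ := h1
      have hl : Γ.Lands b ξ (Sum.inl t) := ⟨hξt, fun h => absurd ht h⟩
      exact ⟨t, Or.inr (adj_of_mem_limitSet hv ht hξ hξt), h.unique hl⟩
    · have hl : Γ.Lands b ξ (Sum.inl v) := ⟨hξ, fun _ t ht ht' => h1 ⟨t, ht, ht'⟩⟩
      exact ⟨v, Or.inl rfl, h.unique hl⟩
  · rintro ⟨u, rfl | hu, rfl⟩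
    · exact h.1
    · have hu' : Γ.tree.Adj v u := hu
      have ht := type1_of_adj hv hu'
      obtain ⟨x, η, hx, hax⟩ := exists_isAxis_of_mem_limitSet (Γ.stab_type1 u ht) h.1
      -- Nontriviality of the edge group gives a nonzero power of the Type 1 generator in the group
      -- of `v`, so the latter has the endpoints of that axis in its limit set.
      obtain ⟨e, he, heu, hev⟩ := exists_edge_stabilizer_ne_one hconn ht hu'.symm
      have hmem : e ∈ Subgroup.zpowers x := hx ▸ heu
      obtain ⟨k, rfl⟩ := hmem
      have hk : k ≠ 0 := by rintro rfl; exact he (zpow_zero x)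
      rcases Int.eq_nat_or_neg k with ⟨m, rfl | rfl⟩
      · exact mem_limitSet_of_pow hax.1 (p := m) (by omega) (by simpa using hev)
      · refine mem_limitSet_of_pow hax.1 (p := m) (by omega) ?_
        have := Subgroup.inv_mem (stabilizer F v) (mem_stabilizer_iff.2 hev)
        simpa using this

/-- Every Type 2 vertex is a landing point. -/
lemma exists_lands_type2 [Nontrivial F] {v : V} (hv : v ∉ Γ.type1) {κ : Type*}
    (c : FreeGroupBasis κ (stabilizer F v)) [Finite κ] : ∃ ξ, Γ.Lands b ξ (Sum.inl v) := by
  have : Nontrivial κ := nontrivial_basis_of_not_isCyclic c (Γ.stab_type2 v hv)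
  have : Countable F := (basisWord_injective b).countable
  obtain ⟨φ, -, hinj, -, hr⟩ := exists_subgroup_boundaryMap b c
  -- Only countably many boundary points are limits of powers, while the limit set of `v` is
  -- uncountable; a point that is no such limit avoids all Type 1 limit sets.
  have hcount : {ξ : FreeBoundary ι | ∃ g : F,
      Tendsto (fun m : ℕ => g ^ m) atTop (coneFilter b ξ)}.Countable := by
    have : {ξ : FreeBoundary ι | ∃ g : F,
        Tendsto (fun m : ℕ => g ^ m) atTop (coneFilter b ξ)} =
        ⋃ g : F, {ξ | Tendsto (fun m : ℕ => g ^ m) atTop (coneFilter b ξ)} := by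
      ext ξ; simp
    rw [this]
    exact Set.countable_iUnion fun g =>
      Set.Subsingleton.countable fun ξ h η h' => boundary_limit_unique h h'
  obtain ⟨ζ, hζ⟩ : ∃ ζ, φ ζ ∉ {ξ : FreeBoundary ι | ∃ g : F,
      Tendsto (fun m : ℕ => g ^ m) atTop (coneFilter b ξ)} := by
    by_contra! hcon
    have h1 := hcount.preimage hinj
    have h2 : Countable (FreeBoundary κ) :=
      Set.countable_univ_iff.1 (h1.mono fun ζ _ => hcon ζ)
    exact not_countable_iff.2 FreeBoundary.uncountable h2
  refine ⟨φ ζ, hr ▸ ⟨ζ, rfl⟩, fun _ t ht hξ => hζ ?_⟩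
  obtain ⟨x, η, -, hax⟩ := exists_isAxis_of_mem_limitSet (Γ.stab_type1 t ht) hξ
  exact ⟨x, hax.1⟩

end Pieces

end RelCyclicSplitting

namespace RelCyclicSplitting

/-! ### The line pattern of the augmented multiword -/

section LinePattern

variable {F V ι : Type*} [Group F] [MulAction F V] {M : Set F} {Γ : RelCyclicSplitting M V}
  {b : FreeGroupBasis ι F}

lemma exists_edge_generator {v t : V} (ht : t ∈ Γ.type1) :
    ∃ e : F, Subgroup.zpowers e = stabilizer F v ⊓ stabilizer F t := by
  have h1 : IsCyclic (stabilizer F t) := (Γ.stab_type1 t ht).prop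
  have h2 : IsCyclic (stabilizer F v ⊓ stabilizer F t : Subgroup F) :=
    Subgroup.isCyclic_of_le inf_le_right
  exact (Subgroup.isCyclic_iff_exists_zpowers_eq_top _).1 h2

/-- Every word of the augmented multiword is a word of `M` or fixes a Type 1 vertex. -/
lemma mem_aug_cases {w : F} (hw : w ∈ Γ.aug) : w ∈ M ∨ ∃ t ∈ Γ.type1, w • t = t := by
  rcases hw with hw | ⟨u, v, huv, h⟩
  · exact Or.inl hw
  · have hmem : w ∈ stabilizer F u ⊓ stabilizer F v := h ▸ Subgroup.mem_zpowers w
    by_cases hu : u ∈ Γ.type1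
    · exact Or.inr ⟨u, hu, hmem.1⟩
    · exact Or.inr ⟨v, type1_of_adj hu huv, hmem.2⟩

/-- The elements of the line pattern of the augmented multiword are elliptic. -/
lemma exists_fixed_of_mem_linePattern {x : F} (hx : x ∈ linePattern Γ.aug) :
    ∃ z : V, x • z = z := by
  have key : ∀ {w x : F}, w ∈ Γ.aug → IsConj w x → ∃ z : V, x • z = z := by
    intro w x hw hc
    obtain ⟨g, rfl⟩ := isConj_iff.1 hc
    obtain ⟨z, hz⟩ : ∃ z : V, w • z = z := by
      rcases mem_aug_cases hw with h | ⟨t, -, h⟩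
      · exact Γ.elliptic w h
      · exact ⟨t, h⟩
    exact ⟨g • z, by simp [mul_smul, hz]⟩
  obtain ⟨w, hw, h | h⟩ := hx
  · exact key hw h
  · obtain ⟨z, hz⟩ := key hw h
    exact ⟨z, (inv_smul_eq_iff.1 hz).symm⟩

/-- An edge generator is a power of `h`, with nonzero exponent because connectedness makes the edge
group nontrivial. -/
lemma zpow_mem_linePattern_aug [Nontrivial F] [Finite ι]
    (hconn : ConnectedSpace (DecompSpace b M)) {v t : V} (ht : t ∈ Γ.type1)
    (hvt : Γ.tree.Adj v t) {h : F}
    (hh : stabilizer F v ⊓ stabilizer F t ≤ Subgroup.zpowers h) :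
    ∃ k : ℤ, k ≠ 0 ∧ h ^ k ∈ Γ.aug := by
  obtain ⟨e, he⟩ := exists_edge_generator (v := v) ht
  obtain ⟨k, hk⟩ := hh (he ▸ Subgroup.mem_zpowers e)
  refine ⟨k, ?_, Or.inr ⟨v, t, hvt, ?_⟩⟩
  · rintro rfl
    obtain ⟨y, hy, hyt, hyv⟩ := exists_edge_stabilizer_ne_one hconn ht hvt.symm
    have h1 : y ∈ stabilizer F v ⊓ stabilizer F t := ⟨hyv, hyt⟩
    rw [← he, ← hk] at h1
    simp at h1
    exact hy h1
  · exact (congrArg _ hk).trans he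

/-- The points over a Type 1 vertex are identified. -/
lemma decompMap_eq_of_type1 [Nontrivial F] [Finite ι] (hconn : ConnectedSpace (DecompSpace b M))
    {t : V} (ht : t ∈ Γ.type1) {ξ η : FreeBoundary ι} (hξ : ξ ∈ limitSet b (stabilizer F t))
    (hη : η ∈ limitSet b (stabilizer F t)) : decompMap b Γ.aug ξ = decompMap b Γ.aug η := by
  obtain ⟨h, η', hh, hax⟩ := exists_isAxis_of_mem_limitSet (Γ.stab_type1 t ht) hξ
  rw [← hh] at hη
  rcases tendsto_pow_of_mem_limitSet_zpowers hη with h1 | h1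
  · rw [boundary_limit_unique hax.1 h1]
  · obtain ⟨v, hv⟩ := (Γ.nontrivial_type1 t ht).nonempty
    have hv' : Γ.tree.Adj t v := hv
    obtain ⟨k, hk, hmem⟩ := zpow_mem_linePattern_aug hconn ht hv'.symm (h := h)
      (by rw [hh]; exact inf_le_right)
    rw [← boundary_limit_unique hax.2 h1]
    exact decompMap_eq_of_zpow_mem hax hk (subset_linePattern _ hmem)

/-- The landing point is invariant under the identifications of the augmented multiword. -/
lemma Lands.congr_decompMap [Nontrivial F] [Finite ι] {ξ η : FreeBoundary ι}
    {p : V ⊕ TreeEnd Γ.tree} (h : decompMap b Γ.aug ξ = decompMap b Γ.aug η)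
    (hp : Γ.Lands b ξ p) : Γ.Lands b η p := by
  rcases decompMap_eq_iff.1 h with rfl | ⟨x, hx, hax⟩
  · exact hp
  obtain ⟨z, hz⟩ := exists_fixed_of_mem_linePattern hx
  -- If one endpoint of an axis is in a Type 1 limit set, its element lies in that stabilizer, and
  -- so the other endpoint is there too.
  have key : ∀ {ξ η : FreeBoundary ι} {x : F}, IsAxis b x ξ η → ∀ t ∈ Γ.type1,
      ξ ∈ limitSet b (stabilizer F t) → η ∈ limitSet b (stabilizer F t) := by
    intro ξ η x hax t ht hξ
    have hxt := mem_of_tendsto_pow_of_isMaxCyclic (Γ.stab_type1 t ht) hax.1 hξ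
    exact mem_limitSet_of_pow hax.2 Nat.one_pos (by simpa using hxt)
  by_cases h1 : ∃ t ∈ Γ.type1, ξ ∈ limitSet b (stabilizer F t)
  · obtain ⟨t, ht, hξ⟩ := h1
    have hl : Γ.Lands b ξ (Sum.inl t) := ⟨hξ, fun h => absurd ht h⟩
    rw [hp.unique hl]
    exact ⟨key hax t ht hξ, fun h => absurd ht h⟩
  · have hzx : x ∈ stabilizer F z := hz
    have hl : Γ.Lands b ξ (Sum.inl z) :=
      ⟨mem_limitSet_of_pow hax.1 Nat.one_pos (by simpa using hzx),
        fun _ t ht ht' => h1 ⟨t, ht, ht'⟩⟩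
    rw [hp.unique hl]
    exact ⟨mem_limitSet_of_pow hax.2 Nat.one_pos (by simpa using hz),
      fun _ t ht ht' => h1 ⟨t, ht, key hax.symm t ht ht'⟩⟩

/-- The augmented multiword consists of finitely many conjugacy classes. -/
lemma exists_finite_aug (Γ : RelCyclicSplitting M V) (b : FreeGroupBasis ι F) (hM : M.Finite) :
    ∃ W₀ : Set F, W₀.Finite ∧ ∀ w ∈ Γ.aug, ∃ w₀ ∈ W₀, IsConj w₀ w := by
  obtain ⟨s, hs, hrep⟩ := Γ.finite_edges
  refine ⟨M ∪ ⋃ e ∈ s, {h : F | Subgroup.zpowers h = stabilizer F e.1 ⊓ stabilizer F e.2},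
    hM.union (hs.biUnion fun e _ => ?_), ?_⟩
  -- An infinite cyclic edge group has just two generators, and a trivial one has only `1`.
  · by_cases hex : ∃ h : F, h ≠ 1 ∧ Subgroup.zpowers h = stabilizer F e.1 ⊓ stabilizer F e.2
    · obtain ⟨h, hne, hh⟩ := hex
      refine (Set.toFinite {h, h⁻¹}).subset fun y hy => ?_
      rcases (Subgroup.zpowers_eq_zpowers_iff (not_isOfFinOrder_of_ne_one b hne)).1
        (hh.trans (Eq.symm hy)) with h1 | h1
      · exact Or.inl h1.symm
      · exact Or.inr h1.symm
    · refine (Set.finite_singleton (1 : F)).subset fun y hy => ?_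
      by_contra hne
      exact hex ⟨y, hne, hy⟩
  · rintro w (hw | ⟨u, v, huv, hw⟩)
    · exact ⟨w, Or.inl hw, IsConj.refl w⟩
    · obtain ⟨g, hg⟩ := hrep u v huv
      refine ⟨g * w * g⁻¹, Or.inr (Set.mem_biUnion hg ?_), isConj_iff.2 ⟨g⁻¹, by group⟩⟩
      have h1 : ∀ z : V, stabilizer F (g • z) = (stabilizer F z).map (MulAut.conj g).toMonoidHom :=
        fun z => stabilizer_smul_eq_stabilizer_map_conj g z
      rw [Set.mem_ofPred, h1, h1, ← Subgroup.map_inf _ _ _ (MulAut.conj g).injective, ← hw,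
        MonoidHom.map_zpowers]
      rfl

end LinePattern

/-! ### The pieces -/

section PieceMaps

variable {F V ι : Type*} [Group F] [Nontrivial F] [MulAction F V] {M : Set F}
  {Γ : RelCyclicSplitting M V} [Finite ι] {b : FreeGroupBasis ι F}
  {v : V} {κ : Type*} [Finite κ] {c : FreeGroupBasis κ (stabilizer F v)}
  {φ : FreeBoundary κ → FreeBoundary ι}

omit [Nontrivial F] [Finite κ] [Finite ι] in
lemma isAxis_coe (ht : ∀ ξ, Tendsto (fun h : stabilizer F v => (h : F)) (coneFilter c ξ)
      (coneFilter b (φ ξ))) {x : stabilizer F v} {ξ η : FreeBoundary κ} (h : IsAxis c x ξ η) :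
    IsAxis b (x : F) (φ ξ) (φ η) :=
  ⟨((ht ξ).comp h.1).congr fun m => by simp, ((ht η).comp h.2).congr fun m => by simp⟩

omit [Nontrivial F] [Finite ι] in
lemma isAxis_of_coe (hinj : Function.Injective φ)
    (ht : ∀ ξ, Tendsto (fun h : stabilizer F v => (h : F)) (coneFilter c ξ)
      (coneFilter b (φ ξ))) {x : stabilizer F v} {ξ η : FreeBoundary κ}
    (h : IsAxis b (x : F) (φ ξ) (φ η)) : IsAxis c x ξ η := by
  obtain ⟨ξ', η', h'⟩ := exists_isAxis c (x := x) (fun e => h.ne_one (by rw [e]; rfl))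
  obtain ⟨h1, h2⟩ := (isAxis_coe ht h').unique h
  rwa [← hinj h1, ← hinj h2]

omit [Finite κ] in
/-- The lines of the induced multiword are lines of the augmented multiword. -/
lemma decompMap_eq_of_ind (hconn : ConnectedSpace (DecompSpace b M)) (hv : v ∉ Γ.type1)
    (ht : ∀ ξ, Tendsto (fun h : stabilizer F v => (h : F)) (coneFilter c ξ)
      (coneFilter b (φ ξ))) {ξ η : FreeBoundary κ} (h : LineEndpoints c (Γ.ind v) ξ η) :
    decompMap b Γ.aug (φ ξ) = decompMap b Γ.aug (φ η) := by
  obtain ⟨h, hh, x, hx, hax⟩ := lineEndpoints_iff.1 h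
  have hax' := isAxis_coe ht hax
  obtain ⟨g, rfl⟩ := isConj_iff.1 hx
  rcases hh with ⟨w, hw, hc⟩ | ⟨-, t, hvt, hle⟩
  · refine decompMap_eq_of_isAxis ⟨w, Or.inl hw, Or.inl (hc.trans ?_)⟩ hax'
    exact isConj_iff.2 ⟨g, by simp⟩
  · have ht1 := type1_of_adj hv hvt
    have hle' : stabilizer F v ⊓ stabilizer F t ≤ Subgroup.zpowers (h : F) := by
      rintro y ⟨hyv, hyt⟩
      obtain ⟨k, hk⟩ := hle (show (⟨y, hyv⟩ : stabilizer F v) ∈ _ from hyt)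
      exact ⟨k, by simpa using congrArg Subtype.val hk⟩
    obtain ⟨k, hk, hmem⟩ := zpow_mem_linePattern_aug hconn ht1 hvt hle'
    refine decompMap_eq_of_zpow_mem hax' hk ⟨_, hmem, Or.inl (isConj_iff.2 ⟨g, ?_⟩)⟩
    simp [conj_zpow]

omit [Nontrivial F] [Finite ι] in
/-- The generator of an edge group, as a word of the induced multiword. -/
lemma exists_ind_generator (b : FreeGroupBasis ι F) {t : V} (ht : t ∈ Γ.type1)
    (hvt : Γ.tree.Adj v t) {x : F} (hx : x ≠ 1) (hxv : x • v = v) (hxt : x • t = t) :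
    ∃ y ∈ Γ.ind v, (⟨x, hxv⟩ : stabilizer F v) ∈ Subgroup.zpowers y := by
  have h1 : IsCyclic (stabilizer F t) := (Γ.stab_type1 t ht).prop
  have h2 : IsCyclic ((stabilizer F t).subgroupOf (stabilizer F v)) :=
    isCyclic_of_injective (((stabilizer F v).subtype.comp
      ((stabilizer F t).subgroupOf (stabilizer F v)).subtype).codRestrict (stabilizer F t)
        fun z => z.2) fun y z h => Subtype.ext (Subtype.ext (by
          have h' := congrArg Subtype.val h
          exact h'))
  obtain ⟨y, hy⟩ := (Subgroup.isCyclic_iff_exists_zpowers_eq_top _).1 h2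
  have hxy : (⟨x, hxv⟩ : stabilizer F v) ∈ Subgroup.zpowers y := by
    rw [hy]; exact hxt
  -- The edge group is itself maximal cyclic in the vertex group: a larger cyclic subgroup is
  -- generated by a root of an element of the Type 1 stabilizer, which is closed under roots.
  refine ⟨y, Or.inr ⟨⟨inferInstance, fun K hK hle => ?_⟩, t, hvt, hy.ge⟩, hxy⟩
  obtain ⟨k, rfl⟩ := (Subgroup.isCyclic_iff_exists_zpowers_eq_top K).1 hK
  rw [hy]
  refine Subgroup.zpowers_le.2 ?_
  obtain ⟨m, hm⟩ := hle hxy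
  have hm' : (k : F) ^ m = x := by simpa using congrArg Subtype.val hm
  change (k : F) ∈ stabilizer F t
  rcases Int.eq_nat_or_neg m with ⟨n, rfl | rfl⟩
  · rw [zpow_natCast] at hm'
    exact (Γ.stab_type1 t ht).mem_of_pow_mem (hm' ▸ hxt) (hm' ▸ hx) b
  · rw [zpow_neg, zpow_natCast, inv_eq_iff_eq_inv] at hm'
    exact (Γ.stab_type1 t ht).mem_of_pow_mem
      (hm' ▸ Subgroup.inv_mem (stabilizer F t) (mem_stabilizer_iff.2 hxt))
      (hm' ▸ inv_ne_one.2 hx) b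

omit [Nontrivial F] in
/-- The pieces are mapped injectively. -/
lemma decompMap_ind_eq (hv : v ∉ Γ.type1) (hinj : Function.Injective φ)
    (ht : ∀ ξ, Tendsto (fun h : stabilizer F v => (h : F)) (coneFilter c ξ)
      (coneFilter b (φ ξ))) (hr : Set.range φ = limitSet b (stabilizer F v))
    {ξ η : FreeBoundary κ} (h : decompMap b Γ.aug (φ ξ) = decompMap b Γ.aug (φ η)) :
    decompMap c (Γ.ind v) ξ = decompMap c (Γ.ind v) η := by
  rcases decompMap_eq_iff.1 h with h | ⟨x, hx, hax⟩
  · rw [hinj h]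
  have hξ : φ ξ ∈ limitSet b (stabilizer F v) := hr ▸ ⟨ξ, rfl⟩
  obtain ⟨p, hp, hpv⟩ := exists_pow_mem_of_mem_limitSet (Γ.fg_stabilizer b v) hax.1 hξ
  have hp1 := (hax.pow hp).ne_one
  -- If `x` fixes a Type 1 vertex, that vertex is adjacent to `v`, and a power of `x` is a power of
  -- the corresponding edge generator. So the axis of `x` is a line of the induced pattern.
  have htype1 : ∀ t ∈ Γ.type1, x • t = t → decompMap c (Γ.ind v) ξ = decompMap c (Γ.ind v) η := by
    intro t ht1 hxt
    have hxpt : x ^ p • t = t := Subgroup.pow_mem (stabilizer F t) (mem_stabilizer_iff.2 hxt) p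
    have hvt := adj_of_fixed b hv ht1 hp1 hpv hxpt
    obtain ⟨y, hy, k, hk⟩ := exists_ind_generator b ht1 hvt hp1 hpv hxpt
    have hk' : (y : F) ^ k = x ^ p := by simpa using congrArg Subtype.val hk
    have hne : k ≠ 0 := by
      rintro rfl
      exact hp1 (by rw [← hk', zpow_zero])
    rcases Int.eq_nat_or_neg k with ⟨m, rfl | rfl⟩
    · refine decompMap_eq_of_isAxis (subset_linePattern _ hy) (isAxis_of_coe hinj ht ?_)
      refine IsAxis.of_pow (p := m) (by omega) ?_
      rw [← zpow_natCast, hk']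
      exact hax.pow hp
    · refine decompMap_eq_of_isAxis (inv_mem_linePattern (subset_linePattern _ hy))
        (isAxis_of_coe hinj ht ?_)
      refine IsAxis.of_pow (p := m) (by omega) ?_
      rw [Subgroup.coe_inv, inv_pow, ← zpow_natCast, ← zpow_neg, hk']
      exact hax.pow hp
  have hmain : ∀ w ∈ Γ.aug, ∀ x' : F, (x' = x ∨ x' = x⁻¹) → IsConj w x' →
      decompMap c (Γ.ind v) ξ = decompMap c (Γ.ind v) η := by
    intro w hw x' hx' hc
    have hxx' : ∀ {z : V}, x' • z = z ↔ x • z = z := by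
      intro z
      rcases hx' with rfl | rfl
      · rfl
      · rw [inv_smul_eq_iff, eq_comm]
    obtain ⟨g, hg⟩ := isConj_iff.1 hc
    rcases mem_aug_cases hw with hwM | ⟨t, ht1, hwt⟩
    · obtain ⟨u, hu⟩ := Γ.elliptic w hwM
      have hxu : x • (g • u) = g • u := hxx'.1 (by rw [← hg]; simp [mul_smul, hu])
      by_cases hxv : x • v = v
      · have hax' := isAxis_of_coe hinj ht (x := ⟨x, hxv⟩) hax
        have hx'v : x' • v = v := hxx'.2 hxv
        have hind : (⟨x', hx'v⟩ : stabilizer F v) ∈ Γ.ind v := Or.inl ⟨w, hwM, hc⟩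
        refine decompMap_eq_of_isAxis ?_ hax'
        rcases hx' with rfl | rfl
        · exact subset_linePattern _ hind
        · have := inv_mem_linePattern (subset_linePattern _ hind)
          have e : (⟨x, hxv⟩ : stabilizer F v) = (⟨x⁻¹, hx'v⟩)⁻¹ := Subtype.ext (by simp)
          rw [e]
          exact this
      -- Here `x` fixes `g • u` but not `v`, while `x ^ p` fixes both, hence also the first edge
      -- from `v` towards `g • u`. Root closure then shows that `x` itself fixes the Type 1 end of
      -- this edge.
      · obtain ⟨t, hvt, hut⟩ := exists_mem_branch Γ.isTree (u := v) (z := g • u)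
          (fun e => hxv (e ▸ hxu))
        have hxpt := smul_eq_of_fixed Γ.isTree Γ.adj_smul hvt hut hpv
          (Subgroup.pow_mem (stabilizer F (g • u)) (mem_stabilizer_iff.2 hxu) p)
        have ht1 := type1_of_adj hv hvt
        exact htype1 t ht1 ((Γ.stab_type1 t ht1).mem_of_pow_mem hxpt hp1 b)
    · refine htype1 (g • t) (Γ.smul_type1 g ht1) (hxx'.1 ?_)
      rw [← hg]
      simp [mul_smul, hwt]
  obtain ⟨w, hw, hc | hc⟩ := hx
  · exact hmain w hw x (Or.inl rfl) hc
  · exact hmain w hw _ (Or.inr rfl) hc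

end PieceMaps

end RelCyclicSplitting

/-! ### The compactified tree of decomposition spaces -/

namespace RelCyclicSplitting

section QuasiMap

variable {F V ι : Type*} [Group F] [MulAction F V] {M : Set F}
  {Γ : RelCyclicSplitting M V} {b : FreeGroupBasis ι F}

/-- The quasi-map from the decomposition space to the compactified tree. -/
lemma exists_quasiMap [Nontrivial F] [Finite ι] (Γ : RelCyclicSplitting M V)
    (b : FreeGroupBasis ι F) : ∃ π : DecompSpace b Γ.aug → V ⊕ TreeEnd Γ.tree,
      ∀ ξ, Γ.Lands b ξ (π (decompMap b Γ.aug ξ)) := by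
  choose p hp using exists_lands (Γ := Γ) (b := b)
  exact ⟨Quot.lift p fun ξ η h => ((hp ξ).congr_decompMap (Quot.sound h)).unique (hp η), hp⟩

variable {π : DecompSpace b Γ.aug → V ⊕ TreeEnd Γ.tree}

lemma exists_limit_of_mem_stabilizer [Finite ι] (b : FreeGroupBasis ι F) {z : V} {g : F}
    (hg : g ∈ stabilizer F z) (hne : g ≠ 1) :
    ∃ ξ, Tendsto (fun m : ℕ => g ^ m) atTop (coneFilter b ξ) ∧ ξ ∈ limitSet b (stabilizer F z) := by
  obtain ⟨ξ, hξ⟩ := exists_tendsto_pow b hne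
  exact ⟨ξ, hξ, mem_limitSet_of_pow hξ Nat.one_pos (by simpa using hg)⟩

lemma lands_type1 {t : V} (ht : t ∈ Γ.type1) {ξ : FreeBoundary ι}
    (h : ξ ∈ limitSet b (stabilizer F t)) : Γ.Lands b ξ (Sum.inl t) :=
  ⟨h, fun h' => absurd ht h'⟩

variable [Nontrivial F] [Finite ι]

lemma exists_lands_type1 (b : FreeGroupBasis ι F) {t : V} (ht : t ∈ Γ.type1) :
    ∃ ξ, Γ.Lands b ξ (Sum.inl t) := by
  obtain ⟨g, hg, hne⟩ := Γ.exists_smul_eq_ne_one t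
  obtain ⟨ξ, -, hξ⟩ := exists_limit_of_mem_stabilizer b (mem_stabilizer_iff.2 hg) hne
  exact ⟨ξ, lands_type1 ht hξ⟩

lemma surjective_quasiMap {κ : Γ.Type2 → Type*} [∀ v, Finite (κ v)]
    (c : ∀ v : Γ.Type2, FreeGroupBasis (κ v) (stabilizer F v.1))
    (hπ : ∀ ξ, Γ.Lands b ξ (π (decompMap b Γ.aug ξ))) : Function.Surjective π := by
  suffices h : ∀ p, ∃ ξ, Γ.Lands b ξ p from fun p =>
    let ⟨ξ, hξ⟩ := h p
    ⟨decompMap b Γ.aug ξ, (hπ ξ).unique hξ⟩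
  rintro (z | e)
  · by_cases hz : z ∈ Γ.type1
    · exact exists_lands_type1 b hz
    · exact exists_lands_type2 hz (c ⟨z, hz⟩)
  · obtain ⟨r, rfl⟩ := e.exists_ray
    obtain ⟨ξ, hξ⟩ := exists_landsRay b r
    exact ⟨ξ, r, rfl, hξ⟩

lemma eq_of_quasiMap_eq_type1 (hconn : ConnectedSpace (DecompSpace b M))
    (hπ : ∀ ξ, Γ.Lands b ξ (π (decompMap b Γ.aug ξ))) {t : V} (ht : t ∈ Γ.type1)
    {x y : DecompSpace b Γ.aug} (hx : π x = Sum.inl t) (hy : π y = Sum.inl t) : x = y := by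
  obtain ⟨ξ, rfl⟩ := surjective_decompMap b _ x
  obtain ⟨η, rfl⟩ := surjective_decompMap b _ y
  have h1 := hπ ξ
  have h2 := hπ η
  rw [hx] at h1
  rw [hy] at h2
  exact decompMap_eq_of_type1 hconn ht h1.1 h2.1

omit [Nontrivial F] in
lemma eq_of_quasiMap_eq_end (hπ : ∀ ξ, Γ.Lands b ξ (π (decompMap b Γ.aug ξ)))
    {e : TreeEnd Γ.tree} {x y : DecompSpace b Γ.aug} (hx : π x = Sum.inr e)
    (hy : π y = Sum.inr e) : x = y := by
  obtain ⟨r, rfl⟩ := e.exists_ray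
  obtain ⟨ξ, rfl⟩ := surjective_decompMap b _ x
  obtain ⟨η, rfl⟩ := surjective_decompMap b _ y
  have h1 := hπ ξ
  have h2 := hπ η
  rw [hx] at h1
  rw [hy] at h2
  rw [h1.landsRay.boundary_unique h2.landsRay]

lemma isOpen_preimage_treeBranch (hπ : ∀ ξ, Γ.Lands b ξ (π (decompMap b Γ.aug ξ))) {t w : V}
    (ht : t ∈ Γ.type1) (hw : Γ.tree.Adj t w) : IsOpen (π ⁻¹' treeBranch Γ.tree t w) := by
  rw [← (isQuotientMap_decompMap b Γ.aug).isOpen_preimage]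
  convert isOpen_toward hw (isClosed_limitSet b (Γ.fg_stabilizer b t)) using 1
  ext ξ
  exact ⟨fun h => (hπ ξ).toward_of_type1 ht hw h, fun h => (hπ ξ).mem_treeBranch hw h⟩

lemma isCutPoint_of_type1 (hconn : ConnectedSpace (DecompSpace b M))
    (hπ : ∀ ξ, Γ.Lands b ξ (π (decompMap b Γ.aug ξ))) (hsurj : Function.Surjective π) {t : V}
    (ht : t ∈ Γ.type1) {x : DecompSpace b Γ.aug} (hx : π x = Sum.inl t) : IsCutPoint x := by
  intro hpre
  obtain ⟨v, hv, w, hw, hvw⟩ := Γ.nontrivial_type1 t ht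
  have hne : ∀ u, Γ.tree.Adj t u → ∃ y, y ≠ x ∧ π y ∈ treeBranch Γ.tree t u := by
    intro u hu
    obtain ⟨y, hy⟩ := hsurj (Sum.inl u)
    refine ⟨y, ?_, hy ▸ inl_mem_treeBranch.2 (mem_branch_of_adj hu)⟩
    rintro rfl
    exact hu.ne (Sum.inl_injective (hx.symm.trans hy))
  obtain ⟨y, hyx, hy⟩ := hne v hv
  obtain ⟨z, hzx, hz⟩ := hne w hw
  -- Since only `x` lies over `t`, its complement is the disjoint union of the open sets over the
  -- branches at `t`: one branch is separated from all the others.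
  obtain ⟨p, -, hp, hp'⟩ := hpre (π ⁻¹' treeBranch Γ.tree t v)
    (⋃ u ∈ {u | Γ.tree.Adj t u ∧ u ≠ v}, π ⁻¹' treeBranch Γ.tree t u)
    (isOpen_preimage_treeBranch hπ ht hv)
    (isOpen_biUnion fun u hu => isOpen_preimage_treeBranch hπ ht hu.1)
    (fun p hp => by
      obtain ⟨u, hu, hpu⟩ := exists_mem_treeBranch Γ.isTree (u := t) (p := π p)
        fun h => hp (eq_of_quasiMap_eq_type1 hconn hπ ht h hx)
      by_cases huv : u = v
      · exact Or.inl (huv ▸ hpu)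
      · exact Or.inr (Set.mem_biUnion (show u ∈ {u | _ ∧ _} from ⟨hu, huv⟩) hpu))
    ⟨y, hyx, hy⟩
    ⟨z, hzx, Set.mem_biUnion (show w ∈ {u | _ ∧ _} from ⟨hw, hvw.symm⟩) hz⟩
  obtain ⟨u, hu, hpu⟩ := Set.mem_iUnion₂.1 hp'
  exact hu.2 (treeBranch_unique Γ.isTree hu.1 hv hpu hp)

omit [Nontrivial F] in
/-- Near a point of the limit set of `v`, whatever hangs off at a neighbour of `v` and comes
close to the point hangs off at a boundary point close to the point. -/
lemma exists_isOpen_shadow (b : FreeGroupBasis ι F) {v : V} {τ : V → FreeBoundary ι}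
    (hτ : ∀ t, Γ.tree.Adj v t → τ t ∈ limitSet b (stabilizer F t)) {ξ : FreeBoundary ι}
    (hξ : ξ ∈ limitSet b (stabilizer F v)) (n : ℕ) :
    ∃ W, IsOpen W ∧ ξ ∈ W ∧ (∀ η ∈ W, ∀ k < n, η.1 k = ξ.1 k) ∧
      ∀ η ∈ W, ∀ t, Γ.tree.Adj v t → ¬ Γ.Toward b η t v →
        ξ ∈ limitSet b (stabilizer F t) ∨ ∀ k < n, (τ t).1 k = ξ.1 k := by
  obtain ⟨E, hE, hsh⟩ := Γ.exists_finite_shadow b v n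
  -- Only finitely many neighbours can have a large shadow. At those whose limit set misses `ξ`, the
  -- direction of `ξ` is towards `v`, an open condition that excludes their shadows from `W`.
  let E' : Set V := {t ∈ E | Γ.tree.Adj v t ∧ ξ ∉ limitSet b (stabilizer F t)}
  refine ⟨{η | ∀ k < n, η.1 k = ξ.1 k} ∩ ⋂ t ∈ E', {η | Γ.Toward b η t v},
    (FreeBoundary.isOpen_cylinder ξ n).inter ((hE.subset fun t ht => ht.1).isOpen_biInter
      fun t ht => isOpen_toward ht.2.1.symm (isClosed_limitSet b (Γ.fg_stabilizer b t))),
    ⟨fun _ _ => rfl, Set.mem_iInter₂.2 fun t ht => ?_⟩, fun η hη => hη.1, fun η hη t hvt ht => ?_⟩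
  · obtain ⟨w, hw, hξw⟩ := exists_toward ht.2.2
    have := branch_unique Γ.isTree hw ht.2.1.symm (hξw.mem_branch hξ)
      (mem_branch_of_adj ht.2.1.symm)
    exact this ▸ hξw
  · by_cases hξt : ξ ∈ limitSet b (stabilizer F t)
    · exact Or.inl hξt
    · have htE : t ∉ E := fun h => ht (Set.mem_iInter₂.1 hη.2 t ⟨h, hvt, hξt⟩)
      refine Or.inr fun k hk => ?_
      rw [← hη.1 k hk]
      exact hsh t htE v hvt.symm (mem_branch_of_adj hvt.symm) _ _
        (fun h => h.not_mem_limitSet (hτ t hvt)) ht k hk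

/-- The retraction to the piece of a Type 2 vertex. -/
lemma exists_retraction (hconn : ConnectedSpace (DecompSpace b M))
    (hπ : ∀ ξ, Γ.Lands b ξ (π (decompMap b Γ.aug ξ))) {v : V} (hv : v ∉ Γ.type1) :
    ∃ ρ : DecompSpace b Γ.aug → DecompSpace b Γ.aug, Continuous ρ ∧
      (∀ x, π x = Sum.inl v → ρ x = x) ∧
      ∀ t, Γ.tree.Adj v t → ∀ x, π x ∈ treeBranch Γ.tree v t → π (ρ x) = Sum.inl t := by
  classical
  have hex : ∀ t, ∃ ξ, Γ.tree.Adj v t → Γ.Lands b ξ (Sum.inl t) := by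
    intro t
    by_cases hvt : Γ.tree.Adj v t
    · obtain ⟨ξ, hξ⟩ := exists_lands_type1 b (type1_of_adj hv hvt)
      exact ⟨ξ, fun _ => hξ⟩
    · obtain ⟨x, hx⟩ := exists_ne (1 : F)
      exact ⟨(exists_tendsto_pow b hx).choose, fun h => absurd h hvt⟩
  choose τ hτ using hex
  let ρ : DecompSpace b Γ.aug → DecompSpace b Γ.aug := fun x =>
    if h : ∃ t, Γ.tree.Adj v t ∧ π x ∈ treeBranch Γ.tree v t then decompMap b Γ.aug (τ h.choose)
    else x
  have hρ : ∀ {x t}, Γ.tree.Adj v t → π x ∈ treeBranch Γ.tree v t →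
      ρ x = decompMap b Γ.aug (τ t) := by
    intro x t hvt hx
    have h : ∃ t, Γ.tree.Adj v t ∧ π x ∈ treeBranch Γ.tree v t := ⟨t, hvt, hx⟩
    have e := treeBranch_unique Γ.isTree h.choose_spec.1 hvt h.choose_spec.2 hx
    simp only [ρ, dif_pos h, e]
  have hρ' : ∀ {x}, (¬ ∃ t, Γ.tree.Adj v t ∧ π x ∈ treeBranch Γ.tree v t) → ρ x = x :=
    fun h => dif_neg h
  refine ⟨ρ, ?_, fun x hx => hρ' ?_, fun t hvt x hx => ?_⟩
  · rw [(isQuotientMap_decompMap b Γ.aug).continuous_iff, continuous_iff_continuousAt]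
    intro ξ
    -- On the limit set of `v` continuity comes from the shadow lemma: nearby points are fixed or
    -- collapsed to attaching points near `ξ` or identified with it. Off the limit set `ρ` is
    -- locally constant.
    by_cases hξ : ξ ∈ limitSet b (stabilizer F v)
    · have hfix : ∀ t, Γ.tree.Adj v t → ξ ∈ limitSet b (stabilizer F t) →
          decompMap b Γ.aug (τ t) = decompMap b Γ.aug ξ := fun t hvt h =>
        decompMap_eq_of_type1 hconn (type1_of_adj hv hvt) (hτ t hvt).1 h
      have hρξ : ρ (decompMap b Γ.aug ξ) = decompMap b Γ.aug ξ := by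
        by_cases h : ∃ t, Γ.tree.Adj v t ∧ π (decompMap b Γ.aug ξ) ∈ treeBranch Γ.tree v t
        · obtain ⟨t, hvt, ht⟩ := h
          rw [hρ hvt ht]
          refine hfix t hvt ?_
          obtain ⟨u, hu, hpu⟩ := ((hπ ξ).mem_limitSet_iff hconn hv).1 hξ
          rw [hpu] at ht
          rcases hu with rfl | hu
          · exact absurd ht (inl_not_mem_treeBranch_self _ _)
          · have hut := branch_unique Γ.isTree hvt hu (inl_mem_treeBranch.1 ht)
              (mem_branch_of_adj hu)
            have h1 := hπ ξ
            rw [hpu] at h1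
            exact hut ▸ h1.1
        · exact hρ' h
      rw [ContinuousAt, Function.comp_apply, hρξ, tendsto_nhds]
      intro O hO hξO
      obtain ⟨n, -, hn⟩ := (FreeBoundary.nhds_hasBasis ξ).mem_iff.1
        ((hO.preimage (isQuotientMap_decompMap b Γ.aug).continuous).mem_nhds hξO)
      obtain ⟨W, hW, hξW, hWn, hWt⟩ := exists_isOpen_shadow b (fun t h => (hτ t h).1) hξ n
      filter_upwards [hW.mem_nhds hξW] with η hη
      change ρ (decompMap b Γ.aug η) ∈ O
      by_cases h : ∃ t, Γ.tree.Adj v t ∧ π (decompMap b Γ.aug η) ∈ treeBranch Γ.tree v t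
      · obtain ⟨t, hvt, ht⟩ := h
        rw [hρ hvt ht]
        rcases hWt η hη t hvt fun h' => treeBranch_disjoint Γ.isTree hvt ht
          ((hπ η).mem_treeBranch hvt.symm h') with h' | h'
        · rw [hfix t hvt h']
          exact hξO
        · exact hn h'
      · rw [hρ' h]
        exact hn (hWn η hη)
    · obtain ⟨t, hvt, ht⟩ := exists_toward hξ
      refine ContinuousAt.congr (f := fun _ => decompMap b Γ.aug (τ t)) continuousAt_const ?_
      filter_upwards [(isOpen_toward hvt
        (isClosed_limitSet b (Γ.fg_stabilizer b v))).mem_nhds ht] with η hη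
      exact (hρ hvt ((hπ η).mem_treeBranch hvt hη)).symm
  · rintro ⟨t, -, ht⟩
    exact inl_not_mem_treeBranch_self _ _ (hx ▸ ht)
  · rw [hρ hvt hx]
    exact (hπ _).unique (hτ t hvt)

/-- The embedding of the piece of a Type 2 vertex, induced by a continuous extension `φ` of the
inclusion of the vertex group. -/
lemma exists_piece (hconn : ConnectedSpace (DecompSpace b M)) [T2Space (DecompSpace b Γ.aug)]
    (hπ : ∀ ξ, Γ.Lands b ξ (π (decompMap b Γ.aug ξ))) {v : V} (hv : v ∉ Γ.type1) {κ : Type*}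
    [Finite κ] (c : FreeGroupBasis κ (stabilizer F v)) :
    ∃ j : DecompSpace c (Γ.ind v) → DecompSpace b Γ.aug, IsEmbedding j ∧
      Set.range j = {x | ∃ u ∈ closedStar Γ.tree v, π x = Sum.inl u} ∧
      ∀ ξ : FreeBoundary κ, ∃ ξ' : FreeBoundary ι,
        Tendsto (fun h : stabilizer F v => (h : F)) (coneFilter c ξ) (coneFilter b ξ') ∧
        j (decompMap c (Γ.ind v) ξ) = decompMap b Γ.aug ξ' := by
  obtain ⟨φ, hφ, hinj, hlim, hr⟩ := exists_subgroup_boundaryMap b c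
  let j : DecompSpace c (Γ.ind v) → DecompSpace b Γ.aug :=
    Quot.lift (fun ξ => decompMap b Γ.aug (φ ξ)) fun ξ η h => decompMap_eq_of_ind hconn hv hlim h
  have hj : ∀ ξ, j (decompMap c (Γ.ind v) ξ) = decompMap b Γ.aug (φ ξ) := fun _ => rfl
  refine ⟨j, (Continuous.isClosedEmbedding ?_ ?_).isEmbedding, ?_, fun ξ => ⟨φ ξ, hlim ξ, rfl⟩⟩
  · exact (isQuotientMap_decompMap c _).continuous_iff.2
      ((isQuotientMap_decompMap b _).continuous.comp hφ)
  · intro x y h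
    obtain ⟨ξ, rfl⟩ := surjective_decompMap c _ x
    obtain ⟨η, rfl⟩ := surjective_decompMap c _ y
    exact decompMap_ind_eq hv hinj hlim hr h
  · ext x
    obtain ⟨ξ, rfl⟩ := surjective_decompMap b _ x
    rw [Set.mem_ofPred, ← (hπ ξ).mem_limitSet_iff hconn hv]
    constructor
    · rintro ⟨y, hy⟩
      obtain ⟨η, rfl⟩ := surjective_decompMap c _ y
      have h1 : Γ.Lands b ξ (π (decompMap b Γ.aug (φ η))) := by
        rw [← hj, hy]
        exact hπ ξ
      rw [h1.mem_limitSet_iff hconn hv, ← (hπ (φ η)).mem_limitSet_iff hconn hv, ← hr]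
      exact ⟨η, rfl⟩
    · intro hξ
      rw [← hr] at hξ
      obtain ⟨η, rfl⟩ := hξ
      exact ⟨decompMap c _ η, rfl⟩

end QuasiMap

end RelCyclicSplitting

open RelCyclicSplitting
theorem mainTheorem8 {F ι V : Type*} [Group F] [Finite ι] [Nontrivial ι]
    (b : FreeGroupBasis ι F) [MulAction F V] (M : Set F) (hM : M.Finite)
    (hconn : ConnectedSpace (DecompSpace b M)) (Γ : RelCyclicSplitting M V)
    {κ : Γ.Type2 → Type*} (c : ∀ v : Γ.Type2, FreeGroupBasis (κ v) (stabilizer F v.1)) :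
    -- the vertex groups are free of finite rank
    (∀ v, Finite (κ v)) ∧
    ∃ (π : DecompSpace b Γ.aug → V ⊕ TreeEnd Γ.tree)
      (j : ∀ v : Γ.Type2, DecompSpace (c v) (Γ.ind v.1) → DecompSpace b Γ.aug),
      IsCompactifiedTreeOfSpaces Γ.tree Γ.type1 j π ∧
      -- the embeddings of the pieces are induced by the inclusions of the vertex groups
      (∀ (v : Γ.Type2) (ξ : FreeBoundary (κ v)), ∃ ξ' : FreeBoundary ι,
        ConvergesToBoundary b (fun m => ((rayVertex (c v) ξ m : stabilizer F v.1) : F)) ξ' ∧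
        j v (decompMap (c v) (Γ.ind v.1) ξ) = decompMap b Γ.aug ξ') ∧
      -- the quasi-map to the compactified tree is equivariant
      (∀ (g : F) (ξ : FreeBoundary ι), ∃ ξ' : FreeBoundary ι,
        ConvergesToBoundary b (fun m => g * rayVertex b ξ m) ξ' ∧
        π (decompMap b Γ.aug ξ') = Γ.smulCompactified g (π (decompMap b Γ.aug ξ))) ∧
      -- the preimage of a Type 1 vertex is a cut point
      (∀ t ∈ Γ.type1, ∀ x, π x = Sum.inl t → IsCutPoint x) ∧
      -- it is the image of the endpoints of the axis of the stabilizer of the vertex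
      (∀ t ∈ Γ.type1, ∀ g ∈ stabilizer F t, g ≠ 1 → ∃ ξ : FreeBoundary ι,
        ConvergesToBoundary b (fun m => g ^ m) ξ ∧ π (decompMap b Γ.aug ξ) = Sum.inl t) ∧
      -- over an end, the quasi-map is the limit of the orbit map to the tree
      (∀ (ξ : FreeBoundary ι) (r : TreeRay Γ.tree),
        π (decompMap b Γ.aug ξ) = Sum.inr r.toEnd → ∀ (v : V) (k : ℕ), ∀ᶠ m in atTop,
          Sum.inl (rayVertex b ξ m • v) ∈ treeBranch Γ.tree (r.1 k) (r.1 (k + 1))) := by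
  have hF : Nontrivial F := by
    obtain ⟨i, i', hi⟩ := exists_pair_ne ι
    exact ⟨b i, b i', fun h => hi (b.injective h)⟩
  have hκ : ∀ v, Finite (κ v) := fun v =>
    have : Group.FG (stabilizer F v.1) := (Group.fg_iff_subgroup_fg _).2 (Γ.fg_stabilizer b v.1)
    finite_basis_of_fg (c v)
  obtain ⟨W₀, hW₀, hconj⟩ := Γ.exists_finite_aug b hM
  have hT2 : T2Space (DecompSpace b Γ.aug) := t2Space_decompSpace b hW₀ hconj
  obtain ⟨π, hπ⟩ := Γ.exists_quasiMap b
  have hsurj := surjective_quasiMap c hπ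
  choose j hemb hrange hind using fun v : Γ.Type2 => exists_piece hconn hπ v.2 (c v)
  refine ⟨hκ, π, j, ⟨inferInstance, hT2, hsurj, fun t ht => ?_, fun e => ?_, hemb, hrange,
    fun t ht v hv => isOpen_preimage_treeBranch hπ ht hv,
    fun v hv => exists_retraction hconn hπ hv⟩, fun v ξ => ?_, fun g ξ => ?_,
    fun t ht x hx => isCutPoint_of_type1 hconn hπ hsurj ht hx, fun t ht g hg hne => ?_,
    fun ξ r hr v k => ?_⟩
  · obtain ⟨x, hx⟩ := hsurj (Sum.inl t)
    exact ⟨x, hx, fun y hy => eq_of_quasiMap_eq_type1 hconn hπ ht hy hx⟩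
  · obtain ⟨x, hx⟩ := hsurj (Sum.inr e)
    exact ⟨x, hx, fun y hy => eq_of_quasiMap_eq_end hπ hy hx⟩
  · obtain ⟨ξ', hξ', h⟩ := hind v ξ
    exact ⟨ξ', (convergesToBoundary_iff b).2 (hξ'.comp (tendsto_rayVertex (c v) ξ)), h⟩
  · obtain ⟨ξ', hξ'⟩ := exists_tendsto_mul_left b g ξ
    exact ⟨ξ', (convergesToBoundary_iff b).2 (hξ'.comp (tendsto_rayVertex b ξ)),
      (hπ ξ').unique ((hπ ξ).smul hξ')⟩
  · obtain ⟨ξ, hξ, hmem⟩ := exists_limit_of_mem_stabilizer b hg hne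
    exact ⟨ξ, (convergesToBoundary_iff b).2 hξ, (hπ ξ).unique (lands_type1 ht hmem)⟩
  · have h := hπ ξ
    rw [hr] at h
    exact ((tendsto_rayVertex b ξ).eventually (h.landsRay k v)).mono
      fun m hm => inl_mem_treeBranch.2 hm
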